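/- Let $M$ be a smooth manifold of real dimension $6$ with an $SU(3)$-structure $(g,I,\omega,\Omega)$: $g$ is a Riemannian metric, $I$ a $g$-orthogonal almost complex structure, $\omega=g(I\cdot,\cdot)$ its Hermitian form, and $\Omega$ a smooth $(3,0)$-form of unit length, that is, $|\Omega(e_1,e_2,e_3)|=1$ whenever $e_1,e_2,e_3,Ie_1,Ie_2,Ie_3$ are orthonormal. Assume that $M$ is nearly Kähler, that is, for some real constant $\lambda\neq 0$, $$d\omega=3\lambda\,\mathrm{Re}\,\Omega,\qquad d\,\mathrm{Im}\,\Omega=-2\lambda\,\omega\wedge\omega .$$ Let $d^{i,j}$ denote the component of the de Rham differential that maps $\Lambda^{p,q}(M)$ to $\Lambda^{p+i,q+j}(M)$ for all $p,q$, and put $N=d^{2,-1}$, $\bar N=d^{-1,2}$, $\partial=d^{1,0}$, $\bar\partial=d^{0,1}$, $C=N+\bar N$. Then for all $p,q\ge 0$ the following maps $\Lambda^{p,q}(M)\to\Lambda^{p+1,q+1}(M)$ (on smooth complex-valued forms) are $C^\infty(M)$-linear and equal: (i) $C^2$; (ii) $-\{\partial,\bar\partial\}=-(\partial\bar\partial+\bar\partial\partial)$;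 (iii) the scalar operator $2\sqrt{-1}\,\lambda^2(p-q)L_\omega$, that is, $\eta\mapsto 2\sqrt{-1}\,\lambda^2(p-q)\,\eta\wedge\omega$. -/

import Mathlib

open scoped Manifold ContDiff Bundle BigOperators
open Finset

noncomputable section

namespace NK

/-! ### Multilinear algebra of complex-valued alternating forms on a real vector space -/

section Algebra

variable {V : Type*} [AddCommGroup V] [Module ℝ V] [TopologicalSpace V]

/-- The tensor product `(α ⊗ β)(v) = α(v₁,…,v_p) β(v_{p+1},…,v_{p+q})`. -/
def tensorMul {p q : ℕ} (α : V [⋀^Fin p]→L[ℝ] ℂ) (β : V [⋀^Fin q]→L[ℝ] ℂ) :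
    ContinuousMultilinearMap ℝ (fun _ : Fin (p + q) => V) ℂ where
  toFun v := α (fun i => v (Fin.castAdd q i)) * β (fun j => v (Fin.natAdd p j))
  map_update_add' := by
    intro inst v i x y
    obtain rfl : inst = instDecidableEqFin (p + q) := Subsingleton.elim _ _
    induction i using Fin.addCases with
    | left i =>
      have h1 : ∀ z, (fun l => Function.update v (Fin.castAdd q i) z (Fin.castAdd q l)) =
          Function.update (fun l => v (Fin.castAdd q l)) i z := fun z => by
        funext l; by_cases h : l = i
        · subst h; simp
        · have : Fin.castAdd q l ≠ Fin.castAdd q i := fun e => h (Fin.castAdd_injective _ _ e)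
          simp [h, this]
      have h2 : ∀ z, (fun l => Function.update v (Fin.castAdd q i) z (Fin.natAdd p l)) =
          (fun l => v (Fin.natAdd p l)) := fun z => by
        funext l
        have : Fin.natAdd p l ≠ Fin.castAdd q i := fun e => by
          have := congrArg Fin.val e
          simp at this; omega
        simp [this]
      simp only [h1, h2, α.map_update_add, add_mul]
    | right i =>
      have h1 : ∀ z, (fun l => Function.update v (Fin.natAdd p i) z (Fin.natAdd p l)) =
          Function.update (fun l => v (Fin.natAdd p l)) i z := fun z => by
        funext l; by_cases h : l = i
        · subst h; simp
        · have : Fin.natAdd p l ≠ Fin.natAdd p i := fun e => h (Fin.natAdd_injective _ _ e)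
          simp [h, this]
      have h2 : ∀ z, (fun l => Function.update v (Fin.natAdd p i) z (Fin.castAdd q l)) =
          (fun l => v (Fin.castAdd q l)) := fun z => by
        funext l
        have : Fin.castAdd q l ≠ Fin.natAdd p i := fun e => by
          have := congrArg Fin.val e
          simp at this; omega
        simp [this]
      simp only [h1, h2, β.map_update_add, mul_add]
  map_update_smul' := by
    intro inst v i c x
    obtain rfl : inst = instDecidableEqFin (p + q) := Subsingleton.elim _ _
    induction i using Fin.addCases with
    | left i =>
      have h1 : ∀ z, (fun l => Function.update v (Fin.castAdd q i) z (Fin.castAdd q l)) =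
          Function.update (fun l => v (Fin.castAdd q l)) i z := fun z => by
        funext l; by_cases h : l = i
        · subst h; simp
        · have : Fin.castAdd q l ≠ Fin.castAdd q i := fun e => h (Fin.castAdd_injective _ _ e)
          simp [h, this]
      have h2 : ∀ z, (fun l => Function.update v (Fin.castAdd q i) z (Fin.natAdd p l)) =
          (fun l => v (Fin.natAdd p l)) := fun z => by
        funext l
        have : Fin.natAdd p l ≠ Fin.castAdd q i := fun e => by
          have := congrArg Fin.val e
          simp at this; omega
        simp [this]
      simp only [h1, h2, α.map_update_smul, smul_mul_assoc]
    | right i =>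
      have h1 : ∀ z, (fun l => Function.update v (Fin.natAdd p i) z (Fin.natAdd p l)) =
          Function.update (fun l => v (Fin.natAdd p l)) i z := fun z => by
        funext l; by_cases h : l = i
        · subst h; simp
        · have : Fin.natAdd p l ≠ Fin.natAdd p i := fun e => h (Fin.natAdd_injective _ _ e)
          simp [h, this]
      have h2 : ∀ z, (fun l => Function.update v (Fin.natAdd p i) z (Fin.castAdd q l)) =
          (fun l => v (Fin.castAdd q l)) := fun z => by
        funext l
        have : Fin.castAdd q l ≠ Fin.natAdd p i := fun e => by
          have := congrArg Fin.val e
          simp at this; omega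
        simp [this]
      simp only [h1, h2, β.map_update_smul, mul_smul_comm]
  cont := by
    refine Continuous.mul (α.coe_continuous.comp ?_) (β.coe_continuous.comp ?_) <;> fun_prop

@[simp]
theorem tensorMul_apply {p q : ℕ} (α : V [⋀^Fin p]→L[ℝ] ℂ) (β : V [⋀^Fin q]→L[ℝ] ℂ)
    (v : Fin (p + q) → V) :
    tensorMul α β v = α (fun i => v (Fin.castAdd q i)) * β (fun j => v (Fin.natAdd p j)) := rfl

/-- The exterior product
`(α ∧ β)(v) = (1 / (p! q!)) ∑_σ sgn(σ) α(v_{σ(1)},…,v_{σ(p)}) β(v_{σ(p+1)},…,v_{σ(p+q)})`. -/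
def wedge {p q : ℕ} (α : V [⋀^Fin p]→L[ℝ] ℂ) (β : V [⋀^Fin q]→L[ℝ] ℂ) :
    V [⋀^Fin (p + q)]→L[ℝ] ℂ :=
  ((p.factorial * q.factorial : ℂ)⁻¹) •
    ContinuousMultilinearMap.alternatization (tensorMul α β)

/-- For a complex structure `J` on `V`, a form `η` of degree `k` and a set `S` of slots:
the multilinear map `v ↦ η_ℂ(w₁,…,w_k)`, where `η_ℂ` is the complex multilinear extension of `η`
to `V ⊗ ℂ`, and `w_j` is the `(1,0)`-part `(v_j - √-1 J v_j)/2` of `v_j` for `j ∈ S`,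
and the `(0,1)`-part `(v_j + √-1 J v_j)/2` for `j ∉ S`. It is written here in expanded form:
`T` is the set of the slots where the term with `J` is chosen. -/
def slotProj (J : V →L[ℝ] V) {k : ℕ} (S : Finset (Fin k)) (η : V [⋀^Fin k]→L[ℝ] ℂ) :
    ContinuousMultilinearMap ℝ (fun _ : Fin k => V) ℂ :=
  ((2 : ℂ)⁻¹ ^ k) • ∑ T : Finset (Fin k),
    (∏ j ∈ T, (if j ∈ S then -Complex.I else Complex.I)) •
      η.toContinuousMultilinearMap.compContinuousLinearMap
        (fun j => if j ∈ T then J else ContinuousLinearMap.id ℝ V)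

theorem slotProj_apply (J : V →L[ℝ] V) {k : ℕ} (S : Finset (Fin k)) (η : V [⋀^Fin k]→L[ℝ] ℂ)
    (v : Fin k → V) :
    slotProj J S η v = (2 : ℂ)⁻¹ ^ k * ∑ T : Finset (Fin k),
      (∏ j ∈ T, (if j ∈ S then -Complex.I else Complex.I)) *
        η (fun j => if j ∈ T then J (v j) else v j) := by
  simp only [slotProj, smul_apply, _root_.sum_apply,
    smul_eq_mul, ContinuousMultilinearMap.compContinuousLinearMap_apply]
  congr 1
  refine Finset.sum_congr rfl fun T _ => ?_
  congr 1
  change η _ = η _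
  congr 1
  funext j
  split_ifs <;> simp

theorem slotProj_swap (J : V →L[ℝ] V) {k : ℕ} (S : Finset (Fin k)) (η : V [⋀^Fin k]→L[ℝ] ℂ)
    (v : Fin k → V) {i j : Fin k} (hv : v i = v j) (hij : i ≠ j) :
    slotProj J (S.map (Equiv.swap i j).toEmbedding) η v = -slotProj J S η v := by
  have hve : ∀ l, v (Equiv.swap i j l) = v l := fun l => by
    by_cases h1 : l = i
    · subst h1; simp [hv]
    · by_cases h2 : l = j
      · subst h2; simp [hv]
      · rw [Equiv.swap_apply_of_ne_of_ne h1 h2]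
  rw [slotProj_apply, slotProj_apply, ← mul_neg, ← Finset.sum_neg_distrib]
  congr 1
  symm
  refine Fintype.sum_equiv (Equiv.finsetCongr (Equiv.swap i j)) _ _ fun T => ?_
  have h1 : (∏ l ∈ (Equiv.finsetCongr (Equiv.swap i j)) T,
      (if l ∈ S.map (Equiv.swap i j).toEmbedding then -Complex.I else Complex.I)) =
      ∏ l ∈ T, (if l ∈ S then -Complex.I else Complex.I) := by
    simp [Equiv.finsetCongr_apply, Finset.prod_map]
  have h2 : (fun l => if l ∈ (Equiv.finsetCongr (Equiv.swap i j)) T then J (v l) else v l) =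
      (fun l => if l ∈ T then J (v l) else v l) ∘ (Equiv.swap i j) := by
    funext l
    have : l ∈ (Equiv.finsetCongr (Equiv.swap i j)) T ↔ Equiv.swap i j l ∈ T := by
      rw [Equiv.finsetCongr_apply, Finset.mem_map_equiv, Equiv.symm_swap]
    simp only [Function.comp, this, hve]
  have h3 := η.toAlternatingMap.map_swap (fun l => if l ∈ T then J (v l) else v l) hij
  simp only [ContinuousAlternatingMap.coe_toAlternatingMap] at h3
  rw [h1, h2, h3, mul_neg]

/-- The projection of a `k`-form to its component of Hodge type `(p,q)`: the sum of the
components with `p` slots of type `(1,0)` and `q` slots of type `(0,1)`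
(this is `0` unless `p + q = k`). -/
def typeProj (J : V →L[ℝ] V) {k : ℕ} (p q : ℤ) (η : V [⋀^Fin k]→L[ℝ] ℂ) :
    V [⋀^Fin k]→L[ℝ] ℂ :=
  { (∑ S : Finset (Fin k) with (#S : ℤ) = p ∧ (#Sᶜ : ℤ) = q, slotProj J S η) with
    map_eq_zero_of_eq' := by
      intro v i j hv hij
      change (∑ S : Finset (Fin k) with (#S : ℤ) = p ∧ (#Sᶜ : ℤ) = q, slotProj J S η) v = 0
      rw [_root_.sum_apply]
      have key : (∑ S : Finset (Fin k) with (#S : ℤ) = p ∧ (#Sᶜ : ℤ) = q, slotProj J S η v) =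
          ∑ S : Finset (Fin k) with (#S : ℤ) = p ∧ (#Sᶜ : ℤ) = q, -slotProj J S η v := by
        symm
        refine Finset.sum_equiv (Equiv.finsetCongr (Equiv.swap i j)) ?_ ?_
        · intro S
          simp [Equiv.finsetCongr_apply, Finset.card_compl]
        · intro S _
          rw [Equiv.finsetCongr_apply, slotProj_swap J S η v hv hij]
      rw [Finset.sum_neg_distrib] at key
      exact self_eq_neg.1 key }

end Algebra

/-! ### Differential forms on a 6-manifold -/

/-- The model space `ℝ⁶`. -/
abbrev E6 : Type := EuclideanSpace ℝ (Fin 6)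

section Forms

variable {M : Type*} [TopologicalSpace M] [ChartedSpace E6 M]

variable (M) in
/-- Complex-valued differential `k`-forms on `M`, without any regularity. -/
abbrev Form (k : ℕ) : Type _ := ∀ x : M, TangentSpace (𝓡 6) x [⋀^Fin k]→L[ℝ] ℂ

/-- The form `η` in the preferred chart at `x₀`: its pullback by the inverse of the chart. -/
def localRep {k : ℕ} (η : Form M k) (x₀ : M) (y : E6) : E6 [⋀^Fin k]→L[ℝ] ℂ :=
  (η ((chartAt E6 x₀).symm y)).compContinuousLinearMap
    (mfderiv (𝓡 6) (𝓡 6) (chartAt E6 x₀).symm y :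
      E6 →L[ℝ] TangentSpace (𝓡 6) ((chartAt E6 x₀).symm y))

/-- Smoothness of a differential form: smoothness of its coordinate expressions. -/
def IsSmooth {k : ℕ} (η : Form M k) : Prop :=
  ∀ x₀ : M, ContDiffOn ℝ ∞ (localRep η x₀) (chartAt E6 x₀).target

/-- The de Rham differential, computed at `x` in the preferred chart at `x`. -/
def deRham {k : ℕ} (η : Form M k) : Form M (k + 1) := fun x =>
  (extDeriv (localRep η x) (chartAt E6 x x)).compContinuousLinearMap
    (mfderiv (𝓡 6) (𝓡 6) (chartAt E6 x) x : TangentSpace (𝓡 6) x →L[ℝ] E6)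

/-- The exterior product of differential forms. -/
def Form.wedge {k l : ℕ} (α : Form M k) (β : Form M l) : Form M (k + l) :=
  fun x => NK.wedge (α x) (β x)

/-- The real part of a complex-valued form, as a complex-valued form. -/
def Form.rePart {k : ℕ} (η : Form M k) : Form M k := fun x =>
  (Complex.ofRealCLM.comp Complex.reCLM).compContinuousAlternatingMap (η x)

/-- The imaginary part of a complex-valued form, as a complex-valued form. -/
def Form.imPart {k : ℕ} (η : Form M k) : Form M k := fun x =>
  (Complex.ofRealCLM.comp Complex.imCLM).compContinuousAlternatingMap (η x)

/-- Multiplication of a form by a complex-valued function. -/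
def Form.funMul {k : ℕ} (f : M → ℂ) (η : Form M k) : Form M k := fun x => f x • η x

variable (J : ∀ x : M, TangentSpace (𝓡 6) x →L[ℝ] TangentSpace (𝓡 6) x)

/-- The `(p,q)`-component of a form on an almost complex manifold. -/
def hodgeProj {k : ℕ} (p q : ℤ) (η : Form M k) : Form M k := fun x => typeProj (J x) p q (η x)

/-- `η` is a smooth form of Hodge type `(p,q)`, that is, a section of `Λ^{p,q}(M)`. -/
structure IsSection {k : ℕ} (p q : ℤ) (η : Form M k) : Prop where
  smooth : IsSmooth η
  type : hodgeProj J p q η = η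

/-- The Hodge component `d^{i,j}` of the de Rham differential:
on `Λ^{p,q}(M)` it is the `(p+i,q+j)`-component of `d`. -/
def dComp (i j : ℤ) {k : ℕ} (η : Form M k) : Form M (k + 1) :=
  ∑ pq ∈ antidiagonal k,
    hodgeProj J (pq.1 + i) (pq.2 + j) (deRham (hodgeProj J pq.1 pq.2 η))

/-- `∂ = d^{1,0}`. -/
def del {k : ℕ} (η : Form M k) : Form M (k + 1) := dComp J 1 0 η

/-- `∂̄ = d^{0,1}`. -/
def delbar {k : ℕ} (η : Form M k) : Form M (k + 1) := dComp J 0 1 η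

/-- `N = d^{2,-1}`. -/
def nij {k : ℕ} (η : Form M k) : Form M (k + 1) := dComp J 2 (-1) η

/-- `N̄ = d^{-1,2}`. -/
def nijbar {k : ℕ} (η : Form M k) : Form M (k + 1) := dComp J (-1) 2 η

/-- `C = N + N̄`. -/
def opC {k : ℕ} (η : Form M k) : Form M (k + 1) := nij J η + nijbar J η

end Forms

/-! ### Nearly Kähler 6-manifolds -/

/-- An `SU(3)`-structure on a 6-manifold: a Riemannian metric `g`, an orthogonal almost complex
structure `J`, the Hermitian form `ω = g(J·,·)`, and a `(3,0)`-form `Ω` of unit length.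
Unit length is measured on unitary frames: `|Ω(e₁,e₂,e₃)| = 1` whenever
`e₁, e₂, e₃, Je₁, Je₂, Je₃` are `g`-orthonormal. -/
structure SU3Structure (M : Type*) [TopologicalSpace M] [ChartedSpace E6 M]
    [IsManifold (𝓡 6) ∞ M] where
  g : Bundle.ContMDiffRiemannianMetric (𝓡 6) ∞ E6 (fun x : M => TangentSpace (𝓡 6) x)
  J : ∀ x : M, TangentSpace (𝓡 6) x →L[ℝ] TangentSpace (𝓡 6) x
  J_smooth : ContMDiff (𝓡 6) ((𝓡 6).prod 𝓘(ℝ, E6 →L[ℝ] E6)) ∞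
    (fun x => Bundle.TotalSpace.mk' (E6 →L[ℝ] E6)
      (E := fun x : M => TangentSpace (𝓡 6) x →L[ℝ] TangentSpace (𝓡 6) x) x (J x))
  J_sq : ∀ x v, J x (J x v) = -v
  J_orthogonal : ∀ x u v, g.inner x (J x u) (J x v) = g.inner x u v
  omega : Form M 2
  omega_smooth : IsSmooth omega
  omega_apply : ∀ (x : M) (u v : TangentSpace (𝓡 6) x), omega x ![u, v] = (g.inner x (J x u) v : ℂ)
  Omega : Form M 3
  Omega_section : IsSection J 3 0 Omega
  Omega_unit : ∀ (x : M) (e : Fin 3 → TangentSpace (𝓡 6) x),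
    (∀ a b, g.inner x (e a) (e b) = if a = b then 1 else 0) →
    (∀ a b, g.inner x (e a) (J x (e b)) = 0) → ‖Omega x e‖ = 1

/-- An `SU(3)`-structure is nearly Kähler, with constant `lam`, if `lam ≠ 0` and
`dω = 3 lam Re Ω`, `d Im Ω = -2 lam ω²`. -/
structure SU3Structure.IsNearlyKahler {M : Type*} [TopologicalSpace M] [ChartedSpace E6 M]
    [IsManifold (𝓡 6) ∞ M] (s : SU3Structure M) (lam : ℝ) : Prop where
  ne_zero : lam ≠ 0
  d_omega : deRham s.omega = (3 * lam : ℂ) • s.Omega.rePart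
  d_im : deRham s.Omega.imPart = (-2 * lam : ℂ) • Form.wedge s.omega s.omega

end NK

end

/-!
The proof is local and reduces everything to linear algebra at a point.

*The operator `C` is algebraic.* Let `J` be an almost complex structure on an open set of a vector
space. The flat connection, corrected by `B_u = -½ J (∂_u J)` (`connForm`), makes `J` parallel, so
it preserves Hodge types. Hence on forms of type `(p,q)`, i.e. of weight `p - q` for the derivation
`J` (`HasWeight`), the exterior derivative is the sum of terms of weight `p - q ± 1` and of the
derivation of degree one attached to the part `B⁻` of `B` that is complex antilinear in `u`
(`connMinus`), which has weights `p - q ± 3` only (`typeProj_extDeriv_sub`). So `C = N + N̄` is the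
derivation `contract B⁻` (`locComp_add_locComp`), and `d = ∂ + ∂̄ + C` (`extDeriv_eq_locComp`).
The component of bidegree `(1,1)` of `d² = 0` reads `∂∂̄ + ∂̄∂ + N N̄ + N̄ N = 0`
(`locComp_anticomm`). Consequently `C² = -{∂,∂̄}` on a form of type `(p,q)` as soon as `C²` maps it
to type `(p+1,q+1)` (`locC_locC_eq_neg`); this makes (ii) a consequence of (iii).

*The torsion.* Put `T(u,v) = B⁻_u v - B⁻_v u`. The nearly Kähler equations give `d Re Ω = 0`, as
`λ ≠ 0`, hence `dΩ = -2√-1 λ ω ∧ ω`, and `CΩ` is the component of type `(2,2)` of `dΩ`, which is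
all of it (`IsNearlyKahlerOn.contract_Omega`). Since `T` is complex antilinear in both arguments,
the equation `CΩ = -2√-1 λ ω ∧ ω` can be solved for `T`: in terms of the Hermitian form `h`,
`Ω(T(a,b),x,y) = -√-1 λ (h(a,x) h(b,y) - h(a,y) h(b,x))` (`val3_torsion`). In a unitary frame
`Ω` is a unit multiple of the determinant, and `T` is `λ` times a complex conjugate vector product,
up to a unit. The identity for iterated vector products then shows that the cyclic sum of
`T(T(u,v),x)` is `2 λ² (ω ∧ J)(u,v,x)` (`torsion_torsion`).

*The square of `C`.* For any `B` whose torsion satisfies such an identity, `(contract B)²` is a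
multiple of `η ↦ ω ∧ (J · η)`; this follows by induction on the degree, taking interior products
(`contract_contract`). On type `(p,q)` the derivation `J` is the scalar `√-1 (p - q)`, which is
(iii). Function linearity is then plain.

*Charts.* `extDeriv` commutes with pullbacks, so the de Rham differential is computed by `extDeriv`
in every preferred chart (`localRep_deRham`), and a nearly Kähler structure induces one on each
chart domain (`SU3Structure.IsNearlyKahler.isNearlyKahlerOn`). Forms are equal if their coordinate
expressions are (`form_ext`).
-/

noncomputable section

namespace NK

/-! ### Derivations of the algebra of forms and the Lefschetz operator -/

section ExteriorAlgebra

open ContinuousAlternatingMap hiding add_apply sub_apply neg_apply smul_apply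

variable {E : Type*} [NormedAddCommGroup E] [NormedSpace ℝ E]

/-- The action of an endomorphism `A` on forms as a derivation of degree `0`:
`(A · η)(v) = ∑ⱼ η(v₁,…,A vⱼ,…,v_k)`. -/
def derAct {k : ℕ} (A : E →L[ℝ] E) (η : E [⋀^Fin k]→L[ℝ] ℂ) : E [⋀^Fin k]→L[ℝ] ℂ :=
  η.fderivCompContinuousLinearMap (.id ℝ E) A

/-- The derivation of degree `1` on forms attached to a family of endomorphisms `B`: the
alternation `∑ₐ eᵃ ∧ (B_{eₐ} · η)` of `u ↦ B_u · η`. It only depends on the antisymmetrisation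
`B_u v - B_v u`. -/
def contract {k : ℕ} (B : E →L[ℝ] E →L[ℝ] E) (η : E [⋀^Fin k]→L[ℝ] ℂ) :
    E [⋀^Fin (k + 1)]→L[ℝ] ℂ :=
  alternatizeUncurryFin (η.fderivCompContinuousLinearMap (.id ℝ E) ∘L B)

/-- The map `β ↦ β ∧ η` on real one-forms. -/
def extMul {k : ℕ} (η : E [⋀^Fin k]→L[ℝ] ℂ) : (E →L[ℝ] ℝ) →L[ℝ] E [⋀^Fin (k + 1)]→L[ℝ] ℂ :=
  alternatizeUncurryFinCLM ℝ E ℂ ∘L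
    (ContinuousLinearMap.smulRightL ℝ E (E [⋀^Fin k]→L[ℝ] ℂ)).flip η

/-- The Lefschetz operator of a real bilinear form `w`: for alternating `w` it is exterior
multiplication by `w`, written as `½ ∑ₐ eᵃ ∧ w(eₐ, ·) ∧ η` in a basis `eₐ` with dual
basis `eᵃ`. -/
def lef {k : ℕ} (w : E →L[ℝ] E →L[ℝ] ℝ) (η : E [⋀^Fin k]→L[ℝ] ℂ) :
    E [⋀^Fin (k + 2)]→L[ℝ] ℂ :=
  (2 : ℝ)⁻¹ • alternatizeUncurryFin (extMul η ∘L w)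

variable {k : ℕ}

theorem derAct_apply (A : E →L[ℝ] E) (η : E [⋀^Fin k]→L[ℝ] ℂ) (v : Fin k → E) :
    derAct A η v = ∑ j, η (Function.update v j (A (v j))) := by
  rw [derAct, fderivCompContinuousLinearMap_apply]
  refine Finset.sum_congr rfl fun j _ => congrArg η ?_
  funext l
  by_cases h : l = j
  · subst h; simp
  · simp [h]

theorem derAct_zero_form (A : E →L[ℝ] E) (η : E [⋀^Fin 0]→L[ℝ] ℂ) : derAct A η = 0 := by
  ext v; simp [derAct_apply]

theorem derAct_add (A : E →L[ℝ] E) (η θ : E [⋀^Fin k]→L[ℝ] ℂ) :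
    derAct A (η + θ) = derAct A η + derAct A θ := by
  ext v; simp [derAct_apply, Finset.sum_add_distrib]

theorem derAct_sub (A : E →L[ℝ] E) (η θ : E [⋀^Fin k]→L[ℝ] ℂ) :
    derAct A (η - θ) = derAct A η - derAct A θ := by
  ext v; simp [derAct_apply]

theorem derAct_smul (A : E →L[ℝ] E) (c : ℂ) (η : E [⋀^Fin k]→L[ℝ] ℂ) :
    derAct A (c • η) = c • derAct A η := by
  ext v; simp [derAct_apply, Finset.mul_sum]

theorem derAct_real_smul (A : E →L[ℝ] E) (c : ℝ) (η : E [⋀^Fin k]→L[ℝ] ℂ) :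
    derAct A (c • η) = c • derAct A η := by
  ext v; simp [derAct_apply, Finset.mul_sum]

theorem derAct_map_add (A B : E →L[ℝ] E) (η : E [⋀^Fin k]→L[ℝ] ℂ) :
    derAct (A + B) η = derAct A η + derAct B η := map_add _ _ _

theorem derAct_map_sub (A B : E →L[ℝ] E) (η : E [⋀^Fin k]→L[ℝ] ℂ) :
    derAct (A - B) η = derAct A η - derAct B η := map_sub _ _ _

theorem derAct_map_neg (A : E →L[ℝ] E) (η : E [⋀^Fin k]→L[ℝ] ℂ) :
    derAct (-A) η = -derAct A η := map_neg _ _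

theorem derAct_map_smul (c : ℝ) (A : E →L[ℝ] E) (η : E [⋀^Fin k]→L[ℝ] ℂ) :
    derAct (c • A) η = c • derAct A η := map_smul _ _ _

/-- The interior product `ι_u η = η(u, ·)`. -/
def int {k : ℕ} (u : E) (η : E [⋀^Fin (k + 1)]→L[ℝ] ℂ) : E [⋀^Fin k]→L[ℝ] ℂ := η.curryLeft u

theorem int_apply (u : E) (η : E [⋀^Fin (k + 1)]→L[ℝ] ℂ) (v : Fin k → E) :
    int u η v = η (Matrix.vecCons u v) := rfl

theorem int_add (u : E) (η θ : E [⋀^Fin (k + 1)]→L[ℝ] ℂ) : int u (η + θ) = int u η + int u θ :=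
  rfl

theorem int_sub (u : E) (η θ : E [⋀^Fin (k + 1)]→L[ℝ] ℂ) : int u (η - θ) = int u η - int u θ :=
  rfl

theorem int_smul (u : E) (c : ℂ) (η : E [⋀^Fin (k + 1)]→L[ℝ] ℂ) : int u (c • η) = c • int u η :=
  rfl

theorem int_real_smul (u : E) (c : ℝ) (η : E [⋀^Fin (k + 1)]→L[ℝ] ℂ) :
    int u (c • η) = c • int u η := rfl

theorem int_vec_add (u v : E) (η : E [⋀^Fin (k + 1)]→L[ℝ] ℂ) :
    int (u + v) η = int u η + int v η := map_add _ _ _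

theorem int_vec_sub (u v : E) (η : E [⋀^Fin (k + 1)]→L[ℝ] ℂ) :
    int (u - v) η = int u η - int v η := map_sub _ _ _

theorem int_vec_smul (c : ℝ) (u : E) (η : E [⋀^Fin (k + 1)]→L[ℝ] ℂ) :
    int (c • u) η = c • int u η := map_smul _ _ _

/-- Forms of positive degree are equal as soon as their interior products are. -/
theorem ext_int {η θ : E [⋀^Fin (k + 1)]→L[ℝ] ℂ} (h : ∀ u, int u η = int u θ) : η = θ := by
  ext v
  have := congrArg (fun f => f (Matrix.vecTail v)) (h (Matrix.vecHead v))
  simpa only [int_apply, Matrix.cons_head_tail] using this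

theorem int_int_self (η : E [⋀^Fin (k + 2)]→L[ℝ] ℂ) (u : E) : int u (int u η) = 0 :=
  curryLeft_same η u

theorem int_anticomm (η : E [⋀^Fin (k + 2)]→L[ℝ] ℂ) (u v : E) :
    int v (int u η) = -int u (int v η) := by
  have h := int_int_self η (u + v)
  simp only [int_vec_add, int_add, int_int_self, zero_add, add_zero] at h
  exact eq_neg_of_add_eq_zero_left h

/-- The family `v ↦ ι_u (f v)`. -/
def intFamily (u : E) (f : E →L[ℝ] E [⋀^Fin (k + 1)]→L[ℝ] ℂ) : E →L[ℝ] E [⋀^Fin k]→L[ℝ] ℂ :=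
  ((curryLeftLI (𝕜 := ℝ) (E := E) (F := ℂ) (n := k)).toContinuousLinearMap ∘L f).flip u

@[simp]
theorem intFamily_apply (u v : E) (f : E →L[ℝ] E [⋀^Fin (k + 1)]→L[ℝ] ℂ) :
    intFamily u f v = int u (f v) := rfl

theorem alternatize_sub (f g : E →L[ℝ] E [⋀^Fin k]→L[ℝ] ℂ) :
    alternatizeUncurryFin (f - g) = alternatizeUncurryFin f - alternatizeUncurryFin g := by
  ext v
  simp [alternatizeUncurryFin_apply, mul_sub]

theorem alternatize_neg (f : E →L[ℝ] E [⋀^Fin k]→L[ℝ] ℂ) :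
    alternatizeUncurryFin (-f) = -alternatizeUncurryFin f := by
  ext v
  simp [alternatizeUncurryFin_apply]

/-- The product rule for interior products, `alternatizeUncurryFin f` being `∑ₐ eᵃ ∧ f(eₐ)`. -/
theorem int_alternatize (f : E →L[ℝ] E [⋀^Fin (k + 1)]→L[ℝ] ℂ) (u : E) :
    int u (alternatizeUncurryFin f) = f u - alternatizeUncurryFin (intFamily u f) := by
  ext v
  rw [int_apply, alternatizeUncurryFin_apply, Fin.sum_univ_succ,
    ContinuousAlternatingMap.sub_apply, alternatizeUncurryFin_apply, sub_eq_add_neg,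
    ← Finset.sum_neg_distrib]
  congr 1
  · simp [Fin.removeNth_zero]
  · refine Finset.sum_congr rfl fun i _ => ?_
    have : Fin.removeNth i.succ (Matrix.vecCons u v) = Matrix.vecCons u (Fin.removeNth i v) := by
      funext l
      induction l using Fin.cases <;> simp [Fin.removeNth]
    rw [this]
    simp [pow_succ, int_apply]

theorem int_alternatize_zero (f : E →L[ℝ] E [⋀^Fin 0]→L[ℝ] ℂ) (u : E) :
    int u (alternatizeUncurryFin f) = f u := by
  ext v
  rw [int_apply, alternatizeUncurryFin_apply]
  simp

theorem int_derAct (A : E →L[ℝ] E) (η : E [⋀^Fin (k + 1)]→L[ℝ] ℂ) (u : E) :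
    int u (derAct A η) = derAct A (int u η) + int (A u) η := by
  ext v
  rw [ContinuousAlternatingMap.add_apply, derAct_apply, int_apply, derAct_apply, int_apply,
    Fin.sum_univ_succ, add_comm]
  congr 1
  · refine Finset.sum_congr rfl fun i _ => ?_
    rw [int_apply]
    refine congrArg η ?_
    funext l
    induction l using Fin.cases with
    | zero => rw [Function.update_of_ne (Fin.succ_ne_zero i).symm]; rfl
    | succ l =>
      by_cases h : l = i
      · subst h; simp
      · simp [h]
  · refine congrArg η ?_
    funext l
    induction l using Fin.cases <;> simp

/-- The derivation `A · η` as the alternation of `v ↦ ι_{A v} η`. -/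
theorem alternatize_curryLeft_comp (A : E →L[ℝ] E) (η : E [⋀^Fin (k + 1)]→L[ℝ] ℂ) :
    alternatizeUncurryFin (η.curryLeft ∘L A) = derAct A η := by
  rw [derAct, fderivCompContinuousLinearMap_eq_alternatizeUncurryFin]
  rw [ContinuousLinearMap.comp_apply, alternatizeUncurryFinCLM_apply]
  congr 1

theorem derAct_id (η : E [⋀^Fin k]→L[ℝ] ℂ) : derAct (.id ℝ E) η = (k : ℝ) • η := by
  ext v; simp [derAct_apply]

/-- On forms, which are contravariant, commutators are reversed. -/
theorem derAct_comm (A B : E →L[ℝ] E) (η : E [⋀^Fin k]→L[ℝ] ℂ) :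
    derAct A (derAct B η) - derAct B (derAct A η) = derAct (B ∘L A - A ∘L B) η := by
  induction k with
  | zero => simp [derAct_zero_form]
  | succ k ih =>
    refine ext_int fun u => ?_
    have hv : (B ∘L A - A ∘L B) u = B (A u) - A (B u) := rfl
    rw [int_derAct, ← ih, hv]
    simp only [int_sub, int_derAct, derAct_add, int_vec_sub]
    abel

/-- Alternation is equivariant for the action of endomorphisms: `g` is the result of letting `A`
act on the form-valued one-form `f`. -/
theorem derAct_alternatize (A : E →L[ℝ] E) (f g : E →L[ℝ] E [⋀^Fin k]→L[ℝ] ℂ)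
    (h : ∀ u, g u = derAct A (f u) + f (A u)) :
    derAct A (alternatizeUncurryFin f) = alternatizeUncurryFin g := by
  induction k with
  | zero =>
    refine ext_int fun u => ?_
    rw [int_derAct, int_alternatize_zero, int_alternatize_zero, int_alternatize_zero, h]
  | succ k ih =>
    refine ext_int fun u => ?_
    rw [int_derAct, int_alternatize, int_alternatize, int_alternatize, derAct_sub, h,
      ih (intFamily u f) (intFamily u g - intFamily (A u) f), alternatize_sub]
    · abel
    · intro v
      have hv : (intFamily u g - intFamily (A u) f) v = int u (g v) - int (A u) (f v) := rfl
      rw [hv, h, int_add, int_derAct, intFamily_apply, intFamily_apply]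
      abel

theorem contract_zero_form (B : E →L[ℝ] E →L[ℝ] E) (η : E [⋀^Fin 0]→L[ℝ] ℂ) :
    contract B η = 0 := by
  refine ext_int fun u => ?_
  rw [contract, int_alternatize_zero]
  exact derAct_zero_form (B u) η

/-- The anticommutator of an interior product with `contract B` is a derivation of degree `0`. -/
theorem int_contract (B : E →L[ℝ] E →L[ℝ] E) (η : E [⋀^Fin (k + 1)]→L[ℝ] ℂ) (u : E) :
    int u (contract B η) = derAct (B u - B.flip u) η - contract B (int u η) := by
  have h : intFamily u (η.fderivCompContinuousLinearMap (.id ℝ E) ∘L B) =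
      (int u η).fderivCompContinuousLinearMap (.id ℝ E) ∘L B + η.curryLeft ∘L B.flip u := by
    ext1 v
    exact int_derAct (B v) η u
  rw [contract, int_alternatize, h, alternatizeUncurryFin_add, alternatize_curryLeft_comp,
    derAct_map_sub, contract]
  change derAct (B u) η - _ = _
  abel

theorem extMul_apply (η : E [⋀^Fin k]→L[ℝ] ℂ) (β : E →L[ℝ] ℝ) :
    extMul η β = alternatizeUncurryFin (β.smulRight η) := rfl

theorem int_extMul_zero (η : E [⋀^Fin 0]→L[ℝ] ℂ) (β : E →L[ℝ] ℝ) (u : E) :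
    int u (extMul η β) = β u • η := by
  rw [extMul_apply, int_alternatize_zero]; rfl

theorem int_extMul (η : E [⋀^Fin (k + 1)]→L[ℝ] ℂ) (β : E →L[ℝ] ℝ) (u : E) :
    int u (extMul η β) = β u • η - extMul (int u η) β := by
  rw [extMul_apply, int_alternatize]; rfl

theorem extMul_add (η θ : E [⋀^Fin k]→L[ℝ] ℂ) : extMul (η + θ) = extMul η + extMul θ := by
  ext1 β
  exact map_add ((alternatizeUncurryFinCLM ℝ E ℂ) ∘L
    (ContinuousLinearMap.smulRightL ℝ E (E [⋀^Fin k]→L[ℝ] ℂ) β)) η θ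

theorem extMul_smul (c : ℂ) (η : E [⋀^Fin k]→L[ℝ] ℂ) (β : E →L[ℝ] ℝ) :
    extMul (c • η) β = c • extMul η β := by
  rw [extMul_apply, extMul_apply, ← alternatizeUncurryFin_smul]
  congr 1
  ext1 u
  exact smul_comm (β u) c η

/-- `β ∧ ι_a η` is the action of the rank one endomorphism `β(·) a` on `η`. -/
theorem extMul_int (η : E [⋀^Fin (k + 1)]→L[ℝ] ℂ) (β : E →L[ℝ] ℝ) (a : E) :
    extMul (int a η) β = derAct (β.smulRight a) η := by
  rw [extMul_apply, ← alternatize_curryLeft_comp]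
  congr 1
  ext1 u
  exact (int_vec_smul (β u) a η).symm

theorem derAct_extMul (A : E →L[ℝ] E) (η : E [⋀^Fin k]→L[ℝ] ℂ) (β : E →L[ℝ] ℝ) :
    derAct A (extMul η β) = extMul (derAct A η) β + extMul η (β ∘L A) := by
  rw [extMul_apply, extMul_apply, extMul_apply, ← alternatizeUncurryFin_add]
  refine derAct_alternatize _ _ _ fun u => ?_
  change β u • derAct A η + β (A u) • η = derAct A (β u • η) + β (A u) • η
  rw [derAct_real_smul]

theorem lef_smul (w : E →L[ℝ] E →L[ℝ] ℝ) (c : ℂ) (η : E [⋀^Fin k]→L[ℝ] ℂ) :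
    lef w (c • η) = c • lef w η := by
  have h1 : extMul (c • η) ∘L w = c • (extMul η ∘L w) := by
    ext1 u
    exact extMul_smul c η (w u)
  rw [lef, lef, h1, alternatizeUncurryFin_smul]
  ext v
  exact smul_comm _ _ _

theorem lef_add (w : E →L[ℝ] E →L[ℝ] ℝ) (η θ : E [⋀^Fin k]→L[ℝ] ℂ) :
    lef w (η + θ) = lef w η + lef w θ := by
  rw [lef, lef, lef, extMul_add, ContinuousLinearMap.add_comp, alternatizeUncurryFin_add]
  module

theorem lef_neg (w : E →L[ℝ] E →L[ℝ] ℝ) (η : E [⋀^Fin k]→L[ℝ] ℂ) : lef w (-η) = -lef w η := by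
  have h := lef_smul w (-1) η
  have h1 : ∀ {l : ℕ} (θ : E [⋀^Fin l]→L[ℝ] ℂ), (-1 : ℂ) • θ = -θ := fun θ => by ext; simp
  rwa [h1, h1] at h

/-- The product rule `ι_u (w ∧ η) = w(u, ·) ∧ η + w ∧ ι_u η`. -/
theorem int_lef (w : E →L[ℝ] E →L[ℝ] ℝ) (hw : ∀ u v, w v u = -w u v)
    (η : E [⋀^Fin (k + 1)]→L[ℝ] ℂ) (u : E) :
    int u (lef w η) = extMul η (w u) + lef w (int u η) := by
  have h : intFamily u (extMul η ∘L w) = -((w u).smulRight η) - extMul (int u η) ∘L w := by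
    ext1 v
    change int u (extMul η (w v)) = -(w u v • η) - extMul (int u η) (w v)
    rw [int_extMul, hw u v]
    module
  have h2 : alternatizeUncurryFin (-((w u).smulRight η)) = - extMul η (w u) := by
    rw [extMul_apply, alternatize_neg]
  rw [lef, lef, int_real_smul, int_alternatize, h, alternatize_sub, h2]
  change (2 : ℝ)⁻¹ • (extMul η (w u) - _) = _
  module

theorem int_lef_zero (w : E →L[ℝ] E →L[ℝ] ℝ) (hw : ∀ u v, w v u = -w u v)
    (η : E [⋀^Fin 0]→L[ℝ] ℂ) (u : E) :
    int u (lef w η) = extMul η (w u) := by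
  have h : intFamily u (extMul η ∘L w) = -((w u).smulRight η) := by
    ext1 v
    change int u (extMul η (w v)) = -(w u v • η)
    rw [int_extMul_zero, hw u v]
    module
  have h2 : alternatizeUncurryFin (-((w u).smulRight η)) = - extMul η (w u) := by
    rw [extMul_apply, alternatize_neg]
  rw [lef, int_real_smul, int_alternatize, h, h2]
  change (2 : ℝ)⁻¹ • (extMul η (w u) - _) = _
  module

/-- If `J` leaves the alternating form `w` infinitesimally invariant, then exterior multiplication
by `w` commutes with the action of `J`. -/
theorem derAct_lef (J : E →L[ℝ] E) (w : E →L[ℝ] E →L[ℝ] ℝ)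
    (hJ : ∀ u v, w (J u) v = -w u (J v)) (η : E [⋀^Fin k]→L[ℝ] ℂ) :
    derAct J (lef w η) = lef w (derAct J η) := by
  rw [lef, lef, derAct_real_smul]
  congr 1
  refine derAct_alternatize _ _ _ fun u => ?_
  change extMul (derAct J η) (w u) = derAct J (extMul η (w u)) + extMul η (w (J u))
  have : w (J u) = -(w u ∘L J) := by ext v; simp [hJ]
  rw [derAct_extMul, this, map_neg]
  abel

theorem contract_smul (B : E →L[ℝ] E →L[ℝ] E) (c : ℂ) (η : E [⋀^Fin k]→L[ℝ] ℂ) :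
    contract B (c • η) = c • contract B η := by
  rw [contract, contract, ← alternatizeUncurryFin_smul]
  congr 1
  refine ContinuousLinearMap.ext fun u => ?_
  exact derAct_smul (B u) c η

theorem contract_add (B : E →L[ℝ] E →L[ℝ] E) (η θ : E [⋀^Fin k]→L[ℝ] ℂ) :
    contract B (η + θ) = contract B η + contract B θ := by
  rw [contract, contract, contract, ← alternatizeUncurryFin_add]
  congr 1
  refine ContinuousLinearMap.ext fun u => ?_
  exact derAct_add (B u) η θ

theorem contract_sub (B : E →L[ℝ] E →L[ℝ] E) (η θ : E [⋀^Fin k]→L[ℝ] ℂ) :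
    contract B (η - θ) = contract B η - contract B θ := by
  rw [contract, contract, contract, ← alternatize_sub]
  congr 1
  refine ContinuousLinearMap.ext fun u => ?_
  exact derAct_sub (B u) η θ

theorem contract_map_add (B C : E →L[ℝ] E →L[ℝ] E) (η : E [⋀^Fin k]→L[ℝ] ℂ) :
    contract (B + C) η = contract B η + contract C η := by
  rw [contract, contract, contract, ← alternatizeUncurryFin_add]
  congr 1
  refine ContinuousLinearMap.ext fun u => ?_
  exact derAct_map_add (B u) (C u) η

theorem contract_map_smul (c : ℝ) (B : E →L[ℝ] E →L[ℝ] E) (η : E [⋀^Fin k]→L[ℝ] ℂ) :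
    contract (c • B) η = c • contract B η := by
  rw [contract, contract, ← alternatizeUncurryFin_smul]
  congr 1
  refine ContinuousLinearMap.ext fun u => ?_
  exact derAct_map_smul c (B u) η

/-- The action of an endomorphism `A` on `contract B`, where `C` is the result of letting `A` act
on the vector-valued bilinear form `B`. -/
theorem derAct_contract (A : E →L[ℝ] E) (B C : E →L[ℝ] E →L[ℝ] E)
    (h : ∀ u v, C u v = B (A u) v + B u (A v) - A (B u v)) (η : E [⋀^Fin k]→L[ℝ] ℂ) :
    derAct A (contract B η) = contract B (derAct A η) + contract C η := by
  rw [contract, contract, contract, ← alternatizeUncurryFin_add]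
  refine derAct_alternatize _ _ _ fun u => ?_
  change derAct (B u) (derAct A η) + derAct (C u) η =
    derAct A (derAct (B u) η) + derAct (B (A u)) η
  have h1 : C u = (B u ∘L A - A ∘L B u) + B (A u) := by
    ext v
    change C u v = (B u (A v) - A (B u v)) + B (A u) v
    rw [h]; abel
  rw [h1, derAct_map_add, ← derAct_comm]
  abel

/-- The commutator of the degree `0` derivation `T_u` with `contract B`, where
`T(u,v) = B_u v - B_v u` is a bracket with `T(T(u,v),x) + cyclic permutations = c (w ∧ J)(u,v,x)`.
The hypothesis says that the curvature-like endomorphism `[T_v, T_u] + T_{T(u,v)}` is the sum of a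
multiple of `J` and of two endomorphisms of rank one, and `extMul_int` gives their action. -/
theorem derAct_contract_comm (B : E →L[ℝ] E →L[ℝ] E) (J : E →L[ℝ] E) (w : E →L[ℝ] E →L[ℝ] ℝ)
    (hw : ∀ u v, w v u = -w u v)
    (c : ℝ) (T : E →L[ℝ] E →L[ℝ] E) (hT : ∀ u v, T u v = B u v - B v u)
    (hS : ∀ u v x, T v (T u x) - T u (T v x) + T (T u v) x =
      c • (w u v • J x - w u x • J v + w v x • J u)) (u : E)
    (η : E [⋀^Fin (k + 1)]→L[ℝ] ℂ) :
    derAct (T u) (contract B η) - contract B (derAct (T u) η) =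
      c • (extMul (derAct J η) (w u) + lef w (int (J u) η)) := by
  have hflip : ∀ u, B u - B.flip u = T u := fun u => by
    ext v; rw [hT]; rfl
  have hend : ∀ v, (T v ∘L T u - T u ∘L T v) + T (T u v) =
      c • (w u v • J - (w u).smulRight (J v) + (w v).smulRight (J u)) := fun v => by
    ext x : 1
    exact hS u v x
  have h1 : ∀ {l : ℕ} (η : E [⋀^Fin (l + 1)]→L[ℝ] ℂ) (v : E),
      (derAct (T u) (derAct (T v) η) - derAct (T v) (derAct (T u) η)) + derAct (T (T u v)) η =
      c • (w u v • derAct J η - extMul (int (J v) η) (w u) + extMul (int (J u) η) (w v)) :=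
    fun η v => by
      rw [derAct_comm, ← derAct_map_add, hend, derAct_map_smul, derAct_map_add, derAct_map_sub,
        derAct_map_smul, extMul_int, extMul_int]
  induction k with
  | zero =>
    refine ext_int fun v => ?_
    have h0 : ∀ (A : E →L[ℝ] E) (θ : E [⋀^Fin 0]→L[ℝ] ℂ), derAct A θ = 0 := derAct_zero_form
    simp only [int_sub, int_derAct, int_contract, hflip, contract_zero_form,
      int_real_smul, int_add, int_extMul, int_lef_zero w hw, h0, sub_zero, zero_add]
    rw [← h1]
    abel
  | succ k ih =>
    refine ext_int fun v => ?_
    have h2 := ih (int v η)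
    rw [int_sub, int_derAct, int_contract, int_contract, int_contract, hflip, hflip, int_derAct,
      derAct_sub, contract_add, int_real_smul, int_add, int_extMul, int_lef w hw, int_derAct,
      extMul_add, int_anticomm η (J u) v, _root_.add_apply]
    have h3 : derAct (T u) (derAct (T v) η) - derAct (T u) (contract B (int v η)) +
        (derAct (T (T u v)) η - contract B (int (T u v) η)) -
        (derAct (T v) (derAct (T u) η) -
          (contract B (derAct (T u) (int v η)) + contract B (int (T u v) η))) =
        ((derAct (T u) (derAct (T v) η) - derAct (T v) (derAct (T u) η)) + derAct (T (T u v)) η) -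
        (derAct (T u) (contract B (int v η)) - contract B (derAct (T u) (int v η))) := by abel
    rw [h3, h1, h2, lef_neg]
    module

/-- The square of `contract B` is the exterior product with `w` composed with the action of `J`,
up to the factor `c`, if the bracket `T(u,v) = B_u v - B_v u` satisfies
`T(T(u,v),x) + cyclic permutations = c (w ∧ J)(u,v,x)`. Both sides are compared by taking interior
products, with which `contract B` has the anticommutator `T_u` (`int_contract`). -/
theorem contract_contract (B : E →L[ℝ] E →L[ℝ] E) (J : E →L[ℝ] E) (w : E →L[ℝ] E →L[ℝ] ℝ)
    (hw : ∀ u v, w v u = -w u v)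
    (c : ℝ) (T : E →L[ℝ] E →L[ℝ] E) (hT : ∀ u v, T u v = B u v - B v u)
    (hS : ∀ u v x, T v (T u x) - T u (T v x) + T (T u v) x =
      c • (w u v • J x - w u x • J v + w v x • J u))
    (η : E [⋀^Fin k]→L[ℝ] ℂ) :
    contract B (contract B η) = c • lef w (derAct J η) := by
  have hflip : ∀ u, B u - B.flip u = T u := fun u => by
    ext v; rw [hT]; rfl
  induction k with
  | zero =>
    rw [contract_zero_form, derAct_zero_form]
    have h1 := contract_add B (0 : E [⋀^Fin 1]→L[ℝ] ℂ) 0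
    have h2 := lef_add w (0 : E [⋀^Fin 0]→L[ℝ] ℂ) 0
    rw [add_zero] at h1 h2
    rw [left_eq_add.1 h1, left_eq_add.1 h2]
    module
  | succ k ih =>
    refine ext_int fun u => ?_
    rw [int_contract, hflip, int_contract, hflip, int_real_smul, int_lef w hw, int_derAct,
      lef_add]
    have h1 := derAct_contract_comm B J w hw c T hT hS u η
    rw [contract_sub, ih]
    have h3 : derAct (T u) (contract B η) -
        (contract B (derAct (T u) η) - c • lef w (derAct J (int u η))) =
        (derAct (T u) (contract B η) - contract B (derAct (T u) η)) +
          c • lef w (derAct J (int u η)) := by abel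
    rw [h3, h1]
    module

end ExteriorAlgebra

/-! ### The exterior product with a two-form -/

section WedgeTwoForm

open ContinuousAlternatingMap hiding add_apply sub_apply neg_apply smul_apply

/-- Every permutation of `Fin (n + 1)` is a permutation of the last `n` elements followed by
the inverse of one of the cycles `(0 1 … p)`. -/
theorem bijective_cycleRange_symm_mul (n : ℕ) :
    Function.Bijective fun x : Fin (n + 1) × Equiv.Perm (Fin n) =>
      x.1.cycleRange.symm * Equiv.Perm.decomposeFin.symm (0, x.2) := by
  rw [Fintype.bijective_iff_injective_and_card]
  constructor
  · rintro ⟨p, e⟩ ⟨q, f⟩ h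
    have h0 := congrArg (fun σ : Equiv.Perm (Fin (n + 1)) => σ 0) h
    simp at h0
    subst h0
    have := mul_left_cancel h
    have := Equiv.Perm.decomposeFin.symm.injective this
    simpa using this
  · simp [Fintype.card_perm, Nat.factorial_succ]

theorem sum_perm_fin_succ {n : ℕ} {R : Type*} [AddCommMonoid R]
    (F : Equiv.Perm (Fin (n + 1)) → R) :
    ∑ σ, F σ = ∑ p : Fin (n + 1), ∑ e : Equiv.Perm (Fin n),
      F (p.cycleRange.symm * Equiv.Perm.decomposeFin.symm (0, e)) := by
  rw [← Fintype.sum_prod_type']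
  exact (Fintype.sum_bijective _ (bijective_cycleRange_symm_mul n) _ _ fun _ => rfl).symm

variable {E : Type*} [NormedAddCommGroup E] [NormedSpace ℝ E] {k : ℕ}

theorem tensorMul_vecCons (η : E [⋀^Fin (k + 1)]→L[ℝ] ℂ) (om : E [⋀^Fin 2]→L[ℝ] ℂ) (a : E)
    (v : Fin (k + 2) → E) :
    tensorMul η om (Matrix.vecCons a v) = tensorMul (int a η) om v := by
  rw [tensorMul_apply, tensorMul_apply, int_apply]
  congr 1
  · refine congrArg η (funext fun i => ?_)
    induction i using Fin.cases <;> rfl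
  · refine congrArg om (funext fun i => ?_)
    have : (Fin.natAdd (k + 1) i : Fin (k + 1 + 2)) = (Fin.natAdd k i).succ := by
      ext; simp; omega
    rw [this]; rfl

/-- Expansion of `alternatization (η ⊗ ω)` along the first slot. -/
theorem alternatization_tensorMul_succ (η : E [⋀^Fin (k + 1)]→L[ℝ] ℂ) (om : E [⋀^Fin 2]→L[ℝ] ℂ)
    (v : Fin (k + 3) → E) :
    ContinuousMultilinearMap.alternatization (tensorMul η om) v =
      ∑ i : Fin (k + 3), (-1) ^ (i : ℕ) •
        ContinuousMultilinearMap.alternatization (tensorMul (int (v i) η) om) (i.removeNth v) := by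
  have h : ContinuousMultilinearMap.alternatization (tensorMul η om) v =
    ∑ σ : Equiv.Perm (Fin (k + 3)), Equiv.Perm.sign σ • tensorMul η om (v ∘ σ) :=
      ContinuousMultilinearMap.alternatization_apply_apply _ v
  rw [h, sum_perm_fin_succ]
  refine Finset.sum_congr rfl fun p _ => ?_
  rw [ContinuousMultilinearMap.alternatization_apply_apply, Finset.smul_sum]
  refine Finset.sum_congr rfl fun e _ => ?_
  have hv : v ∘ (p.cycleRange.symm * Equiv.Perm.decomposeFin.symm (0, e) : Equiv.Perm _) =
      Matrix.vecCons (v p) (p.removeNth v ∘ e) := by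
    funext l
    induction l using Fin.cases with
    | zero => simp
    | succ l => simp [Fin.removeNth]
  rw [hv, tensorMul_vecCons]
  simp [Equiv.Perm.sign_mul, Fin.sign_cycleRange, Units.smul_def, mul_assoc]

/-- `∑ₐ eᵃ ∧ (ι_{eₐ} η ∧ ω) = (k + 1) η ∧ ω` for a form `η` of degree `k + 1`. -/
theorem wedge_succ (η : E [⋀^Fin (k + 1)]→L[ℝ] ℂ) (om : E [⋀^Fin 2]→L[ℝ] ℂ)
    (v : Fin (k + 3) → E) :
    ((k + 1 : ℕ) : ℂ) * wedge η om v =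
      ∑ i : Fin (k + 3), (-1) ^ (i : ℕ) • wedge (int (v i) η) om (i.removeNth v) := by
  have h1 : wedge η om v = (((k + 1).factorial * Nat.factorial 2 : ℂ)⁻¹) *
    ContinuousMultilinearMap.alternatization (tensorMul η om) v := rfl
  have h2 : ∀ i : Fin (k + 3), wedge (int (v i) η) om (i.removeNth v) =
    ((k.factorial * Nat.factorial 2 : ℂ)⁻¹) *
      ContinuousMultilinearMap.alternatization (tensorMul (int (v i) η) om) (i.removeNth v) :=
    fun i => rfl
  simp only [h1, h2, alternatization_tensorMul_succ]
  rw [Finset.mul_sum, Finset.mul_sum]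
  refine Finset.sum_congr rfl fun i _ => ?_
  have : (k.factorial : ℂ) ≠ 0 := by exact_mod_cast k.factorial_ne_zero
  have h3 : ((k + 1 : ℕ) : ℂ) ≠ 0 := by exact_mod_cast k.succ_ne_zero
  rw [Nat.factorial_succ]
  push_cast at h3 ⊢
  simp only [zsmul_eq_mul]
  field_simp

/-- The exterior product with a real two-form is its Lefschetz operator. -/
theorem wedge_eq_lef (om : E [⋀^Fin 2]→L[ℝ] ℂ) (w : E →L[ℝ] E →L[ℝ] ℝ)
    (hom : ∀ u v, om ![u, v] = w u v) (η : E [⋀^Fin k]→L[ℝ] ℂ) : wedge η om = lef w η := by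
  have hw : ∀ u v, w v u = -w u v := fun u v => by
    have h : om ![v, u] = -om ![u, v] := by
      have := om.toAlternatingMap.map_swap ![u, v] (i := 0) (j := 1) (by decide)
      rw [ContinuousAlternatingMap.coe_toAlternatingMap] at this
      rw [← this]
      congr 1
      funext i; fin_cases i <;> rfl
    rw [hom, hom] at h
    exact_mod_cast h
  induction k with
  | zero =>
    ext v
    have h1 : wedge η om v = (((0 : ℕ).factorial * Nat.factorial 2 : ℂ)⁻¹) *
      ContinuousMultilinearMap.alternatization (tensorMul η om) v := rfl
    have h2 : lef w η v = int (v 1) (int (v 0) (lef w η)) ![] := by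
      rw [int_apply, int_apply]
      congr 1
      funext i; fin_cases i <;> rfl
    have h3 : ∀ σ : Equiv.Perm (Fin (0 + 2)), Equiv.Perm.sign σ • tensorMul η om (v ∘ σ) =
        η ![] * om v := fun σ => by
      have h4 := om.toAlternatingMap.map_perm v σ
      have h5 : tensorMul η om (v ∘ σ) = η ![] * om (v ∘ σ) := by
        rw [tensorMul_apply]
        congr 1
        · exact congrArg η (Subsingleton.elim _ _)
        · refine congrArg om (funext fun i => ?_)
          have : (Fin.natAdd 0 i : Fin (0 + 2)) = i := by ext; simp
          rw [this]
      have h6 : om (v ∘ σ) = Equiv.Perm.sign σ • om v := h4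
      rw [h5, h6, mul_smul_comm, smul_smul, Int.units_mul_self, one_smul]
    rw [h1, ContinuousMultilinearMap.alternatization_apply_apply,
      Finset.sum_congr rfl fun σ _ => h3 σ, h2, int_lef_zero w hw, int_extMul_zero]
    have h7 : om v = w (v 0) (v 1) := by
      rw [← hom]
      congr 1
      funext i; fin_cases i <;> rfl
    rw [h7]
    simp [Fintype.card_perm]
    ring
  | succ k ih =>
    -- `lef w η` satisfies the recursion of `wedge_succ`: by the Euler identity
    -- `∑ₐ eᵃ ∧ ι_{eₐ} θ = (deg θ) θ` and the product rule,
    -- `∑ₐ eᵃ ∧ lef w (ι_{eₐ} η) = (k + 3) lef w η - 2 lef w η`.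
    have h1 : alternatizeUncurryFin ((lef w η).curryLeft) = ((k + 3 : ℕ) : ℝ) • lef w η := by
      have := alternatize_curryLeft_comp (.id ℝ E) (lef w η)
      rwa [derAct_id, ContinuousLinearMap.comp_id] at this
    have h2 : alternatizeUncurryFin (extMul η ∘L w) = (2 : ℝ) • lef w η := by
      rw [lef]; module
    have h3 := alternatize_sub (lef w η).curryLeft (extMul η ∘L w)
    rw [h1, h2] at h3
    ext v
    have h4 := congrArg (fun θ => θ v) h3
    simp only [alternatizeUncurryFin_apply] at h4
    have h5 : ∀ u, ((lef w η).curryLeft - extMul η ∘L w) u = lef w (int u η) := fun u => by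
      change int u (lef w η) - extMul η (w u) = _
      rw [int_lef w hw]; abel
    simp only [h5, ← ih] at h4
    rw [← wedge_succ] at h4
    have h6 : ((k + 1 : ℕ) : ℂ) ≠ 0 := by exact_mod_cast k.succ_ne_zero
    refine mul_left_cancel₀ h6 (h4.trans ?_)
    change ((k + 3 : ℕ) : ℝ) • lef w η v - (2 : ℝ) • lef w η v = _
    simp only [Complex.real_smul]
    push_cast
    ring

end WedgeTwoForm

/-! ### Hodge types and weights -/

section Types

open ContinuousAlternatingMap hiding add_apply sub_apply neg_apply smul_apply

variable {E : Type*} [NormedAddCommGroup E] [NormedSpace ℝ E] {k : ℕ}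

/-- The component `slotProj J S` is complex linear in the slots of `S` and complex antilinear in
the others. -/
theorem slotProj_update (J : E →L[ℝ] E) (hJ : ∀ v, J (J v) = -v) (S : Finset (Fin k))
    (η : E [⋀^Fin k]→L[ℝ] ℂ) (v : Fin k → E) (j : Fin k) :
    slotProj J S η (Function.update v j (J (v j))) =
      (if j ∈ S then Complex.I else -Complex.I) * slotProj J S η v := by
  -- Applying `J` in slot `j` exchanges the terms with and without `J` in that slot.
  have hinv : Function.Involutive fun T : Finset (Fin k) => symmDiff T {j} := fun T => by simp
  rw [slotProj_apply, slotProj_apply, mul_left_comm]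
  congr 1
  rw [Finset.mul_sum]
  refine Fintype.sum_equiv hinv.toPerm _ _ fun T => ?_
  set a : Fin k → ℂ := fun l => if l ∈ S then -Complex.I else Complex.I with ha
  have haj : a j * a j = -1 := by
    simp only [ha]; split_ifs <;> simp
  have hs : (if j ∈ S then Complex.I else -Complex.I) = -a j := by
    simp only [ha]; split_ifs <;> simp
  rw [hs]
  change (∏ l ∈ T, a l) * _ = -a j * ((∏ l ∈ symmDiff T {j}, a l) *
    η (fun l => if l ∈ symmDiff T {j} then J (v l) else v l))
  by_cases hj : j ∈ T
  · have hT : symmDiff T {j} = T.erase j := by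
      ext l; simp only [Finset.mem_symmDiff, Finset.mem_singleton, Finset.mem_erase]
      by_cases h : l = j
      · subst h; simp [hj]
      · simp [h]
    have hη : η (fun l => if l ∈ T then J (Function.update v j (J (v j)) l)
        else Function.update v j (J (v j)) l) =
        -η (fun l => if l ∈ T.erase j then J (v l) else v l) := by
      have h1 : (fun l => if l ∈ T then J (Function.update v j (J (v j)) l)
          else Function.update v j (J (v j)) l) =
          Function.update (fun l => if l ∈ T.erase j then J (v l) else v l) j (-v j) := by
        funext l
        by_cases h : l = j
        · subst h; simp [hj, hJ]
        · simp [h]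
      have h2 : Function.update (fun l => if l ∈ T.erase j then J (v l) else v l) j (v j) =
          (fun l => if l ∈ T.erase j then J (v l) else v l) := by
        funext l
        by_cases h : l = j
        · subst h; simp
        · simp [h]
      have h3 := η.toMultilinearMap.map_update_neg
        (fun l => if l ∈ T.erase j then J (v l) else v l) j (v j)
      rw [h2] at h3
      rw [h1]
      exact h3
    rw [hT, hη, ← Finset.mul_prod_erase T a hj]
    ring
  · have hT : symmDiff T {j} = insert j T := by
      ext l; simp only [Finset.mem_symmDiff, Finset.mem_singleton, Finset.mem_insert]
      by_cases h : l = j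
      · subst h; simp [hj]
      · simp [h]
    have hη : (fun l => if l ∈ T then J (Function.update v j (J (v j)) l)
        else Function.update v j (J (v j)) l) =
        fun l => if l ∈ insert j T then J (v l) else v l := by
      funext l
      by_cases h : l = j
      · subst h; simp [hj]
      · simp [h]
    rw [hT, hη, Finset.prod_insert hj]
    linear_combination ((∏ l ∈ T, a l) *
      η (fun l => if l ∈ insert j T then J (v l) else v l)) * haj

theorem slotProj_derAct (J : E →L[ℝ] E) (S : Finset (Fin k))
    (η : E [⋀^Fin k]→L[ℝ] ℂ) (v : Fin k → E) :
    slotProj J S (derAct J η) v = ∑ j, slotProj J S η (Function.update v j (J (v j))) := by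
  simp only [slotProj_apply, derAct_apply, Finset.mul_sum]
  rw [Finset.sum_comm]
  refine Finset.sum_congr rfl fun j _ => Finset.sum_congr rfl fun T _ => ?_
  congr 3
  funext l
  by_cases h : l = j
  · subst h; simp only [Function.update_self]; split_ifs <;> rfl
  · simp [h]

theorem typeProj_apply (J : E →L[ℝ] E) (p q : ℤ) (η : E [⋀^Fin k]→L[ℝ] ℂ) (v : Fin k → E) :
    typeProj J p q η v =
      ∑ S : Finset (Fin k) with (#S : ℤ) = p ∧ (#Sᶜ : ℤ) = q, slotProj J S η v := by
  change (∑ S : Finset (Fin k) with (#S : ℤ) = p ∧ (#Sᶜ : ℤ) = q, slotProj J S η) v = _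
  rw [_root_.sum_apply]

theorem sum_slotProj_update (J : E →L[ℝ] E) (hJ : ∀ v, J (J v) = -v) (S : Finset (Fin k))
    (η : E [⋀^Fin k]→L[ℝ] ℂ) (v : Fin k → E) :
    ∑ j, slotProj J S η (Function.update v j (J (v j))) =
      (Complex.I * ((#S : ℂ) - (#Sᶜ : ℂ))) * slotProj J S η v := by
  simp only [slotProj_update J hJ, ← Finset.sum_mul]
  congr 1
  rw [Finset.sum_ite]
  simp
  have : #({x | x ∉ S} : Finset (Fin k)) = #Sᶜ := by congr 1; ext; simp
  rw [this]
  ring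

theorem derAct_typeProj (J : E →L[ℝ] E) (hJ : ∀ v, J (J v) = -v) (p q : ℤ)
    (η : E [⋀^Fin k]→L[ℝ] ℂ) :
    derAct J (typeProj J p q η) = (Complex.I * ((p : ℂ) - q)) • typeProj J p q η := by
  ext v
  rw [ContinuousAlternatingMap.smul_apply, derAct_apply]
  simp only [typeProj_apply, smul_eq_mul, Finset.mul_sum]
  rw [Finset.sum_comm]
  refine Finset.sum_congr rfl fun S hS => ?_
  rw [sum_slotProj_update J hJ]
  obtain ⟨-, h1, h2⟩ := Finset.mem_filter.1 hS
  rw [← h1, ← h2]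
  push_cast
  rfl

theorem typeProj_derAct (J : E →L[ℝ] E) (hJ : ∀ v, J (J v) = -v) (p q : ℤ)
    (η : E [⋀^Fin k]→L[ℝ] ℂ) :
    typeProj J p q (derAct J η) = (Complex.I * ((p : ℂ) - q)) • typeProj J p q η := by
  ext v
  rw [ContinuousAlternatingMap.smul_apply]
  simp only [typeProj_apply, smul_eq_mul, Finset.mul_sum]
  refine Finset.sum_congr rfl fun S hS => ?_
  rw [slotProj_derAct, sum_slotProj_update J hJ]
  obtain ⟨-, h1, h2⟩ := Finset.mem_filter.1 hS
  rw [← h1, ← h2]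
  push_cast
  rfl

/-- Each vector is the sum of its `(1,0)`-part and its `(0,1)`-part; expanded in all slots. -/
theorem sum_slotProj (J : E →L[ℝ] E) (η : E [⋀^Fin k]→L[ℝ] ℂ) (v : Fin k → E) :
    ∑ S : Finset (Fin k), slotProj J S η v = η v := by
  have key : ∀ T : Finset (Fin k), ∑ S : Finset (Fin k),
      (∏ j ∈ T, (if j ∈ S then -Complex.I else Complex.I)) = if T = ∅ then (2 : ℂ) ^ k else 0 := by
    intro T
    have h := Finset.prod_add (fun j => if j ∈ T then -Complex.I else 1)
      (fun j => if j ∈ T then Complex.I else 1) (Finset.univ : Finset (Fin k))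
    rw [Finset.powerset_univ] at h
    have h1 : ∀ S : Finset (Fin k), (∏ j ∈ T, (if j ∈ S then -Complex.I else Complex.I)) =
        (∏ j ∈ S, (if j ∈ T then -Complex.I else 1)) *
          ∏ j ∈ univ \ S, (if j ∈ T then Complex.I else 1) := by
      intro S
      rw [← Finset.compl_eq_univ_sdiff, Finset.prod_ite, Finset.prod_ite, Finset.prod_ite]
      simp only [Finset.prod_const, one_pow, mul_one]
      congr 3
      · ext; simp [and_comm]
      · ext; simp [and_comm]
    simp only [h1, ← h]
    split_ifs with hT
    · subst hT; norm_num
    · obtain ⟨j, hj⟩ := Finset.nonempty_iff_ne_empty.2 hT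
      exact Finset.prod_eq_zero (Finset.mem_univ j) (by simp [hj])
  simp only [slotProj_apply]
  rw [← Finset.mul_sum, Finset.sum_comm]
  simp only [← Finset.sum_mul, key]
  rw [Finset.sum_eq_single ∅]
  · simp
  · intro T _ hT; simp [hT]
  · simp

theorem sum_typeProj (J : E →L[ℝ] E) (η : E [⋀^Fin k]→L[ℝ] ℂ) :
    ∑ pq ∈ antidiagonal k, typeProj J pq.1 pq.2 η = η := by
  ext v
  have h : (∑ pq ∈ antidiagonal k, typeProj J pq.1 pq.2 η) v =
      ∑ pq ∈ antidiagonal k, typeProj J pq.1 pq.2 η v := by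
    exact map_sum (ContinuousAlternatingMap.apply ℝ E ℂ v) _ _
  rw [h, ← sum_slotProj J η v,
    ← Finset.sum_fiberwise_of_maps_to (s := univ) (t := antidiagonal k)
      (g := fun S : Finset (Fin k) => (#S, #Sᶜ))]
  · refine Finset.sum_congr rfl fun pq _ => ?_
    rw [typeProj_apply]
    refine Finset.sum_congr ?_ fun _ _ => rfl
    ext S
    simp [Prod.ext_iff]
  · intro S _
    simp [Finset.card_add_card_compl]

/-- The projection to the forms of type `(p,q)` as a complex linear map. -/
def typeProjLM (J : E →L[ℝ] E) (k : ℕ) (p q : ℤ) :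
    (E [⋀^Fin k]→L[ℝ] ℂ) →ₗ[ℂ] E [⋀^Fin k]→L[ℝ] ℂ where
  toFun := typeProj J p q
  map_add' η θ := by
    ext v
    simp [typeProj_apply, slotProj_apply, mul_add, Finset.sum_add_distrib]
  map_smul' c η := by
    ext v
    simp [typeProj_apply, slotProj_apply, Finset.mul_sum, mul_left_comm]

theorem typeProj_add (J : E →L[ℝ] E) (p q : ℤ) (η θ : E [⋀^Fin k]→L[ℝ] ℂ) :
    typeProj J p q (η + θ) = typeProj J p q η + typeProj J p q θ :=
  map_add (typeProjLM J k p q) η θ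

theorem typeProj_sub (J : E →L[ℝ] E) (p q : ℤ) (η θ : E [⋀^Fin k]→L[ℝ] ℂ) :
    typeProj J p q (η - θ) = typeProj J p q η - typeProj J p q θ :=
  map_sub (typeProjLM J k p q) η θ

theorem typeProj_smul (J : E →L[ℝ] E) (p q : ℤ) (c : ℂ) (η : E [⋀^Fin k]→L[ℝ] ℂ) :
    typeProj J p q (c • η) = c • typeProj J p q η :=
  map_smul (typeProjLM J k p q) c η

theorem typeProj_zero (J : E →L[ℝ] E) (p q : ℤ) :
    typeProj J p q (0 : E [⋀^Fin k]→L[ℝ] ℂ) = 0 :=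
  map_zero (typeProjLM J k p q)

theorem typeProj_of_add_ne (J : E →L[ℝ] E) {p q : ℤ} (h : p + q ≠ k)
    (η : E [⋀^Fin k]→L[ℝ] ℂ) : typeProj J p q η = 0 := by
  ext v
  rw [typeProj_apply, Finset.sum_eq_zero]
  · rfl
  · intro S hS
    obtain ⟨-, h1, h2⟩ := Finset.mem_filter.1 hS
    refine absurd ?_ h
    rw [← h1, ← h2]
    have := Finset.card_add_card_compl S
    rw [Fintype.card_fin] at this
    exact_mod_cast this

theorem typeProj_of_neg (J : E →L[ℝ] E) {p q : ℤ} (h : p < 0 ∨ q < 0)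
    (η : E [⋀^Fin k]→L[ℝ] ℂ) : typeProj J p q η = 0 := by
  ext v
  rw [typeProj_apply, Finset.sum_eq_zero]
  · rfl
  · intro S hS
    obtain ⟨-, h1, h2⟩ := Finset.mem_filter.1 hS
    omega

theorem eq_zero_or_of_smul_eq_zero {c : ℂ} {η : E [⋀^Fin k]→L[ℝ] ℂ} (h : c • η = 0) :
    c = 0 ∨ η = 0 := by
  by_cases hc : c = 0
  · exact Or.inl hc
  · refine Or.inr (ContinuousAlternatingMap.ext fun v => ?_)
    have h1 : c * η v = 0 := congrArg (fun θ => θ v) h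
    exact (mul_eq_zero.1 h1).resolve_left hc

/-- `η` has weight `m` if `J` acts on it, as a derivation, by the scalar `m √-1`. The forms of
type `(p,q)` with `p, q ≥ 0` are the forms of degree `p + q` and weight `p - q`; for `p` or `q`
negative both notions single out the zero form. -/
def HasWeight (J : E →L[ℝ] E) (m : ℤ) (η : E [⋀^Fin k]→L[ℝ] ℂ) : Prop :=
  derAct J η = (Complex.I * m) • η

theorem hasWeight_typeProj (J : E →L[ℝ] E) (hJ : ∀ v, J (J v) = -v) (p q : ℤ)
    (η : E [⋀^Fin k]→L[ℝ] ℂ) : HasWeight J (p - q) (typeProj J p q η) := by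
  rw [HasWeight, derAct_typeProj J hJ]; push_cast; rfl

theorem HasWeight.typeProj_eq_zero {J : E →L[ℝ] E} (hJ : ∀ v, J (J v) = -v) {m : ℤ}
    {η : E [⋀^Fin k]→L[ℝ] ℂ} (h : HasWeight J m η) {p q : ℤ} (hpq : p - q ≠ m) :
    typeProj J p q η = 0 := by
  have h1 := typeProj_derAct J hJ p q η
  rw [h, typeProj_smul, ← sub_eq_zero] at h1
  have h0 : (Complex.I * m - Complex.I * ((p : ℂ) - q)) • typeProj J p q η = 0 := by
    rw [← h1]; module
  refine (eq_zero_or_of_smul_eq_zero h0).resolve_left fun h2 => hpq ?_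
  rw [← mul_sub, mul_eq_zero] at h2
  have h3 := h2.resolve_left Complex.I_ne_zero
  have h4 : ((m - (p - q) : ℤ) : ℂ) = 0 := by push_cast; exact h3
  have := Int.cast_eq_zero.1 h4
  omega

theorem HasWeight.typeProj_eq_self {J : E →L[ℝ] E} (hJ : ∀ v, J (J v) = -v) {m : ℤ}
    {η : E [⋀^Fin k]→L[ℝ] ℂ} (h : HasWeight J m η) {p q : ℤ} (hpq : p - q = m) (hk : p + q = k) :
    typeProj J p q η = η := by
  by_cases hneg : p < 0 ∨ q < 0
  · rw [typeProj_of_neg J hneg]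
    rw [← sum_typeProj J η, Finset.sum_eq_zero]
    intro pq hpq'
    refine h.typeProj_eq_zero hJ ?_
    have := Finset.HasAntidiagonal.mem_antidiagonal.1 hpq'
    omega
  · push Not at hneg
    obtain ⟨a, rfl⟩ := Int.eq_ofNat_of_zero_le hneg.1
    obtain ⟨b, rfl⟩ := Int.eq_ofNat_of_zero_le hneg.2
    have hab : (a, b) ∈ antidiagonal k := by
      rw [Finset.HasAntidiagonal.mem_antidiagonal]; exact_mod_cast hk
    have h1 := sum_typeProj J η
    rw [Finset.sum_eq_single_of_mem _ hab] at h1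
    · exact h1
    · intro pq hpq' hne
      refine h.typeProj_eq_zero hJ fun h2 => hne ?_
      have := Finset.HasAntidiagonal.mem_antidiagonal.1 hpq'
      ext <;> simp <;> omega

/-- If `J - m √-1` acts on `η` and `θ` as `r` times a quarter turn, then `η` has components of
weight `m + r` and `m - r` only, the combinations `η ± √-1 θ` being of pure weight. -/
theorem typeProj_eq_zero_of_sq {J : E →L[ℝ] E} (hJ : ∀ v, J (J v) = -v) {m r : ℤ}
    {η θ : E [⋀^Fin k]→L[ℝ] ℂ} (h1 : derAct J η = (Complex.I * m) • η + (r : ℂ) • θ)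
    (h2 : derAct J θ = (Complex.I * m) • θ - (r : ℂ) • η) {p q : ℤ}
    (hp : p - q ≠ m + r) (hm : p - q ≠ m - r) : typeProj J p q η = 0 := by
  have e1 := typeProj_derAct J hJ p q η
  have e2 := typeProj_derAct J hJ p q θ
  rw [h1, typeProj_add, typeProj_smul, typeProj_smul] at e1
  rw [h2, typeProj_sub, typeProj_smul, typeProj_smul] at e2
  set a := typeProj J p q η
  set b := typeProj J p q θ
  have e3 : (((p - q - m - r) * (p - q - m + r) : ℤ) : ℂ) • a = 0 := by
    have e1' : (r : ℂ) • b = (Complex.I * (p - q - m)) • a := by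
      rw [← eq_sub_iff_add_eq'] at e1
      rw [e1]
      module
    have e2' : (r : ℂ) • a = -((Complex.I * (p - q - m)) • b) := by
      rw [sub_eq_iff_eq_add] at e2
      have : (Complex.I * m) • b - (Complex.I * (p - q)) • b = (r : ℂ) • a := by
        rw [e2]; abel
      rw [← this]; module
    have e4 : ((r : ℂ) * r) • a = ((p - q - m : ℂ) * (p - q - m)) • a := by
      have e5 : ((r : ℂ) * r) • a = (r : ℂ) • (r : ℂ) • a := by module
      have e6 : (r : ℂ) • -((Complex.I * (p - q - m)) • b) =
        -((Complex.I * (p - q - m)) • (r : ℂ) • b) := by module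
      have e7 : -((Complex.I * (p - q - m)) • (Complex.I * (p - q - m)) • a) =
        -((Complex.I * Complex.I * ((p - q - m) * (p - q - m))) • a) := by module
      rw [e5, e2', e6, e1', e7, Complex.I_mul_I]
      module
    have : (((p - q - m - r) * (p - q - m + r) : ℤ) : ℂ) • a =
      ((p - q - m : ℂ) * (p - q - m)) • a - ((r : ℂ) * r) • a := by
      push_cast; module
    rw [this, e4, sub_self]
  refine (eq_zero_or_of_smul_eq_zero e3).resolve_left fun h => ?_
  rw [Int.cast_eq_zero, mul_eq_zero] at h
  omega

end Types

/-! ### Smooth families of forms and the connection form of an almost complex structure -/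

section Smoothness

/-- A shortcut for instance search, which otherwise times out on spaces of this form. -/
instance instNormedFormHom {E : Type*} [NormedAddCommGroup E] [NormedSpace ℝ E] {k : ℕ} :
    NormedAddCommGroup (E →L[ℝ] E [⋀^Fin k]→L[ℝ] ℂ) :=
  ContinuousLinearMap.toNormedAddCommGroup

open ContinuousAlternatingMap hiding add_apply sub_apply neg_apply smul_apply

variable {D E : Type*} [NormedAddCommGroup D] [NormedSpace ℝ D]
  [NormedAddCommGroup E] [NormedSpace ℝ E] {k : ℕ} {s : Set D} {n : WithTop ℕ∞}

theorem contDiffOn_form_apply {η : D → E [⋀^Fin k]→L[ℝ] ℂ} (hη : ContDiffOn ℝ n η s)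
    {w : D → Fin k → E} (hw : ∀ i, ContDiffOn ℝ n (fun y => w y i) s) :
    ContDiffOn ℝ n (fun y => η y (w y)) s := by
  induction k with
  | zero =>
    have h : (fun y => η y (w y)) = fun y => ContinuousAlternatingMap.apply ℝ E ℂ ![] (η y) := by
      funext y
      exact congrArg (η y) (Subsingleton.elim _ _)
    rw [h]
    exact (ContinuousAlternatingMap.apply ℝ E ℂ ![]).contDiff.comp_contDiffOn hη
  | succ k ih =>
    have h : (fun y => η y (w y)) = fun y => int (w y 0) (η y) (fun i => w y i.succ) := by
      funext y
      rw [int_apply]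
      refine congrArg (η y) (funext fun i => ?_)
      induction i using Fin.cases <;> simp
    rw [h]
    refine ih (η := fun y => int (w y 0) (η y)) ?_ fun i => hw i.succ
    exact ((curryLeftLI (𝕜 := ℝ) (E := E) (F := ℂ)
      (n := k)).toContinuousLinearMap.contDiff.comp_contDiffOn hη).clm_apply (hw 0)

/-- A family of alternating forms on a finite-dimensional space is smooth if its values on
constant vectors are. -/
theorem contDiffOn_form_of_apply [FiniteDimensional ℝ E] {η : D → E [⋀^Fin k]→L[ℝ] ℂ}
    (h : ∀ v, ContDiffOn ℝ n (fun y => η y v) s) : ContDiffOn ℝ n η s := by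
  set b := Module.finBasis ℝ E
  let L : (E [⋀^Fin k]→L[ℝ] ℂ) →ₗ[ℝ] ((Fin k → Fin (Module.finrank ℝ E)) → ℂ) :=
    { toFun := fun ζ t => ζ fun i => b (t i)
      map_add' := fun _ _ => rfl
      map_smul' := fun _ _ => rfl }
  have hL : Function.Injective L := by
    intro ζ ξ hζ
    have h1 : ζ.toMultilinearMap = ξ.toMultilinearMap :=
      Module.Basis.ext_multilinear (fun _ => b) fun t => congrFun hζ t
    ext v
    exact congrArg (fun f => f v) h1
  obtain ⟨g, hg⟩ := L.exists_leftInverse_of_injective (LinearMap.ker_eq_bot.2 hL)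
  have h2 : η = fun y => LinearMap.toContinuousLinearMap g (L (η y)) := by
    funext y
    exact (congrArg (fun f => f (η y)) hg).symm
  rw [h2]
  refine (LinearMap.toContinuousLinearMap g).contDiff.comp_contDiffOn ?_
  exact contDiffOn_pi.2 fun t => h _

theorem contDiffOn_typeProj [FiniteDimensional ℝ E] {J : D → E →L[ℝ] E}
    {η : D → E [⋀^Fin k]→L[ℝ] ℂ} (hJ : ContDiffOn ℝ n J s) (hη : ContDiffOn ℝ n η s) (p q : ℤ) :
    ContDiffOn ℝ n (fun y => typeProj (J y) p q (η y)) s := by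
  refine contDiffOn_form_of_apply fun v => ?_
  simp only [typeProj_apply, slotProj_apply]
  refine ContDiffOn.sum fun S _ => contDiffOn_const.mul (ContDiffOn.sum fun T _ =>
    contDiffOn_const.mul (contDiffOn_form_apply hη fun i => ?_))
  by_cases h : i ∈ T
  · simp only [h, if_true]
    exact hJ.clm_apply contDiffOn_const
  · simp only [h, if_false]
    exact contDiffOn_const

theorem contDiffOn_wedge [FiniteDimensional ℝ E] {l : ℕ} {η : D → E [⋀^Fin k]→L[ℝ] ℂ}
    {θ : D → E [⋀^Fin l]→L[ℝ] ℂ} (hη : ContDiffOn ℝ n η s) (hθ : ContDiffOn ℝ n θ s) :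
    ContDiffOn ℝ n (fun y => wedge (η y) (θ y)) s := by
  refine contDiffOn_form_of_apply fun v => ?_
  have h : ∀ y, wedge (η y) (θ y) v = ((k.factorial * l.factorial : ℂ)⁻¹) *
      ∑ σ : Equiv.Perm (Fin (k + l)), ((Equiv.Perm.sign σ : ℤ) : ℂ) *
        (η y (fun i => v (σ (Fin.castAdd l i))) * θ y (fun j => v (σ (Fin.natAdd k j)))) := by
    intro y
    have h1 : wedge (η y) (θ y) v = ((k.factorial * l.factorial : ℂ)⁻¹) *
      ContinuousMultilinearMap.alternatization (tensorMul (η y) (θ y)) v := rfl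
    rw [h1, ContinuousMultilinearMap.alternatization_apply_apply]
    simp [Units.smul_def]
  simp only [h]
  exact contDiffOn_const.mul (ContDiffOn.sum fun σ _ => contDiffOn_const.mul
    ((contDiffOn_form_apply (w := fun _ i => v (σ (Fin.castAdd l i))) hη
      fun i => contDiffOn_const).mul
      (contDiffOn_form_apply (w := fun _ j => v (σ (Fin.natAdd k j))) hθ
        fun i => contDiffOn_const)))

theorem contDiffOn_extDeriv [FiniteDimensional ℝ E] {η : E → E [⋀^Fin k]→L[ℝ] ℂ} {U : Set E}
    (hU : IsOpen U) (hη : ContDiffOn ℝ ∞ η U) : ContDiffOn ℝ ∞ (extDeriv η) U := by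
  have h : ContDiffOn ℝ ∞ (fderiv ℝ η) U := hη.fderiv_of_isOpen hU (by norm_num)
  exact (alternatizeUncurryFinCLM ℝ E ℂ).contDiff.comp_contDiffOn h

end Smoothness

section FirstOrder

open ContinuousAlternatingMap hiding add_apply sub_apply neg_apply smul_apply

variable {E : Type*} [NormedAddCommGroup E] [NormedSpace ℝ E] {k : ℕ}

/-- For an almost complex structure with value `J` and derivative `D` at a point, the
connection form `B_u = -½ J (D_u J)`: the flat connection corrected by `B` makes `J` parallel. -/
def connForm (J : E →L[ℝ] E) (D : E →L[ℝ] E →L[ℝ] E) : E →L[ℝ] E →L[ℝ] E :=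
  (-(2 : ℝ)⁻¹) • (ContinuousLinearMap.compL ℝ E E E J ∘L D)

/-- The part of the connection form that is complex linear in the direction. -/
def connPlus (J : E →L[ℝ] E) (D : E →L[ℝ] E →L[ℝ] E) : E →L[ℝ] E →L[ℝ] E :=
  (2 : ℝ)⁻¹ • (connForm J D - ContinuousLinearMap.compL ℝ E E E J ∘L connForm J D ∘L J)

/-- The part of the connection form that is complex antilinear in the direction. Its
antisymmetrisation is, up to normalisation, the Nijenhuis tensor. -/
def connMinus (J : E →L[ℝ] E) (D : E →L[ℝ] E →L[ℝ] E) : E →L[ℝ] E →L[ℝ] E :=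
  (2 : ℝ)⁻¹ • (connForm J D + ContinuousLinearMap.compL ℝ E E E J ∘L connForm J D ∘L J)

variable {J : E →L[ℝ] E} {D : E →L[ℝ] E →L[ℝ] E}

theorem connForm_apply (u v : E) : connForm J D u v = (-(2 : ℝ)⁻¹) • J (D u v) := rfl

theorem connPlus_apply (u v : E) :
    connPlus J D u v = (2 : ℝ)⁻¹ • (connForm J D u v - J (connForm J D (J u) v)) := rfl

theorem connMinus_apply (u v : E) :
    connMinus J D u v = (2 : ℝ)⁻¹ • (connForm J D u v + J (connForm J D (J u) v)) := rfl

theorem connPlus_add_connMinus : connPlus J D + connMinus J D = connForm J D := by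
  ext u v
  change connPlus J D u v + connMinus J D u v = _
  rw [connPlus_apply, connMinus_apply]; module

theorem connForm_J (hD : ∀ u v, D u (J v) = -J (D u v)) (u v : E) :
    connForm J D u (J v) = -J (connForm J D u v) := by
  simp only [connForm_apply, hD, map_smul, map_neg]; module

theorem connPlus_J (hD : ∀ u v, D u (J v) = -J (D u v))
    (u v : E) : connPlus J D u (J v) = -J (connPlus J D u v) := by
  simp only [connPlus_apply, connForm_J hD, map_smul, map_neg, map_sub]; module

theorem connMinus_J (hD : ∀ u v, D u (J v) = -J (D u v))
    (u v : E) : connMinus J D u (J v) = -J (connMinus J D u v) := by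
  simp only [connMinus_apply, connForm_J hD, map_smul, map_neg, map_add]; module

theorem connPlus_J_left (hJ : ∀ v, J (J v) = -v)
    (u v : E) : connPlus J D (J u) v = J (connPlus J D u v) := by
  simp only [connPlus_apply, map_smul, map_neg, map_sub, hJ, neg_apply]
  module

theorem connMinus_J_left (hJ : ∀ v, J (J v) = -v)
    (u v : E) : connMinus J D (J u) v = -J (connMinus J D u v) := by
  simp only [connMinus_apply, map_smul, map_neg, map_add, hJ, neg_apply]
  module

/-- The derivation attached to a family that is complex antilinear in both arguments shifts weights
by `±3`. -/
theorem typeProj_contract_connMinus (hJ : ∀ v, J (J v) = -v)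
    (hD : ∀ u v, D u (J v) = -J (D u v)) {m : ℤ} {η : E [⋀^Fin k]→L[ℝ] ℂ} (hη : HasWeight J m η)
    {p q : ℤ} (hp : p - q ≠ m + 3) (hm : p - q ≠ m - 3) :
    typeProj J p q (contract (connMinus J D) η) = 0 := by
  set B := connMinus J D
  set B' := ContinuousLinearMap.compL ℝ E E E J ∘L B
  have hB' : ∀ u v, B' u v = J (B u v) := fun u v => rfl
  refine typeProj_eq_zero_of_sq hJ (m := m) (r := -3) (θ := contract B' η) ?_ ?_
    (by omega) (by omega)
  · rw [derAct_contract J B ((-3 : ℝ) • B'), hη, contract_smul, contract_map_smul]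
    · ext v; simp
    · intro u v
      rw [connMinus_J_left hJ, connMinus_J hD]
      change (-3 : ℝ) • J (B u v) = _
      module
  · rw [derAct_contract J B' ((3 : ℝ) • B), hη, contract_smul, contract_map_smul]
    · ext v; simp
    · intro u v
      rw [hB', hB', hB', connMinus_J_left hJ, connMinus_J hD, map_neg, hJ]
      change (3 : ℝ) • B u v = _
      module

/-- The derivation attached to a family that is complex linear in the direction and complex
antilinear in the other argument shifts weights by `±1`. -/
theorem typeProj_contract_connPlus (hJ : ∀ v, J (J v) = -v)
    (hD : ∀ u v, D u (J v) = -J (D u v)) {m : ℤ} {η : E [⋀^Fin k]→L[ℝ] ℂ} (hη : HasWeight J m η)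
    {p q : ℤ} (hp : p - q ≠ m + 1) (hm : p - q ≠ m - 1) :
    typeProj J p q (contract (connPlus J D) η) = 0 := by
  set B := connPlus J D
  set B' := ContinuousLinearMap.compL ℝ E E E J ∘L B
  have hB' : ∀ u v, B' u v = J (B u v) := fun u v => rfl
  refine typeProj_eq_zero_of_sq hJ (m := m) (r := -1) (θ := contract B' η) ?_ ?_
    (by omega) (by omega)
  · rw [derAct_contract J B ((-1 : ℝ) • B'), hη, contract_smul, contract_map_smul]
    · ext v; simp
    · intro u v
      rw [connPlus_J_left hJ, connPlus_J hD]
      change (-1 : ℝ) • J (B u v) = _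
      module
  · rw [derAct_contract J B' ((1 : ℝ) • B), hη, contract_smul, contract_map_smul]
    · ext v; simp
    · intro u v
      rw [hB', hB', hB', connPlus_J_left hJ, connPlus_J hD, map_neg, hJ]
      change (1 : ℝ) • B u v = _
      module

/-- The alternation of a one-form with values in forms of weight `m` has weights `m ± 1`. -/
theorem typeProj_alternatize (hJ : ∀ v, J (J v) = -v) {m : ℤ}
    {f : E →L[ℝ] E [⋀^Fin k]→L[ℝ] ℂ} (hf : ∀ u, HasWeight J m (f u))
    {p q : ℤ} (hp : p - q ≠ m + 1) (hm : p - q ≠ m - 1) :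
    typeProj J p q (alternatizeUncurryFin f) = 0 := by
  have hc : ∀ g : E →L[ℝ] E [⋀^Fin k]→L[ℝ] ℂ, (∀ u, HasWeight J m (g u)) →
      derAct J (alternatizeUncurryFin g) =
        (Complex.I * m) • alternatizeUncurryFin g + alternatizeUncurryFin (g ∘L J) := by
    intro g hg
    rw [← alternatizeUncurryFin_smul, ← alternatizeUncurryFin_add]
    refine derAct_alternatize _ _ _ fun u => ?_
    rw [hg u]; rfl
  refine typeProj_eq_zero_of_sq hJ (m := m) (r := 1) (θ := alternatizeUncurryFin (f ∘L J)) ?_ ?_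
    hp hm
  · rw [hc f hf]
    ext v; simp
  · rw [hc (f ∘L J) fun u => hf _]
    have : (f ∘L J) ∘L J = -f := by
      ext1 u
      change f (J (J u)) = -f u
      rw [hJ, map_neg]
    rw [this, alternatize_neg]
    ext v
    simp [sub_eq_add_neg]

theorem fderiv_bilinear_apply {X Y Z : Type*} [NormedAddCommGroup X] [NormedSpace ℝ X]
    [NormedAddCommGroup Y] [NormedSpace ℝ Y] [NormedAddCommGroup Z] [NormedSpace ℝ Z]
    (L : X →L[ℝ] Y →L[ℝ] Z) {a : E → X} {b : E → Y} {y : E} (ha : DifferentiableAt ℝ a y)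
    (hb : DifferentiableAt ℝ b y) (u : E) :
    fderiv ℝ (fun z => L (a z) (b z)) y u =
      L (fderiv ℝ a y u) (b y) + L (a y) (fderiv ℝ b y u) := by
  rw [L.fderiv_of_bilinear ha hb, add_comm]
  rfl

theorem fderiv_derAct {J : E → E →L[ℝ] E} {η : E → E [⋀^Fin k]→L[ℝ] ℂ} {y : E}
    (hJ : DifferentiableAt ℝ J y) (hη : DifferentiableAt ℝ η y) (u : E) :
    fderiv ℝ (fun z => derAct (J z) (η z)) y u =
      derAct (J y) (fderiv ℝ η y u) + derAct (fderiv ℝ J y u) (η y) := by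
  have h := fderiv_bilinear_apply (fderivCompContinuousLinearMapCLM ℂ (.id ℝ E)) hη hJ u
  exact h

/-- Where `J² = -1`, the derivative of `J` anticommutes with `J`. -/
theorem fderiv_almostComplex {J : E → E →L[ℝ] E} {y : E} (hJ : DifferentiableAt ℝ J y)
    (hsq : ∀ᶠ z in nhds y, ∀ v, J z (J z v) = -v) (u v : E) :
    fderiv ℝ J y u (J y v) = -J y (fderiv ℝ J y u v) := by
  have h1 := hJ.hasFDerivAt.clm_apply (hJ.hasFDerivAt.clm_apply (hasFDerivAt_const v y))
  have h2 : (fun z => J z (J z v)) =ᶠ[nhds y] fun _ => -v := hsq.mono fun z hz => hz v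
  have h3 := (h1.congr_of_eventuallyEq h2.symm).unique (hasFDerivAt_const (-v) y)
  have h4 := congrArg (fun A => A u) h3
  simp at h4
  rw [eq_neg_iff_add_eq_zero, add_comm]
  exact h4

/-- The exterior derivative of a form of constant weight `m` in terms of a connection that
preserves weights: up to weights `m ± 1` it is the algebraic term `contract (connMinus ..)`, which
has weights `m ± 3`. -/
theorem typeProj_extDeriv_sub {J : E → E →L[ℝ] E} {η : E → E [⋀^Fin k]→L[ℝ] ℂ} {y : E}
    (hJ : DifferentiableAt ℝ J y) (hsq : ∀ᶠ z in nhds y, ∀ v, J z (J z v) = -v)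
    (hη : DifferentiableAt ℝ η y) {m : ℤ} (hm : ∀ᶠ z in nhds y, HasWeight (J z) m (η z))
    {p q : ℤ} (h1 : p - q ≠ m + 1) (h2 : p - q ≠ m - 1) :
    typeProj (J y) p q (extDeriv η y) =
      typeProj (J y) p q (contract (connMinus (J y) (fderiv ℝ J y)) (η y)) := by
  have hsqy := hsq.self_of_nhds
  have hD := fderiv_almostComplex hJ hsq
  set B := connForm (J y) (fderiv ℝ J y) with hB
  set f : E →L[ℝ] E [⋀^Fin k]→L[ℝ] ℂ :=
    fderiv ℝ η y - (η y).fderivCompContinuousLinearMap (.id ℝ E) ∘L B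
  have hf : ∀ u, f u = fderiv ℝ η y u - derAct (B u) (η y) := fun u => rfl
  -- The covariant derivative `f` preserves the weight, as the connection makes `J` parallel.
  have hweight : ∀ u, HasWeight (J y) m (f u) := by
    intro u
    have e1 : fderiv ℝ (fun z => derAct (J z) (η z)) y u = (Complex.I * m) • fderiv ℝ η y u := by
      have : (fun z => derAct (J z) (η z)) =ᶠ[nhds y] fun z => (Complex.I * m) • η z := hm
      rw [this.fderiv_eq, fderiv_fun_const_smul hη]
      rfl
    rw [fderiv_derAct hJ hη] at e1
    have e2 := derAct_comm (J y) (B u) (η y)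
    have e3 : B u ∘L J y - J y ∘L B u = -fderiv ℝ J y u := by
      ext v
      change B u (J y v) - J y (B u v) = -fderiv ℝ J y u v
      rw [connForm_J hD, connForm_apply, map_smul, hsqy]
      module
    have hmy : derAct (J y) (η y) = (Complex.I * m) • η y := hm.self_of_nhds
    rw [e3, derAct_map_neg, hmy, derAct_smul, sub_eq_iff_eq_add] at e2
    rw [HasWeight, hf, derAct_sub, e2, eq_sub_of_add_eq e1]
    module
  have hd : extDeriv η y = alternatizeUncurryFin f +
      (contract (connPlus (J y) (fderiv ℝ J y)) (η y)
        + contract (connMinus (J y) (fderiv ℝ J y)) (η y)) := by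
    rw [← contract_map_add, connPlus_add_connMinus, ← hB, contract, ← alternatizeUncurryFin_add,
      extDeriv]
    congr 1
    ext1 u
    change _ = (fderiv ℝ η y u - derAct (B u) (η y)) + derAct (B u) (η y)
    abel
  rw [hd, typeProj_add, typeProj_add, typeProj_alternatize hsqy hweight h1 h2,
    typeProj_contract_connPlus hsqy hD hm.self_of_nhds h1 h2, zero_add, zero_add]

end FirstOrder

/-! ### Hodge components of the exterior derivative on an open set -/

section LocalComponents

open ContinuousAlternatingMap hiding add_apply sub_apply neg_apply smul_apply

variable {E : Type*} [NormedAddCommGroup E] [NormedSpace ℝ E] {k : ℕ}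

theorem eq_of_typeProj_eq (J : E →L[ℝ] E) {η θ : E [⋀^Fin k]→L[ℝ] ℂ}
    (h : ∀ p q : ℤ, p + q = k → typeProj J p q η = typeProj J p q θ) : η = θ := by
  rw [← sum_typeProj J η, ← sum_typeProj J θ]
  refine Finset.sum_congr rfl fun pq hpq => h _ _ ?_
  exact_mod_cast Finset.HasAntidiagonal.mem_antidiagonal.1 hpq

theorem typeProj_typeProj_self {J : E →L[ℝ] E} (hJ : ∀ v, J (J v) = -v) (p q : ℤ)
    (η : E [⋀^Fin k]→L[ℝ] ℂ) : typeProj J p q (typeProj J p q η) = typeProj J p q η := by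
  by_cases h : p + q = k
  · exact (hasWeight_typeProj J hJ p q η).typeProj_eq_self hJ rfl h
  · rw [typeProj_of_add_ne J h, typeProj_of_add_ne J h]

theorem typeProj_typeProj_of_ne {J : E →L[ℝ] E} (hJ : ∀ v, J (J v) = -v) {p q p' q' : ℤ}
    (h : p' - q' ≠ p - q) (η : E [⋀^Fin k]→L[ℝ] ℂ) :
    typeProj J p' q' (typeProj J p q η) = 0 :=
  (hasWeight_typeProj J hJ p q η).typeProj_eq_zero hJ h

/-- The Hodge component `d^{i,j}` of the exterior derivative for a field `J` of complex structures
on a vector space. -/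
def locComp (J : E → E →L[ℝ] E) (i j : ℤ) (η : E → E [⋀^Fin k]→L[ℝ] ℂ) (y : E) :
    E [⋀^Fin (k + 1)]→L[ℝ] ℂ :=
  ∑ pq ∈ antidiagonal k, typeProj (J y) (pq.1 + i) (pq.2 + j)
    (extDeriv (fun z => typeProj (J z) pq.1 pq.2 (η z)) y)

/-- `J` is a smooth almost complex structure on the set `U`, and `U` is open. -/
structure IsAlmostComplexOn (J : E → E →L[ℝ] E) (U : Set E) : Prop where
  isOpen : IsOpen U
  smooth : ContDiffOn ℝ ∞ J U
  sq : ∀ y ∈ U, ∀ v, J y (J y v) = -v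

variable {J : E → E →L[ℝ] E} {U : Set E} {η : E → E [⋀^Fin k]→L[ℝ] ℂ}

theorem differentiableAt_of_contDiffOn {F : Type*} [NormedAddCommGroup F] [NormedSpace ℝ F]
    {f : E → F} (hf : ContDiffOn ℝ ∞ f U) (hU : IsOpen U) {y : E} (hy : y ∈ U) :
    DifferentiableAt ℝ f y :=
  (hf.contDiffAt (hU.mem_nhds hy)).differentiableAt (by norm_num)

theorem fderiv_almostComplex_of_mem (h : IsAlmostComplexOn J U) {y : E} (hy : y ∈ U) (u v : E) :
    fderiv ℝ J y u (J y v) = -J y (fderiv ℝ J y u v) :=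
  fderiv_almostComplex (differentiableAt_of_contDiffOn h.smooth h.isOpen hy)
    (Filter.mem_of_superset (h.isOpen.mem_nhds hy) h.sq) u v

/-- On forms of pure type `(p,q)` the component `d^{i,j}` is a component of `d`. -/
theorem locComp_of_type (h : IsAlmostComplexOn J U) {p q : ℤ}
    (ht : ∀ z ∈ U, typeProj (J z) p q (η z) = η z) (i j : ℤ) {y : E} (hy : y ∈ U) :
    locComp J i j η y = typeProj (J y) (p + i) (q + j) (extDeriv η y) := by
  have hnear := h.isOpen.mem_nhds hy
  have hzero : ∀ θ : E → E [⋀^Fin k]→L[ℝ] ℂ, (∀ z ∈ U, θ z = 0) → extDeriv θ y = 0 := by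
    intro θ hθ
    have h1 : θ =ᶠ[nhds y] fun _ => 0 := Filter.mem_of_superset hnear hθ
    rw [h1.extDeriv_eq, extDeriv, fderiv_fun_const]
    ext v
    simp [alternatizeUncurryFin_apply]
  by_cases hpq : p + q = k ∧ 0 ≤ p ∧ 0 ≤ q
  · obtain ⟨hk, hp, hq⟩ := hpq
    obtain ⟨a, rfl⟩ := Int.eq_ofNat_of_zero_le hp
    obtain ⟨b, rfl⟩ := Int.eq_ofNat_of_zero_le hq
    have hab : (a, b) ∈ antidiagonal k := by
      rw [Finset.HasAntidiagonal.mem_antidiagonal]; exact_mod_cast hk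
    rw [locComp, Finset.sum_eq_single_of_mem _ hab]
    · have h1 : (fun z => typeProj (J z) a b (η z)) =ᶠ[nhds y] η :=
        Filter.mem_of_superset hnear ht
      rw [h1.extDeriv_eq]
    · intro pq hpq' hne
      rw [hzero, typeProj_zero]
      intro z hz
      rw [← ht z hz]
      refine typeProj_typeProj_of_ne (h.sq z hz) (fun h2 => hne ?_) _
      have := Finset.HasAntidiagonal.mem_antidiagonal.1 hpq'
      ext <;> simp <;> omega
  -- The remaining types belong to the zero form.
  · have h0 : ∀ z ∈ U, η z = 0 := by
      intro z hz
      rw [← ht z hz]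
      by_cases hk : p + q = k
      · exact typeProj_of_neg _ (by omega) _
      · exact typeProj_of_add_ne _ hk _
    rw [hzero η h0, typeProj_zero, locComp, Finset.sum_eq_zero]
    intro pq _
    rw [hzero, typeProj_zero]
    intro z hz
    rw [h0 z hz, typeProj_zero]

theorem typeProj_locComp (h : IsAlmostComplexOn J U) {p q : ℤ}
    (ht : ∀ z ∈ U, typeProj (J z) p q (η z) = η z) (i j : ℤ) :
    ∀ z ∈ U, typeProj (J z) (p + i) (q + j) (locComp J i j η z) = locComp J i j η z := by
  intro z hz
  rw [locComp_of_type h ht i j hz, typeProj_typeProj_self (h.sq z hz)]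

variable [FiniteDimensional ℝ E]

theorem contDiffOn_locComp (h : IsAlmostComplexOn J U) (hη : ContDiffOn ℝ ∞ η U) (i j : ℤ) :
    ContDiffOn ℝ ∞ (locComp J i j η) U :=
  ContDiffOn.sum fun _ _ => contDiffOn_typeProj h.smooth
    (contDiffOn_extDeriv h.isOpen (contDiffOn_typeProj h.smooth hη _ _)) _ _

theorem extDeriv_eq_sum_typeProj (h : IsAlmostComplexOn J U) (hη : ContDiffOn ℝ ∞ η U) {y : E}
    (hy : y ∈ U) : extDeriv η y =
      ∑ pq ∈ antidiagonal k, extDeriv (fun z => typeProj (J z) pq.1 pq.2 (η z)) y := by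
  have h1 : η = fun z => ∑ pq ∈ antidiagonal k, typeProj (J z) pq.1 pq.2 (η z) :=
    funext fun z => (sum_typeProj (J z) (η z)).symm
  have h2 : fderiv ℝ η y =
      ∑ pq ∈ antidiagonal k, fderiv ℝ (fun z => typeProj (J z) pq.1 pq.2 (η z)) y := by
    conv_lhs => rw [h1]
    exact fderiv_fun_sum fun pq _ =>
      differentiableAt_of_contDiffOn (contDiffOn_typeProj h.smooth hη _ _) h.isOpen hy
  rw [extDeriv, h2]
  exact _root_.map_sum (AddMonoidHom.mk' (alternatizeUncurryFin (𝕜 := ℝ) (E := E) (F := ℂ)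
    (n := k)) alternatizeUncurryFin_add) _ _

/-- The components of weight different from `m ± 1` of the exterior derivative of a form of
weight `m` are algebraic. -/
theorem typeProj_extDeriv_typeProj (h : IsAlmostComplexOn J U) (hη : ContDiffOn ℝ ∞ η U) {y : E}
    (hy : y ∈ U) {a b p q : ℤ} (h1 : p - q ≠ a - b + 1) (h2 : p - q ≠ a - b - 1) :
    typeProj (J y) p q (extDeriv (fun z => typeProj (J z) a b (η z)) y) =
      typeProj (J y) p q
        (contract (connMinus (J y) (fderiv ℝ J y)) (typeProj (J y) a b (η y))) := by
  have hnear := h.isOpen.mem_nhds hy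
  exact typeProj_extDeriv_sub (differentiableAt_of_contDiffOn h.smooth h.isOpen hy)
    (Filter.mem_of_superset hnear h.sq)
    (differentiableAt_of_contDiffOn (contDiffOn_typeProj h.smooth hη a b) h.isOpen hy)
    (m := a - b)
    (Filter.mem_of_superset hnear fun z hz => hasWeight_typeProj (J z) (h.sq z hz) a b (η z)) h1 h2

/-- The operator `C = N + N̄` is algebraic: it is the contraction with the complex antilinear part
of the connection form. -/
theorem locComp_add_locComp (h : IsAlmostComplexOn J U) (hη : ContDiffOn ℝ ∞ η U) {y : E}
    (hy : y ∈ U) : locComp J 2 (-1) η y + locComp J (-1) 2 η y =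
      contract (connMinus (J y) (fderiv ℝ J y)) (η y) := by
  set B := connMinus (J y) (fderiv ℝ J y)
  have hc : contract B (η y) =
      ∑ pq ∈ antidiagonal k, contract B (typeProj (J y) pq.1 pq.2 (η y)) := by
    conv_lhs => rw [← sum_typeProj (J y) (η y)]
    let L : (E [⋀^Fin k]→L[ℝ] ℂ) →ₗ[ℂ] E [⋀^Fin (k + 1)]→L[ℝ] ℂ :=
      { toFun := contract B
        map_add' := contract_add B
        map_smul' := contract_smul B }
    exact _root_.map_sum L _ _
  rw [hc, locComp, locComp, ← Finset.sum_add_distrib]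
  refine Finset.sum_congr rfl fun pq hpq => ?_
  have hk : (pq.1 : ℤ) + pq.2 = k := by
    exact_mod_cast Finset.HasAntidiagonal.mem_antidiagonal.1 hpq
  have hsq := h.sq y hy
  rw [typeProj_extDeriv_typeProj h hη hy (by omega) (by omega),
    typeProj_extDeriv_typeProj h hη hy (by omega) (by omega)]
  refine eq_of_typeProj_eq (J y) fun p q hpq' => ?_
  rw [typeProj_add]
  push_cast at hpq'
  by_cases h1 : p - q = pq.1 - pq.2 + 3
  · obtain rfl : p = pq.1 + 2 := by omega
    obtain rfl : q = pq.2 + -1 := by omega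
    rw [typeProj_typeProj_self hsq, typeProj_typeProj_of_ne hsq (by omega), add_zero]
  · by_cases h2 : p - q = pq.1 - pq.2 - 3
    · obtain rfl : p = pq.1 + -1 := by omega
      obtain rfl : q = pq.2 + 2 := by omega
      rw [typeProj_typeProj_self hsq, typeProj_typeProj_of_ne hsq (by omega), zero_add]
    · rw [typeProj_typeProj_of_ne hsq (by omega), typeProj_typeProj_of_ne hsq (by omega),
        typeProj_contract_connMinus hsq (fderiv_almostComplex_of_mem h hy)
          (hasWeight_typeProj (J y) hsq _ _ _) h1 h2, zero_add]

/-- The exterior derivative has the four Hodge components `d^{1,0}`, `d^{0,1}`, `d^{2,-1}`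
and `d^{-1,2}` only. -/
theorem extDeriv_eq_locComp (h : IsAlmostComplexOn J U) (hη : ContDiffOn ℝ ∞ η U) {y : E}
    (hy : y ∈ U) : extDeriv η y =
      locComp J 1 0 η y + locComp J 0 1 η y + (locComp J 2 (-1) η y + locComp J (-1) 2 η y) := by
  rw [extDeriv_eq_sum_typeProj h hη hy]
  simp only [locComp, ← Finset.sum_add_distrib]
  refine Finset.sum_congr rfl fun pq hpq => ?_
  have hk : (pq.1 : ℤ) + pq.2 = k := by
    exact_mod_cast Finset.HasAntidiagonal.mem_antidiagonal.1 hpq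
  have hsq := h.sq y hy
  refine eq_of_typeProj_eq (J y) fun p q hpq' => ?_
  simp only [typeProj_add]
  push_cast at hpq'
  by_cases h1 : p - q = pq.1 - pq.2 + 1
  · obtain rfl : p = pq.1 + 1 := by omega
    obtain rfl : q = pq.2 + 0 := by omega
    rw [typeProj_typeProj_self hsq, typeProj_typeProj_of_ne hsq (by omega),
      typeProj_typeProj_of_ne hsq (by omega), typeProj_typeProj_of_ne hsq (by omega)]
    simp
  by_cases h2 : p - q = pq.1 - pq.2 - 1
  · obtain rfl : p = pq.1 + 0 := by omega
    obtain rfl : q = pq.2 + 1 := by omega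
    rw [typeProj_typeProj_self hsq, typeProj_typeProj_of_ne hsq (by omega),
      typeProj_typeProj_of_ne hsq (by omega), typeProj_typeProj_of_ne hsq (by omega)]
    simp
  by_cases h3 : p - q = pq.1 - pq.2 + 3
  · obtain rfl : p = pq.1 + 2 := by omega
    obtain rfl : q = pq.2 + -1 := by omega
    rw [typeProj_typeProj_self hsq, typeProj_typeProj_of_ne hsq (by omega),
      typeProj_typeProj_of_ne hsq (by omega), typeProj_typeProj_of_ne hsq (by omega)]
    simp
  by_cases h4 : p - q = pq.1 - pq.2 - 3
  · obtain rfl : p = pq.1 + -1 := by omega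
    obtain rfl : q = pq.2 + 2 := by omega
    rw [typeProj_typeProj_self hsq, typeProj_typeProj_of_ne hsq (by omega),
      typeProj_typeProj_of_ne hsq (by omega), typeProj_typeProj_of_ne hsq (by omega)]
    simp
  · rw [typeProj_extDeriv_typeProj h hη hy h1 h2,
      typeProj_contract_connMinus hsq (fderiv_almostComplex_of_mem h hy)
        (hasWeight_typeProj (J y) hsq _ _ _) h3 h4,
      typeProj_typeProj_of_ne hsq (by omega), typeProj_typeProj_of_ne hsq (by omega),
      typeProj_typeProj_of_ne hsq (by omega), typeProj_typeProj_of_ne hsq (by omega)]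
    simp

/-- The component of bidegree `(1,1)` of the identity `d² = 0`. -/
theorem locComp_anticomm (h : IsAlmostComplexOn J U) (hη : ContDiffOn ℝ ∞ η U) {p q : ℤ}
    (ht : ∀ z ∈ U, typeProj (J z) p q (η z) = η z) {y : E} (hy : y ∈ U) :
    locComp J 0 1 (locComp J 1 0 η) y + locComp J 1 0 (locComp J 0 1 η) y +
      (locComp J (-1) 2 (locComp J 2 (-1) η) y + locComp J 2 (-1) (locComp J (-1) 2 η) y) = 0 := by
  have hnear := h.isOpen.mem_nhds hy
  have hd : extDeriv (extDeriv η) y = 0 :=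
    extDeriv_extDeriv_apply (hη.contDiffAt hnear)
      (by rw [minSmoothness_of_isRCLikeNormedField]
          exact WithTop.coe_le_coe.2 (le_top (a := (2 : ℕ∞))))
  have he : extDeriv η =ᶠ[nhds y] (locComp J 1 0 η + locComp J 0 1 η) +
      (locComp J 2 (-1) η + locComp J (-1) 2 η) :=
    Filter.mem_of_superset hnear fun z hz => extDeriv_eq_locComp h hη hz
  have hdiff : ∀ i j : ℤ, DifferentiableAt ℝ (locComp J i j η) y := fun i j =>
    differentiableAt_of_contDiffOn (contDiffOn_locComp h hη i j) h.isOpen hy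
  rw [he.extDeriv_eq, extDeriv_add ((hdiff _ _).add (hdiff _ _)) ((hdiff _ _).add (hdiff _ _)),
    extDeriv_add (hdiff _ _) (hdiff _ _), extDeriv_add (hdiff _ _) (hdiff _ _)] at hd
  have hP := congrArg (typeProj (J y) (p + 1) (q + 1)) hd
  rw [typeProj_zero, typeProj_add, typeProj_add, typeProj_add] at hP
  have key : ∀ i j i' j' : ℤ, i + i' = 1 → j + j' = 1 →
      locComp J i' j' (locComp J i j η) y =
        typeProj (J y) (p + 1) (q + 1) (extDeriv (locComp J i j η) y) := by
    intro i j i' j' hi hj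
    rw [locComp_of_type h (typeProj_locComp h ht i j) i' j' hy, add_assoc p, add_assoc q, hi, hj]
  rw [key 1 0 0 1 (by norm_num) (by norm_num), key 0 1 1 0 (by norm_num) (by norm_num),
    key 2 (-1) (-1) 2 (by norm_num) (by norm_num), key (-1) 2 2 (-1) (by norm_num) (by norm_num)]
  exact hP

/-- If the form `C² η` is of type `(p+1,q+1)` for `η` of type `(p,q)`,
then it is `-(∂∂̄ + ∂̄∂) η`. -/
theorem locC_locC_eq_neg (h : IsAlmostComplexOn J U) (hη : ContDiffOn ℝ ∞ η U) {p q : ℤ}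
    (ht : ∀ z ∈ U, typeProj (J z) p q (η z) = η z) {y : E} (hy : y ∈ U)
    (hC : typeProj (J y) (p + 1) (q + 1) (contract (connMinus (J y) (fderiv ℝ J y))
      (contract (connMinus (J y) (fderiv ℝ J y)) (η y))) =
      contract (connMinus (J y) (fderiv ℝ J y))
        (contract (connMinus (J y) (fderiv ℝ J y)) (η y))) :
    contract (connMinus (J y) (fderiv ℝ J y)) (contract (connMinus (J y) (fderiv ℝ J y)) (η y)) =
      -(locComp J 1 0 (locComp J 0 1 η) y + locComp J 0 1 (locComp J 1 0 η) y) := by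
  set B := connMinus (J y) (fderiv ℝ J y)
  have hsq := h.sq y hy
  have hs := fun i j => contDiffOn_locComp h hη i j
  have htt := fun i j => typeProj_locComp h ht i j
  have h1 : contract B (contract B (η y)) =
      (locComp J 2 (-1) (locComp J 2 (-1) η) y + locComp J (-1) 2 (locComp J 2 (-1) η) y) +
      (locComp J 2 (-1) (locComp J (-1) 2 η) y + locComp J (-1) 2 (locComp J (-1) 2 η) y) := by
    rw [locComp_add_locComp h (hs _ _) hy, locComp_add_locComp h (hs _ _) hy, ← contract_add,
      locComp_add_locComp h hη hy]
  have key : ∀ i j i' j' : ℤ, i + i' = 1 → j + j' = 1 →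
      typeProj (J y) (p + 1) (q + 1) (locComp J i' j' (locComp J i j η) y) =
        locComp J i' j' (locComp J i j η) y := by
    intro i j i' j' hi hj
    have := typeProj_locComp h (htt i j) i' j' y hy
    rwa [add_assoc p, add_assoc q, hi, hj] at this
  have key0 : ∀ i j i' j' : ℤ, i + i' - (j + j') ≠ 0 →
      typeProj (J y) (p + 1) (q + 1) (locComp J i' j' (locComp J i j η) y) = 0 := by
    intro i j i' j' hij
    rw [← typeProj_locComp h (htt i j) i' j' y hy]
    exact typeProj_typeProj_of_ne hsq (by omega) _
  rw [← hC, h1, typeProj_add, typeProj_add, typeProj_add,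
    key0 2 (-1) 2 (-1) (by norm_num), key0 (-1) 2 (-1) 2 (by norm_num),
    key 2 (-1) (-1) 2 (by norm_num) (by norm_num), key (-1) 2 2 (-1) (by norm_num) (by norm_num),
    zero_add, add_zero, eq_neg_iff_add_eq_zero, ← locComp_anticomm h hη ht hy]
  abel

end LocalComponents

/-! ### Hermitian linear algebra in complex dimension three -/

section HermitianAlgebra

open ContinuousAlternatingMap hiding add_apply sub_apply neg_apply smul_apply map_sum

variable {E : Type*} [NormedAddCommGroup E] [NormedSpace ℝ E]

/-- `g` is a Hermitian inner product for the complex structure `J`. -/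
structure IsHermitianStructure (J : E →L[ℝ] E) (g : E →L[ℝ] E →L[ℝ] ℝ) : Prop where
  sq : ∀ v, J (J v) = -v
  symm : ∀ u v, g u v = g v u
  pos : ∀ v, v ≠ 0 → 0 < g v v
  orth : ∀ u v, g (J u) (J v) = g u v

/-- The Hermitian form `h(u,v) = g(u,v) + √-1 g(Ju,v)`, complex linear in `v`. -/
def herm (J : E →L[ℝ] E) (g : E →L[ℝ] E →L[ℝ] ℝ) (u : E) : E →L[ℝ] ℂ :=
  Complex.ofRealCLM ∘L g u + Complex.I • (Complex.ofRealCLM ∘L g (J u))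

theorem herm_apply (J : E →L[ℝ] E) (g : E →L[ℝ] E →L[ℝ] ℝ) (u v : E) :
    herm J g u v = (g u v : ℂ) + Complex.I * (g (J u) v : ℂ) := rfl

variable {J : E →L[ℝ] E} {g : E →L[ℝ] E →L[ℝ] ℝ}

namespace IsHermitianStructure

variable (H : IsHermitianStructure J g)

include H

theorem J_right (u v : E) : g u (J v) = -g (J u) v := by
  rw [← H.orth u (J v), H.sq, map_neg]

theorem self_J (u : E) : g u (J u) = 0 := by
  have h1 := H.J_right u u
  rw [H.symm (J u) u] at h1
  linarith

theorem herm_J (u v : E) : herm J g u (J v) = Complex.I * herm J g u v := by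
  rw [herm_apply, herm_apply, H.orth, H.J_right]
  push_cast
  linear_combination (-(g (J u) v : ℂ)) * Complex.I_mul_I

theorem herm_conj (u v : E) : herm J g v u = (starRingEnd ℂ) (herm J g u v) := by
  rw [herm_apply, herm_apply, H.symm v u, H.symm (J v) u, H.J_right]
  simp

/-- Fewer vectors than the dimension have a common unit normal vector. -/
theorem exists_unit_orthogonal {n : ℕ} (hn : n < Module.finrank ℝ E) (s : Fin n → E) :
    ∃ v, g v v = 1 ∧ ∀ i, g (s i) v = 0 := by
  have : FiniteDimensional ℝ E := Module.finite_of_finrank_pos (by omega)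
  let φ : E →ₗ[ℝ] (Fin n → ℝ) := LinearMap.pi fun i => (g (s i)).toLinearMap
  have hker : LinearMap.ker φ ≠ ⊥ := LinearMap.ker_ne_bot_of_finrank_lt (by simpa using hn)
  obtain ⟨v, hv, hv0⟩ := (Submodule.ne_bot_iff _).1 hker
  have hpos := H.pos v hv0
  refine ⟨(Real.sqrt (g v v))⁻¹ • v, ?_, fun i => ?_⟩
  · simp only [map_smul, smul_eq_mul, smul_apply]
    have h1 := Real.mul_self_sqrt hpos.le
    have h2 : Real.sqrt (g v v) ≠ 0 := (Real.sqrt_pos.2 hpos).ne'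
    field_simp
    nlinarith
  · have : g (s i) v = 0 := congrFun (LinearMap.mem_ker.1 hv) i
    rw [map_smul, this, smul_zero]

/-- In complex dimension three there is a unitary frame. -/
theorem exists_unitary_frame (hE : Module.finrank ℝ E = 6) :
    ∃ e : Fin 3 → E, (∀ a b, g (e a) (e b) = if a = b then 1 else 0) ∧
      ∀ a b, g (e a) (J (e b)) = 0 := by
  obtain ⟨e0, h0, -⟩ := H.exists_unit_orthogonal (n := 0) (by omega) ![]
  obtain ⟨e1, h1, o1⟩ := H.exists_unit_orthogonal (n := 2) (by omega) ![e0, J e0]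
  obtain ⟨e2, h2, o2⟩ := H.exists_unit_orthogonal (n := 4) (by omega) ![e0, J e0, e1, J e1]
  have a1 : g e0 e1 = 0 := o1 0
  have a2 : g (J e0) e1 = 0 := o1 1
  have b1 : g e0 e2 = 0 := o2 0
  have b2 : g (J e0) e2 = 0 := o2 1
  have c1 : g e1 e2 = 0 := o2 2
  have c2 : g (J e1) e2 = 0 := o2 3
  have k1 : g e1 e0 = 0 := by rw [H.symm, a1]
  have k2 : g e2 e0 = 0 := by rw [H.symm, b1]
  have k3 : g e2 e1 = 0 := by rw [H.symm, c1]
  have l1 : g (J e1) e0 = 0 := by rw [H.symm, H.J_right, a2, neg_zero]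
  have l2 : g (J e2) e0 = 0 := by rw [H.symm, H.J_right, b2, neg_zero]
  have l3 : g (J e2) e1 = 0 := by rw [H.symm, H.J_right, c2, neg_zero]
  refine ⟨![e0, e1, e2], fun a b => ?_, fun a b => ?_⟩
  · fin_cases a <;> fin_cases b <;> simp [*]
  · fin_cases a <;> fin_cases b <;> simp [H.J_right, *] <;>
      simp [H.symm (J _) _, H.self_J]

end IsHermitianStructure

/-- `e` is a unitary frame of a Hermitian vector space of complex dimension three. -/
structure IsUnitaryFrame (J : E →L[ℝ] E) (g : E →L[ℝ] E →L[ℝ] ℝ) (e : Fin 3 → E) : Prop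
    extends IsHermitianStructure J g where
  finrank : Module.finrank ℝ E = 6
  orthonormal : ∀ a b, g (e a) (e b) = if a = b then 1 else 0
  totallyReal : ∀ a b, g (e a) (J (e b)) = 0

namespace IsUnitaryFrame

variable {e : Fin 3 → E} (F : IsUnitaryFrame J g e)

include F

theorem herm_frame (a b : Fin 3) : herm J g (e a) (e b) = if a = b then 1 else 0 := by
  have := F.totallyReal b a
  rw [F.symm] at this
  rw [herm_apply, F.orthonormal, this]
  split_ifs <;> simp

/-- The coordinates `h(eₐ, ·)` separate vectors. -/
theorem eq_of_herm_eq {u v : E} (h : ∀ a, herm J g (e a) u = herm J g (e a) v) : u = v := by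
  have : FiniteDimensional ℝ E := Module.finite_of_finrank_pos (by rw [F.finrank]; norm_num)
  let φ : E →ₗ[ℝ] (Fin 3 → ℂ) := LinearMap.pi fun a => (herm J g (e a)).toLinearMap
  have hsurj : Function.Surjective φ := by
    intro z
    refine ⟨∑ b, ((z b).re • e b + (z b).im • J (e b)), funext fun a => ?_⟩
    change herm J g (e a) _ = z a
    simp only [map_sum, map_add, map_smul, F.herm_J, F.herm_frame]
    fin_cases a <;> simp [Fin.sum_univ_three, mul_comm Complex.I]
  have hdim : Module.finrank ℝ E = Module.finrank ℝ (Fin 3 → ℂ) := by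
    rw [F.finrank, Module.finrank_pi_fintype]
    simp [Complex.finrank_real_complex]
  exact (LinearMap.injective_iff_surjective_of_finrank_eq_finrank hdim).2 hsurj (funext h)

/-- A complex linear functional is determined by its values on the frame. -/
theorem expand (f : E →L[ℝ] ℂ) (hf : ∀ v, f (J v) = Complex.I * f v) (v : E) :
    f v = ∑ a, herm J g (e a) v * f (e a) := by
  have hv : v = ∑ b, ((herm J g (e b) v).re • e b + (herm J g (e b) v).im • J (e b)) := by
    refine F.eq_of_herm_eq fun a => ?_
    simp only [map_sum, map_add, map_smul, F.herm_J, F.herm_frame]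
    fin_cases a <;> simp [Fin.sum_univ_three, mul_comm Complex.I]
  conv_lhs => rw [hv]
  simp only [map_sum, map_add, map_smul, hf]
  refine Finset.sum_congr rfl fun a _ => ?_
  conv_rhs => rw [← Complex.re_add_im (herm J g (e a) v)]
  simp only [Complex.real_smul]
  ring

theorem herm_eq_sum (u v : E) :
    herm J g u v = ∑ a, (starRingEnd ℂ) (herm J g (e a) u) * herm J g (e a) v := by
  rw [F.expand (herm J g u) (F.herm_J u) v]
  refine Finset.sum_congr rfl fun a _ => ?_
  rw [F.herm_conj (e a) u, mul_comm]

end IsUnitaryFrame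

/-- The value `Ω(u,v,w)` of a three-form, as an iterated interior product. -/
def val3 (Om : E [⋀^Fin 3]→L[ℝ] ℂ) (u v w : E) : ℂ := int w (int v (int u Om)) ![]

theorem val3_swap_right (Om : E [⋀^Fin 3]→L[ℝ] ℂ) (u v w : E) :
    val3 Om u w v = -val3 Om u v w := by
  rw [val3, int_anticomm]; rfl

theorem val3_swap_left (Om : E [⋀^Fin 3]→L[ℝ] ℂ) (u v w : E) :
    val3 Om v u w = -val3 Om u v w := by
  rw [val3, int_anticomm Om v u]; rfl

theorem val3_self_right (Om : E [⋀^Fin 3]→L[ℝ] ℂ) (u v : E) : val3 Om u v v = 0 := by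
  rw [val3, int_int_self]; rfl

theorem val3_self_left (Om : E [⋀^Fin 3]→L[ℝ] ℂ) (u v : E) : val3 Om u u v = 0 := by
  rw [val3, int_int_self]; rfl

theorem val3_self_outer (Om : E [⋀^Fin 3]→L[ℝ] ℂ) (u v : E) : val3 Om u v u = 0 := by
  rw [val3_swap_right, val3_self_left, neg_zero]

/-- A complex three-form in complex dimension three is a multiple of the determinant. -/
theorem val3_eq_det {e : Fin 3 → E} (F : IsUnitaryFrame J g e) {Om : E [⋀^Fin 3]→L[ℝ] ℂ}
    (hOm : ∀ u v w, val3 Om u v (J w) = Complex.I * val3 Om u v w) (u v w : E) :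
    val3 Om u v w = val3 Om (e 0) (e 1) (e 2) *
      (herm J g (e 0) u * (herm J g (e 1) v * herm J g (e 2) w -
          herm J g (e 2) v * herm J g (e 1) w) -
        herm J g (e 1) u * (herm J g (e 0) v * herm J g (e 2) w -
          herm J g (e 2) v * herm J g (e 0) w) +
        herm J g (e 2) u * (herm J g (e 0) v * herm J g (e 1) w -
          herm J g (e 1) v * herm J g (e 0) w)) := by
  have h3 : ∀ a b c, val3 Om a b c = ∑ i, herm J g (e i) c * val3 Om a b (e i) := fun a b c =>
    F.expand (ContinuousAlternatingMap.apply ℝ E ℂ ![] ∘L (int b (int a Om)).curryLeft)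
      (fun x => hOm a b x) c
  have h2 : ∀ a b c, val3 Om a b c = ∑ i, herm J g (e i) b * val3 Om a (e i) c := fun a b c => by
    rw [val3_swap_right, h3, ← Finset.sum_neg_distrib]
    refine Finset.sum_congr rfl fun i _ => ?_
    rw [val3_swap_right Om a (e i) c]; ring
  have h1 : ∀ a b c, val3 Om a b c = ∑ i, herm J g (e i) a * val3 Om (e i) b c := fun a b c => by
    rw [val3_swap_left, h2, ← Finset.sum_neg_distrib]
    refine Finset.sum_congr rfl fun i _ => ?_
    rw [val3_swap_left Om (e i) b c]; ring
  have p1 := val3_swap_right Om (e 0) (e 1) (e 2)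
  have p2 := val3_swap_left Om (e 0) (e 1) (e 2)
  have p3 := val3_swap_right Om (e 1) (e 0) (e 2)
  have p4 := val3_swap_left Om (e 0) (e 2) (e 1)
  have p5 := val3_swap_right Om (e 2) (e 0) (e 1)
  rw [p1] at p4
  rw [p2] at p3
  rw [p4] at p5
  rw [h1 u v w]
  simp only [h2 _ v w, h3 _ _ w, Fin.sum_univ_three, val3_self_right, val3_self_left,
    val3_self_outer, p1, p2, p3, p4, p5]
  ring

/-- The fundamental two-form `ω(u,v) = g(Ju,v)` as a bilinear form. -/
def fundForm (J : E →L[ℝ] E) (g : E →L[ℝ] E →L[ℝ] ℝ) : E →L[ℝ] E →L[ℝ] ℝ := g ∘L J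

theorem IsHermitianStructure.fundForm_antisymm (H : IsHermitianStructure J g) (u v : E) :
    fundForm J g v u = -fundForm J g u v := by
  change g (J v) u = -g (J u) v
  rw [H.symm, H.J_right]

theorem IsHermitianStructure.fundForm_J (H : IsHermitianStructure J g) (u v : E) :
    fundForm J g (J u) v = -fundForm J g u (J v) := by
  change g (J (J u)) v = -g (J u) (J v)
  rw [H.sq, H.orth, map_neg]
  rfl

theorem int_two_form {om : E [⋀^Fin 2]→L[ℝ] ℂ} {w : E →L[ℝ] E →L[ℝ] ℝ}
    (hom : ∀ u v, om ![u, v] = w u v) (u v : E) : int v (int u om) ![] = w u v := hom u v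

/-- The torsion `T(u,v) = B_u v - B_v u` of a family of endomorphisms. -/
def torsion (B : E →L[ℝ] E →L[ℝ] E) : E →L[ℝ] E →L[ℝ] E := B - B.flip

theorem torsion_apply (B : E →L[ℝ] E →L[ℝ] E) (u v : E) : torsion B u v = B u v - B v u := rfl

/-- The value of `contract B Ω` on four vectors. -/
theorem contract_three_form_apply (B : E →L[ℝ] E →L[ℝ] E) (Om : E [⋀^Fin 3]→L[ℝ] ℂ)
    (a b x y : E) :
    int y (int x (int b (int a (contract B Om)))) ![] =
      val3 Om (torsion B a b) x y + val3 Om b (torsion B a x) y + val3 Om b x (torsion B a y)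
        - val3 Om a (torsion B b x) y - val3 Om a x (torsion B b y)
        + val3 Om a b (torsion B x y) := by
  have hflip : ∀ u, B u - B.flip u = torsion B u := fun u => rfl
  have h0 : ∀ (A : E →L[ℝ] E) (θ : E [⋀^Fin 0]→L[ℝ] ℂ), derAct A θ = 0 := derAct_zero_form
  simp only [int_contract, hflip, int_sub, int_add, int_derAct, contract_zero_form, h0,
    ContinuousAlternatingMap.add_apply, ContinuousAlternatingMap.sub_apply,
    zero_add, sub_zero, val3]
  ring

/-- The value of the square of a two-form on four vectors. -/
theorem lef_two_form_apply {om : E [⋀^Fin 2]→L[ℝ] ℂ} {w : E →L[ℝ] E →L[ℝ] ℝ}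
    (hw : ∀ u v, w v u = -w u v) (hom : ∀ u v, om ![u, v] = w u v) (a b x y : E) :
    int y (int x (int b (int a (lef w om)))) ![] =
      2 * ((w a b : ℂ) * w x y - w a x * w b y + w a y * w b x) := by
  simp only [int_lef w hw, int_lef_zero w hw, int_extMul, int_extMul_zero, int_sub, int_add,
    int_real_smul, ContinuousAlternatingMap.add_apply, ContinuousAlternatingMap.sub_apply,
    ContinuousAlternatingMap.smul_apply, int_two_form hom, Complex.real_smul]
  ring

section Torsion

variable {e : Fin 3 → E} {B : E →L[ℝ] E →L[ℝ] E} {Om : E [⋀^Fin 3]→L[ℝ] ℂ}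
  {om : E [⋀^Fin 2]→L[ℝ] ℂ} {lam : ℝ}

/-- The equation `C Ω = -2 √-1 λ ω ∧ ω` determines the torsion. The term `Ω(T(a,b),x,y)` is the
part of `C Ω` that is complex antilinear in `a, b` and complex linear in `x, y`, since each term of
`C Ω` is antilinear in the arguments of `T` and linear in the other two. -/
theorem val3_torsion (H : IsHermitianStructure J g)
    (hB : ∀ u v, B u (J v) = -J (B u v)) (hB' : ∀ u v, B (J u) v = -J (B u v))
    (hOm : ∀ u v w, val3 Om u v (J w) = Complex.I * val3 Om u v w)
    (hom : ∀ u v, om ![u, v] = fundForm J g u v)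
    (hC : contract B Om = (-2 * Complex.I * lam) • wedge om om) (a b x y : E) :
    val3 Om (torsion B a b) x y = -Complex.I * lam *
      (herm J g a x * herm J g b y - herm J g a y * herm J g b x) := by
  have hT : ∀ u v, torsion B (J u) v = -J (torsion B u v) := fun u v => by
    rw [torsion_apply, torsion_apply, hB, hB', map_sub]; abel
  have hT' : ∀ u v, torsion B u (J v) = -J (torsion B u v) := fun u v => by
    rw [torsion_apply, torsion_apply, hB, hB', map_sub]; abel
  have hOm2 : ∀ u v w, val3 Om u (J v) w = Complex.I * val3 Om u v w := fun u v w => by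
    rw [val3_swap_right, hOm, val3_swap_right]; ring
  have hOm1 : ∀ u v w, val3 Om (J u) v w = Complex.I * val3 Om u v w := fun u v w => by
    rw [val3_swap_left, hOm2, val3_swap_left]; ring
  have hn1 : ∀ u v w, val3 Om (-u) v w = -val3 Om u v w := fun u v w => by
    have := hOm1 (J u) v w
    rw [H.sq, hOm1] at this
    rw [this]; linear_combination (val3 Om u v w) * Complex.I_mul_I
  have hn2 : ∀ u v w, val3 Om u (-v) w = -val3 Om u v w := fun u v w => by
    have := hOm2 u (J v) w
    rw [H.sq, hOm2] at this
    rw [this]; linear_combination (val3 Om u v w) * Complex.I_mul_I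
  have hn3 : ∀ u v w, val3 Om u v (-w) = -val3 Om u v w := fun u v w => by
    have := hOm u v (J w)
    rw [H.sq, hOm] at this
    rw [this]; linear_combination (val3 Om u v w) * Complex.I_mul_I
  have key : ∀ a b, val3 Om (torsion B a b) x y + val3 Om b (torsion B a x) y +
      val3 Om b x (torsion B a y) - val3 Om a (torsion B b x) y - val3 Om a x (torsion B b y)
        + val3 Om a b (torsion B x y) = -4 * Complex.I * lam *
      ((g (J a) b : ℂ) * g (J x) y - g (J a) x * g (J b) y + g (J a) y * g (J b) x) := by
    intro a b
    rw [← contract_three_form_apply, hC, wedge_eq_lef om _ hom]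
    simp only [int_smul, ContinuousAlternatingMap.smul_apply, smul_eq_mul]
    rw [lef_two_form_apply H.fundForm_antisymm hom]
    change _ * (2 * ((g (J a) b : ℂ) * g (J x) y - g (J a) x * g (J b) y +
      g (J a) y * g (J b) x)) = _
    ring
  have k1 := key a b
  have k2 := key (J a) b
  have k3 := key a (J b)
  have k4 := key (J a) (J b)
  simp only [hT, hT', hOm, hOm1, hOm2, hn1, hn2, hn3, map_neg, H.sq, H.orth, neg_apply,
    H.J_right, Complex.ofReal_neg, neg_neg] at k1 k2 k3 k4
  simp only [herm_apply]
  -- The projection to the part that is antilinear in `a` and `b`.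
  linear_combination (norm := (ring_nf; simp only [Complex.I_sq, Complex.I_pow_three]; ring))
    (1 / 4 : ℂ) * (k1 + Complex.I * k2 + Complex.I * k3 - k4)

/-- The components of the torsion in a unitary frame: up to a factor, the complex conjugate of the
vector product. The indices are cyclic, modulo three. -/
theorem herm_torsion (F : IsUnitaryFrame J g e)
    (hB : ∀ u v, B u (J v) = -J (B u v)) (hB' : ∀ u v, B (J u) v = -J (B u v))
    (hOm : ∀ u v w, val3 Om u v (J w) = Complex.I * val3 Om u v w)
    (hom : ∀ u v, om ![u, v] = fundForm J g u v)
    (hC : contract B Om = (-2 * Complex.I * lam) • wedge om om) (u v : E) (a : Fin 3) :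
    val3 Om (e 0) (e 1) (e 2) * herm J g (e a) (torsion B u v) = -Complex.I * lam *
      (starRingEnd ℂ) (herm J g (e (a + 1)) u * herm J g (e (a + 2)) v -
        herm J g (e (a + 2)) u * herm J g (e (a + 1)) v) := by
  have h := val3_torsion F.toIsHermitianStructure hB hB' hOm hom hC u v (e (a + 1)) (e (a + 2))
  rw [val3_eq_det F hOm, F.herm_conj (e (a + 1)) u, F.herm_conj (e (a + 1)) v,
    F.herm_conj (e (a + 2)) u, F.herm_conj (e (a + 2)) v] at h
  simp only [F.herm_frame] at h
  rw [map_sub, map_mul, map_mul]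
  fin_cases a <;> simp at h ⊢ <;> linear_combination h

/-- `ω` is the imaginary part of the Hermitian form. -/
theorem fundForm_eq_herm_sub_conj (J : E →L[ℝ] E) (g : E →L[ℝ] E →L[ℝ] ℝ) (u v : E) :
    (fundForm J g u v : ℂ) =
      (2 * Complex.I)⁻¹ * (herm J g u v - (starRingEnd ℂ) (herm J g u v)) := by
  have h : ((fundForm J g u) v : ℂ) = (g (J u) v : ℂ) := rfl
  have hI := Complex.I_ne_zero
  rw [h, herm_apply, map_add, map_mul, Complex.conj_I, Complex.conj_ofReal, Complex.conj_ofReal]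
  field_simp
  ring

/-- The quadratic identity of the torsion of a nearly Kähler structure, which makes `C²` a
multiple of the Lefschetz operator composed with the weight operator. The two conjugations in the
iterated torsion cancel, and the phase of `Ω(e₀,e₁,e₂)` drops out. -/
theorem torsion_torsion (F : IsUnitaryFrame J g e)
    (hB : ∀ u v, B u (J v) = -J (B u v)) (hB' : ∀ u v, B (J u) v = -J (B u v))
    (hOm : ∀ u v w, val3 Om u v (J w) = Complex.I * val3 Om u v w)
    (hunit : ‖val3 Om (e 0) (e 1) (e 2)‖ = 1)
    (hom : ∀ u v, om ![u, v] = fundForm J g u v)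
    (hC : contract B Om = (-2 * Complex.I * lam) • wedge om om) (u v x : E) :
    torsion B v (torsion B u x) - torsion B u (torsion B v x) + torsion B (torsion B u v) x =
      (2 * lam ^ 2) • (fundForm J g u v • J x - fundForm J g u x • J v
        + fundForm J g v x • J u) := by
  have hT := fun a b c => herm_torsion F hB hB' hOm hom hC a b c
  set ε := val3 Om (e 0) (e 1) (e 2) with hε
  have h1 : ε * (starRingEnd ℂ) ε = 1 := by
    rw [Complex.mul_conj, Complex.normSq_eq_norm_sq, hunit]; norm_num
  have hw := fun a b => fundForm_eq_herm_sub_conj J g a b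
  have hconj : ∀ a b c, (starRingEnd ℂ) ε * (starRingEnd ℂ) (herm J g (e c) (torsion B a b)) =
      Complex.I * lam * (herm J g (e (c + 1)) a * herm J g (e (c + 2)) b -
        herm J g (e (c + 2)) a * herm J g (e (c + 1)) b) := fun a b c => by
    rw [← map_mul, hT]
    simp
  have hI : (2 * Complex.I)⁻¹ = -Complex.I / 2 := by
    rw [mul_inv, Complex.inv_I]; ring
  refine F.eq_of_herm_eq fun a => ?_
  -- The factor `ε` turns the outer torsion into coordinates, the factor `ε̄` the inner one.
  have key : ∀ z : ℂ, z = (starRingEnd ℂ) ε * (ε * z) := fun z => by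
    linear_combination (-z) * h1
  simp only [map_add, map_sub, map_smul, F.herm_J, Complex.real_smul, hw, hI]
  rw [key (herm J g (e a) (torsion B v (torsion B u x))),
    key (herm J g (e a) (torsion B u (torsion B v x))),
    key (herm J g (e a) (torsion B (torsion B u v) x)), hT, hT, hT]
  -- The coordinates of the inner torsions, with indices reduced modulo three.
  have e1 : a + 1 + 1 = a + 2 := by rw [add_assoc]; rfl
  have e2 : a + 1 + 2 = a := by rw [add_assoc]; exact add_zero a
  have e3 : a + 2 + 1 = a := by rw [add_assoc]; exact add_zero a
  have e4 : a + 2 + 2 = a + 1 := by rw [add_assoc]; rfl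
  have c1 := fun x y => hconj x y (a + 1)
  have c2 := fun x y => hconj x y (a + 2)
  rw [e1, e2] at c1
  rw [e3, e4] at c2
  have hsum : ∀ x y, herm J g x y =
      (starRingEnd ℂ) (herm J g (e a) x) * herm J g (e a) y +
      (starRingEnd ℂ) (herm J g (e (a + 1)) x) * herm J g (e (a + 1)) y +
      (starRingEnd ℂ) (herm J g (e (a + 2)) x) * herm J g (e (a + 2)) y := fun x y => by
    rw [F.herm_eq_sum, Fin.sum_univ_three]
    fin_cases a <;> simp <;> ring
  simp only [hsum u v, hsum u x, hsum v x, map_sub, map_mul, map_add, Complex.conj_conj]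
  push_cast
  linear_combination (-Complex.I * lam) * ((starRingEnd ℂ) (herm J g (e (a + 1)) v) * c2 u x
      - (starRingEnd ℂ) (herm J g (e (a + 2)) v) * c1 u x
      - (starRingEnd ℂ) (herm J g (e (a + 1)) u) * c2 v x
      + (starRingEnd ℂ) (herm J g (e (a + 2)) u) * c1 v x
      + (starRingEnd ℂ) (herm J g (e (a + 2)) x) * c1 u v
      - (starRingEnd ℂ) (herm J g (e (a + 1)) x) * c2 u v)

/-- On a Hermitian vector space of complex dimension three with a unit `(3,0)`-form `Om`: if the
derivation `C` attached to a family `B` satisfies `C Om = -2 √-1 λ ω ∧ ω`, then `C²` is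
`2 λ²` times exterior multiplication by `ω` composed with the weight operator. -/
theorem contract_contract_of_contract_three_form (H : IsHermitianStructure J g)
    (hE : Module.finrank ℝ E = 6)
    (hB : ∀ u v, B u (J v) = -J (B u v)) (hB' : ∀ u v, B (J u) v = -J (B u v))
    (hOm : ∀ u v w, val3 Om u v (J w) = Complex.I * val3 Om u v w)
    (hunit : ∀ e : Fin 3 → E, (∀ a b, g (e a) (e b) = if a = b then 1 else 0) →
      (∀ a b, g (e a) (J (e b)) = 0) → ‖Om e‖ = 1)
    (hom : ∀ u v, om ![u, v] = fundForm J g u v)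
    (hC : contract B Om = (-2 * Complex.I * lam) • wedge om om)
    {k : ℕ} (η : E [⋀^Fin k]→L[ℝ] ℂ) :
    contract B (contract B η) = (2 * lam ^ 2) • lef (fundForm J g) (derAct J η) := by
  obtain ⟨e, he, heJ⟩ := H.exists_unitary_frame hE
  have F : IsUnitaryFrame J g e := ⟨H, hE, he, heJ⟩
  refine contract_contract B J _ H.fundForm_antisymm _ _ (torsion_apply B)
    (torsion_torsion F hB hB' hOm ?_ hom hC) η
  rw [← hunit e he heJ]
  congr 1
  change Om _ = Om e
  congr 1
  funext i
  fin_cases i <;> rfl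

end Torsion

end HermitianAlgebra

/-! ### Nearly Kähler structures on an open set -/

section LocalNearlyKahler

open ContinuousAlternatingMap hiding add_apply sub_apply neg_apply smul_apply

variable {E : Type*} [NormedAddCommGroup E] [NormedSpace ℝ E] {k : ℕ}

/-- The real part of a complex-valued form, as a complex-valued form. -/
def reForm (η : E [⋀^Fin k]→L[ℝ] ℂ) : E [⋀^Fin k]→L[ℝ] ℂ :=
  (Complex.ofRealCLM.comp Complex.reCLM).compContinuousAlternatingMap η

/-- The imaginary part of a complex-valued form, as a complex-valued form. -/
def imForm (η : E [⋀^Fin k]→L[ℝ] ℂ) : E [⋀^Fin k]→L[ℝ] ℂ :=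
  (Complex.ofRealCLM.comp Complex.imCLM).compContinuousAlternatingMap η

theorem reForm_add_imForm (η : E [⋀^Fin k]→L[ℝ] ℂ) : reForm η + Complex.I • imForm η = η := by
  ext v
  change ((η v).re : ℂ) + Complex.I * ((η v).im : ℂ) = η v
  rw [mul_comm, Complex.re_add_im]

theorem contDiffOn_reForm {η : E → E [⋀^Fin k]→L[ℝ] ℂ} {U : Set E} {n : WithTop ℕ∞}
    (hη : ContDiffOn ℝ n η U) : ContDiffOn ℝ n (fun y => reForm (η y)) U :=
  (ContinuousLinearMap.compContinuousAlternatingMapCLM ℝ E ℂ ℂ (Fin k)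
    (Complex.ofRealCLM.comp Complex.reCLM)).contDiff.comp_contDiffOn hη

theorem contDiffOn_imForm {η : E → E [⋀^Fin k]→L[ℝ] ℂ} {U : Set E} {n : WithTop ℕ∞}
    (hη : ContDiffOn ℝ n η U) : ContDiffOn ℝ n (fun y => imForm (η y)) U :=
  (ContinuousLinearMap.compContinuousAlternatingMapCLM ℝ E ℂ ℂ (Fin k)
    (Complex.ofRealCLM.comp Complex.imCLM)).contDiff.comp_contDiffOn hη

theorem extDeriv_complex_smul (c : ℂ) (η : E → E [⋀^Fin k]→L[ℝ] ℂ) {y : E}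
    (hη : DifferentiableAt ℝ η y) :
    extDeriv (fun z => c • η z) y = c • extDeriv η y := by
  rw [extDeriv, fderiv_fun_const_smul hη]
  exact alternatizeUncurryFin_smul ..

/-- A nearly Kähler `SU(3)`-structure on an open set `U` of a six-dimensional vector space. The
metric `g` is only used pointwise, so that its smoothness is not recorded. -/
structure IsNearlyKahlerOn (J : E → E →L[ℝ] E) (g : E → E →L[ℝ] E →L[ℝ] ℝ)
    (om : E → E [⋀^Fin 2]→L[ℝ] ℂ) (Om : E → E [⋀^Fin 3]→L[ℝ] ℂ) (lam : ℝ) (U : Set E) : Prop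
    extends IsAlmostComplexOn J U where
  finrank : Module.finrank ℝ E = 6
  hermitian : ∀ y ∈ U, IsHermitianStructure (J y) (g y)
  omega_smooth : ContDiffOn ℝ ∞ om U
  omega_apply : ∀ y ∈ U, ∀ u v, om y ![u, v] = fundForm (J y) (g y) u v
  Omega_smooth : ContDiffOn ℝ ∞ Om U
  Omega_type : ∀ y ∈ U, typeProj (J y) 3 0 (Om y) = Om y
  Omega_unit : ∀ y ∈ U, ∀ e : Fin 3 → E,
    (∀ a b, g y (e a) (e b) = if a = b then 1 else 0) →
    (∀ a b, g y (e a) (J y (e b)) = 0) → ‖Om y e‖ = 1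
  ne_zero : lam ≠ 0
  d_omega : ∀ y ∈ U, extDeriv om y = (3 * lam : ℂ) • reForm (Om y)
  d_im : ∀ y ∈ U, extDeriv (fun z => imForm (Om z)) y = (-2 * lam : ℂ) • wedge (om y) (om y)

/-- A form of type `(3,0)` is complex linear. -/
theorem val3_J_of_type {J : E →L[ℝ] E} (hJ : ∀ v, J (J v) = -v) {Om : E [⋀^Fin 3]→L[ℝ] ℂ}
    (h : typeProj J 3 0 Om = Om) (u v w : E) :
    val3 Om u v (J w) = Complex.I * val3 Om u v w := by
  have hS : (Finset.univ.filter fun S : Finset (Fin 3) => (#S : ℤ) = 3 ∧ (#Sᶜ : ℤ) = 0) =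
      {Finset.univ} := by
    ext S
    simp only [Finset.mem_filter, Finset.mem_univ, true_and, Finset.mem_singleton]
    constructor
    · rintro ⟨-, h2⟩
      have : Sᶜ = ∅ := Finset.card_eq_zero.1 (by exact_mod_cast h2)
      simpa using this
    · rintro rfl
      simp
  have hval : ∀ x : Fin 3 → E, Om x = slotProj J Finset.univ Om x := fun x => by
    conv_lhs => rw [← h]
    rw [typeProj_apply, hS, Finset.sum_singleton]
  have h1 := slotProj_update J hJ Finset.univ Om ![u, v, w] 2
  rw [← hval, ← hval, if_pos (Finset.mem_univ _)] at h1
  have h2 : Function.update ![u, v, w] 2 (J (![u, v, w] 2)) = ![u, v, J w] := by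
    funext i; fin_cases i <;> rfl
  rw [h2] at h1
  exact h1

/-- The fundamental form has type `(1,1)`, i.e. weight zero. -/
theorem derAct_fundForm {J : E →L[ℝ] E} {g : E →L[ℝ] E →L[ℝ] ℝ} (H : IsHermitianStructure J g)
    {om : E [⋀^Fin 2]→L[ℝ] ℂ} (hom : ∀ u v, om ![u, v] = fundForm J g u v) :
    derAct J om = 0 := by
  ext x
  have hx : x = ![x 0, x 1] := by funext i; fin_cases i <;> rfl
  have h0 : Function.update x 0 (J (x 0)) = ![J (x 0), x 1] := by
    funext i; fin_cases i <;> rfl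
  have h1 : Function.update x 1 (J (x 1)) = ![x 0, J (x 1)] := by
    funext i; fin_cases i <;> rfl
  rw [derAct_apply, Fin.sum_univ_two, h0, h1, hom, hom, H.fundForm_J]
  push_cast
  exact neg_add_cancel _

/-- Exterior multiplication by the fundamental form raises the type by `(1,1)`. -/
theorem typeProj_lef {J : E →L[ℝ] E} {g : E →L[ℝ] E →L[ℝ] ℝ} (H : IsHermitianStructure J g)
    {p q : ℤ} (hpq : p + q = k) {η : E [⋀^Fin k]→L[ℝ] ℂ} (ht : typeProj J p q η = η) :
    typeProj J (p + 1) (q + 1) (lef (fundForm J g) η) = lef (fundForm J g) η := by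
  have hw : HasWeight J (p - q) η := by rw [← ht]; exact hasWeight_typeProj J H.sq p q η
  have hw' : HasWeight J (p - q) (lef (fundForm J g) η) := by
    rw [HasWeight, derAct_lef J _ H.fundForm_J, hw, lef_smul]
  exact hw'.typeProj_eq_self H.sq (by ring) (by push_cast; linarith)

namespace IsNearlyKahlerOn

variable {J : E → E →L[ℝ] E} {g : E → E →L[ℝ] E →L[ℝ] ℝ}
  {om : E → E [⋀^Fin 2]→L[ℝ] ℂ} {Om : E → E [⋀^Fin 3]→L[ℝ] ℂ} {lam : ℝ} {U : Set E}

theorem typeProj_wedge (h : IsNearlyKahlerOn J g om Om lam U) {y : E} (hy : y ∈ U)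
    {p q : ℤ} (hpq : p + q = k) {η : E [⋀^Fin k]→L[ℝ] ℂ} (ht : typeProj (J y) p q η = η) :
    typeProj (J y) (p + 1) (q + 1) (wedge η (om y)) = wedge η (om y) := by
  rw [wedge_eq_lef (om y) _ (h.omega_apply y hy)]
  exact typeProj_lef (h.hermitian y hy) hpq ht

theorem extDeriv_Omega (h : IsNearlyKahlerOn J g om Om lam U) {y : E} (hy : y ∈ U) :
    extDeriv Om y = (-2 * Complex.I * lam) • wedge (om y) (om y) := by
  have hnear := h.isOpen.mem_nhds hy
  have hre : DifferentiableAt ℝ (fun z => reForm (Om z)) y :=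
    differentiableAt_of_contDiffOn (contDiffOn_reForm h.Omega_smooth) h.isOpen hy
  have him : DifferentiableAt ℝ (fun z => imForm (Om z)) y :=
    differentiableAt_of_contDiffOn (contDiffOn_imForm h.Omega_smooth) h.isOpen hy
  -- `Re Ω` is closed, because `3 λ Re Ω` is exact and `λ ≠ 0`.
  have hdd : extDeriv (extDeriv om) y = 0 :=
    extDeriv_extDeriv_apply (h.omega_smooth.contDiffAt hnear)
      (by rw [minSmoothness_of_isRCLikeNormedField]
          exact WithTop.coe_le_coe.2 (le_top (a := (2 : ℕ∞))))
  have hev : extDeriv om =ᶠ[nhds y] fun z => (3 * lam : ℂ) • reForm (Om z) :=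
    Filter.mem_of_superset hnear h.d_omega
  rw [hev.extDeriv_eq, extDeriv_complex_smul _ _ hre] at hdd
  have hdre : extDeriv (fun z => reForm (Om z)) y = 0 :=
    (eq_zero_or_of_smul_eq_zero hdd).resolve_left
      (mul_ne_zero three_ne_zero (Complex.ofReal_ne_zero.2 h.ne_zero))
  have hOm : Om = fun z => reForm (Om z) + Complex.I • imForm (Om z) :=
    funext fun z => (reForm_add_imForm (Om z)).symm
  have hIm : DifferentiableAt ℝ (fun z => Complex.I • imForm (Om z)) y := him.const_smul Complex.I
  rw [hOm, extDeriv_fun_add hre hIm, hdre, extDeriv_complex_smul _ _ him, h.d_im y hy]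
  module

variable [FiniteDimensional ℝ E]

/-- The components of `dΩ` of type `(5,-1)` and `(2,2)` make up `C Ω`; the first one vanishes, and
`dΩ` has type `(2,2)`. -/
theorem contract_Omega (h : IsNearlyKahlerOn J g om Om lam U) {y : E} (hy : y ∈ U) :
    contract (connMinus (J y) (fderiv ℝ J y)) (Om y) =
      (-2 * Complex.I * lam) • wedge (om y) (om y) := by
  have hH := h.hermitian y hy
  rw [← locComp_add_locComp h.toIsAlmostComplexOn h.Omega_smooth hy,
    locComp_of_type h.toIsAlmostComplexOn h.Omega_type 2 (-1) hy,
    locComp_of_type h.toIsAlmostComplexOn h.Omega_type (-1) 2 hy,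
    typeProj_of_neg (J y) (Or.inr (by norm_num)), zero_add, h.extDeriv_Omega hy, typeProj_smul,
    wedge_eq_lef (om y) _ (h.omega_apply y hy)]
  congr 1
  have hw : HasWeight (J y) 0 (lef (fundForm (J y) (g y)) (om y)) := by
    rw [HasWeight, derAct_lef (J y) _ hH.fundForm_J, derAct_fundForm hH (h.omega_apply y hy)]
    have h0 : ∀ {l : ℕ} (θ : E [⋀^Fin l]→L[ℝ] ℂ), (0 : ℂ) • θ = 0 := fun θ => by module
    have h1 := lef_smul (fundForm (J y) (g y)) 0 (om y)
    rw [h0, h0] at h1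
    rw [h1, Int.cast_zero, mul_zero, h0]
  exact hw.typeProj_eq_self hH.sq (by norm_num) (by norm_num)

/-- `C² η = 2 √-1 λ² (p - q) η ∧ ω` at a point, on forms of type `(p,q)`. -/
theorem contract_contract (h : IsNearlyKahlerOn J g om Om lam U) {y : E} (hy : y ∈ U)
    {p q : ℤ} {η : E [⋀^Fin k]→L[ℝ] ℂ} (ht : typeProj (J y) p q η = η) :
    contract (connMinus (J y) (fderiv ℝ J y)) (contract (connMinus (J y) (fderiv ℝ J y)) η) =
      (2 * Complex.I * (lam : ℂ) ^ 2 * ((p : ℂ) - q)) • wedge η (om y) := by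
  have hH := h.hermitian y hy
  have hD := fun u v => fderiv_almostComplex_of_mem h.toIsAlmostComplexOn hy u v
  rw [contract_contract_of_contract_three_form hH h.finrank (connMinus_J hD)
    (connMinus_J_left hH.sq) (val3_J_of_type hH.sq (h.Omega_type y hy)) (h.Omega_unit y hy)
    (h.omega_apply y hy) (h.contract_Omega hy), wedge_eq_lef (om y) _ (h.omega_apply y hy)]
  conv_lhs => rw [← ht, derAct_typeProj (J y) hH.sq, lef_smul, ht]
  ext v
  simp only [ContinuousAlternatingMap.smul_apply, Complex.real_smul, smul_eq_mul]
  push_cast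
  ring

/-- `(N + N̄)² η` in terms of the Hodge components of the exterior derivative. -/
theorem locC_locC (h : IsNearlyKahlerOn J g om Om lam U) {y : E} (hy : y ∈ U)
    {p q : ℤ} {η : E → E [⋀^Fin k]→L[ℝ] ℂ} (hη : ContDiffOn ℝ ∞ η U)
    (ht : ∀ z ∈ U, typeProj (J z) p q (η z) = η z) :
    (locComp J 2 (-1) (fun z => locComp J 2 (-1) η z + locComp J (-1) 2 η z) y +
      locComp J (-1) 2 (fun z => locComp J 2 (-1) η z + locComp J (-1) 2 η z) y) =
      (2 * Complex.I * (lam : ℂ) ^ 2 * ((p : ℂ) - q)) • wedge (η y) (om y) := by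
  rw [locComp_add_locComp h.toIsAlmostComplexOn
    ((contDiffOn_locComp h.toIsAlmostComplexOn hη _ _).add
      (contDiffOn_locComp h.toIsAlmostComplexOn hη _ _)) hy,
    locComp_add_locComp h.toIsAlmostComplexOn hη hy, h.contract_contract hy (ht y hy)]

/-- `-(∂∂̄ + ∂̄∂) η` on forms of type `(p,q)`. -/
theorem locC_locC_eq (h : IsNearlyKahlerOn J g om Om lam U) {y : E} (hy : y ∈ U)
    {p q : ℤ} (hpq : p + q = k) {η : E → E [⋀^Fin k]→L[ℝ] ℂ} (hη : ContDiffOn ℝ ∞ η U)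
    (ht : ∀ z ∈ U, typeProj (J z) p q (η z) = η z) :
    -(locComp J 1 0 (locComp J 0 1 η) y + locComp J 0 1 (locComp J 1 0 η) y) =
      (2 * Complex.I * (lam : ℂ) ^ 2 * ((p : ℂ) - q)) • wedge (η y) (om y) := by
  have hC := h.contract_contract hy (ht y hy)
  rw [← locC_locC_eq_neg h.toIsAlmostComplexOn hη ht hy, hC]
  rw [hC, typeProj_smul, h.typeProj_wedge hy hpq (ht y hy)]

end IsNearlyKahlerOn

end LocalNearlyKahler

/-! ### Forms in charts -/

section Naturality

variable {V W : Type*} [AddCommGroup V] [Module ℝ V] [TopologicalSpace V]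
  [AddCommGroup W] [Module ℝ W] [TopologicalSpace W] {k l : ℕ}

/-- The Hodge projections are natural for complex linear maps. -/
theorem typeProj_compContinuousLinearMap (A : V →L[ℝ] W) {J' : V →L[ℝ] V} {J : W →L[ℝ] W}
    (h : ∀ v, A (J' v) = J (A v)) (p q : ℤ) (η : W [⋀^Fin k]→L[ℝ] ℂ) :
    (typeProj J p q η).compContinuousLinearMap A =
      typeProj J' p q (η.compContinuousLinearMap A) := by
  ext v
  change (∑ S : Finset (Fin k) with (#S : ℤ) = p ∧ (#Sᶜ : ℤ) = q, slotProj J S η) (A ∘ v) =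
    (∑ S : Finset (Fin k) with (#S : ℤ) = p ∧ (#Sᶜ : ℤ) = q,
      slotProj J' S (η.compContinuousLinearMap A)) v
  rw [_root_.sum_apply, _root_.sum_apply]
  refine Finset.sum_congr rfl fun S _ => ?_
  rw [slotProj_apply, slotProj_apply]
  congr 1
  refine Finset.sum_congr rfl fun T _ => ?_
  congr 1
  change η _ = η _
  congr 1
  funext j
  simp only [Function.comp]
  split_ifs
  · exact (h _).symm
  · rfl

theorem wedge_apply (α : V [⋀^Fin k]→L[ℝ] ℂ) (β : V [⋀^Fin l]→L[ℝ] ℂ) (v : Fin (k + l) → V) :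
    wedge α β v = (k.factorial * l.factorial : ℂ)⁻¹ *
      ∑ σ : Equiv.Perm (Fin (k + l)), Equiv.Perm.sign σ • tensorMul α β (v ∘ σ) := by
  rw [wedge, ContinuousAlternatingMap.smul_apply, smul_eq_mul,
    ContinuousMultilinearMap.alternatization_apply_apply]

theorem wedge_add_left (α α' : V [⋀^Fin k]→L[ℝ] ℂ) (β : V [⋀^Fin l]→L[ℝ] ℂ) :
    wedge (α + α') β = wedge α β + wedge α' β := by
  ext v
  rw [ContinuousAlternatingMap.add_apply, wedge_apply, wedge_apply, wedge_apply, ← mul_add,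
    ← Finset.sum_add_distrib]
  congr 1
  refine Finset.sum_congr rfl fun σ _ => ?_
  rw [tensorMul_apply, tensorMul_apply, tensorMul_apply, ContinuousAlternatingMap.add_apply,
    add_mul, smul_add]

theorem wedge_smul_left (c : ℂ) (α : V [⋀^Fin k]→L[ℝ] ℂ) (β : V [⋀^Fin l]→L[ℝ] ℂ) :
    wedge (c • α) β = c • wedge α β := by
  ext v
  have h : ∀ σ : Equiv.Perm (Fin (k + l)), Equiv.Perm.sign σ • tensorMul (c • α) β (v ∘ σ) =
      c * Equiv.Perm.sign σ • tensorMul α β (v ∘ σ) := fun σ => by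
    rw [tensorMul_apply, tensorMul_apply, ContinuousAlternatingMap.smul_apply, smul_eq_mul,
      mul_assoc, Units.smul_def, Units.smul_def, mul_smul_comm]
  rw [ContinuousAlternatingMap.smul_apply, smul_eq_mul, wedge_apply, wedge_apply,
    Finset.sum_congr rfl fun σ _ => h σ, ← Finset.mul_sum, mul_left_comm]

/-- Naturality of the exterior product. -/
theorem wedge_compContinuousLinearMap (A : V →L[ℝ] W) (α : W [⋀^Fin k]→L[ℝ] ℂ)
    (β : W [⋀^Fin l]→L[ℝ] ℂ) : (wedge α β).compContinuousLinearMap A =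
      wedge (α.compContinuousLinearMap A) (β.compContinuousLinearMap A) := by
  ext v
  change wedge α β (A ∘ v) = _
  rw [wedge_apply, wedge_apply]
  rfl

end Naturality

section Charts

variable {M : Type*} [TopologicalSpace M] [ChartedSpace E6 M] {k l : ℕ}

/-- The derivative of the inverse of the preferred chart at `x₀`, as an endomorphism of the model
space, of which every tangent space is a copy. -/
def chartInvDeriv (x₀ : M) (y : E6) : E6 →L[ℝ] E6 :=
  mfderiv (𝓡 6) (𝓡 6) (chartAt E6 x₀).symm y

/-- The derivative of the preferred chart at `x₀`, as an endomorphism of the model space. -/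
def chartDeriv (x₀ x : M) : E6 →L[ℝ] E6 := mfderiv (𝓡 6) (𝓡 6) (chartAt E6 x₀) x

/-- The value of a form at a point, as a form on the model space. -/
def formAt (η : Form M k) (x : M) : E6 [⋀^Fin k]→L[ℝ] ℂ := η x

theorem localRep_eq (η : Form M k) (x₀ : M) (y : E6) : localRep η x₀ y =
    (formAt η ((chartAt E6 x₀).symm y)).compContinuousLinearMap (chartInvDeriv x₀ y) := rfl

section Derivatives

variable [IsManifold (𝓡 6) ∞ M]

theorem chartDeriv_comp_chartInvDeriv {x₀ : M} {y : E6} (hy : y ∈ (chartAt E6 x₀).target) :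
    chartDeriv x₀ ((chartAt E6 x₀).symm y) ∘L chartInvDeriv x₀ y = .id ℝ E6 := by
  have : IsManifold (𝓡 6) 1 M := .of_le (n := ∞) (by norm_num)
  exact (mdifferentiable_chart x₀).comp_symm_deriv hy

theorem chartInvDeriv_comp_chartDeriv {x₀ : M} {y : E6} (hy : y ∈ (chartAt E6 x₀).target) :
    chartInvDeriv x₀ y ∘L chartDeriv x₀ ((chartAt E6 x₀).symm y) = .id ℝ E6 := by
  have : IsManifold (𝓡 6) 1 M := .of_le (n := ∞) (by norm_num)
  have h := (mdifferentiable_chart (I := 𝓡 6) x₀).symm_comp_deriv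
    ((chartAt E6 x₀).map_target hy)
  rw [(chartAt E6 x₀).right_inv hy] at h
  exact h

theorem chartDeriv_chartInvDeriv {x₀ : M} {y : E6} (hy : y ∈ (chartAt E6 x₀).target) (v : E6) :
    chartDeriv x₀ ((chartAt E6 x₀).symm y) (chartInvDeriv x₀ y v) = v :=
  congrArg (fun A : E6 →L[ℝ] E6 => A v) (chartDeriv_comp_chartInvDeriv hy)

theorem chartInvDeriv_chartDeriv {x₀ : M} {y : E6} (hy : y ∈ (chartAt E6 x₀).target) (v : E6) :
    chartInvDeriv x₀ y (chartDeriv x₀ ((chartAt E6 x₀).symm y) v) = v :=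
  congrArg (fun A : E6 →L[ℝ] E6 => A v) (chartInvDeriv_comp_chartDeriv hy)

end Derivatives

theorem localRep_apply (η : Form M k) (x₀ : M) (y : E6) (v : Fin k → E6) :
    localRep η x₀ y v = η ((chartAt E6 x₀).symm y) (fun i => chartInvDeriv x₀ y (v i)) := rfl

theorem localRep_add (η θ : Form M k) (x₀ : M) (y : E6) :
    localRep (η + θ) x₀ y = localRep η x₀ y + localRep θ x₀ y := rfl

theorem localRep_neg (η : Form M k) (x₀ : M) (y : E6) :
    localRep (-η) x₀ y = -localRep η x₀ y := rfl

theorem localRep_smul (c : ℂ) (η : Form M k) (x₀ : M) (y : E6) :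
    localRep (c • η) x₀ y = c • localRep η x₀ y := rfl

theorem localRep_sum {ι : Type*} (s : Finset ι) (η : ι → Form M k) (x₀ : M) (y : E6) :
    localRep (∑ i ∈ s, η i) x₀ y = ∑ i ∈ s, localRep (η i) x₀ y :=
  map_sum (AddMonoidHom.mk' (fun η : Form M k => localRep η x₀ y)
    fun η θ => localRep_add η θ x₀ y) η s

theorem localRep_funMul (f : M → ℂ) (η : Form M k) (x₀ : M) (y : E6) :
    localRep (Form.funMul f η) x₀ y = f ((chartAt E6 x₀).symm y) • localRep η x₀ y := rfl

theorem localRep_rePart (η : Form M k) (x₀ : M) (y : E6) :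
    localRep η.rePart x₀ y = reForm (localRep η x₀ y) := rfl

theorem localRep_wedge (η : Form M k) (θ : Form M l) (x₀ : M) (y : E6) :
    localRep (Form.wedge η θ) x₀ y = wedge (localRep η x₀ y) (localRep θ x₀ y) :=
  wedge_compContinuousLinearMap _ _ _

theorem IsSmooth.wedge {η : Form M k} {θ : Form M l} (hη : IsSmooth η) (hθ : IsSmooth θ) :
    IsSmooth (Form.wedge η θ) := fun x₀ =>
  (contDiffOn_wedge (hη x₀) (hθ x₀)).congr fun y _ => localRep_wedge η θ x₀ y

theorem IsSmooth.add {η θ : Form M k} (hη : IsSmooth η) (hθ : IsSmooth θ) :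
    IsSmooth (η + θ) := fun x₀ => (hη x₀).add (hθ x₀)

theorem IsSmooth.const_smul (c : ℂ) {η : Form M k} (hη : IsSmooth η) :
    IsSmooth (c • η) := fun x₀ => (hη x₀).const_smul c

theorem Form.wedge_add_left {l : ℕ} (η θ : Form M k) (β : Form M l) :
    Form.wedge (η + θ) β = Form.wedge η β + Form.wedge θ β :=
  funext fun x => NK.wedge_add_left (η x) (θ x) (β x)

theorem Form.wedge_funMul_left {l : ℕ} (f : M → ℂ) (η : Form M k) (β : Form M l) :
    Form.wedge (Form.funMul f η) β = Form.funMul f (Form.wedge η β) :=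
  funext fun x => NK.wedge_smul_left (f x) (η x) (β x)

theorem Form.smul_funMul (c : ℂ) (f : M → ℂ) (η : Form M k) :
    c • Form.funMul f η = Form.funMul f (c • η) :=
  funext fun x => smul_comm c (f x) (η x)

variable [IsManifold (𝓡 6) ∞ M]

/-- Forms are determined by their coordinate expressions. -/
theorem form_ext {η θ : Form M k} (h : ∀ x₀ : M, ∀ y ∈ (chartAt E6 x₀).target,
    localRep η x₀ y = localRep θ x₀ y) : η = θ := by
  funext x
  have hx := (chartAt E6 x).map_source (mem_chart_source E6 x)
  have h1 : formAt η ((chartAt E6 x).symm (chartAt E6 x x)) =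
      formAt θ ((chartAt E6 x).symm (chartAt E6 x x)) := by
    ext v
    have h2 := congrArg (fun β : E6 [⋀^Fin k]→L[ℝ] ℂ => β fun i =>
      chartDeriv x ((chartAt E6 x).symm (chartAt E6 x x)) (v i)) (h x _ hx)
    simp only [localRep_eq, ContinuousAlternatingMap.compContinuousLinearMap_apply,
      Function.comp_def, chartInvDeriv_chartDeriv hx] at h2
    exact h2
  rw [(chartAt E6 x).left_inv (mem_chart_source E6 x)] at h1
  exact h1

theorem contMDiffAt_chart_symm {x₀ : M} {y : E6} (hy : y ∈ (chartAt E6 x₀).target) :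
    ContMDiffAt (𝓡 6) (𝓡 6) ∞ (chartAt E6 x₀).symm y :=
  (contMDiffOn_chart_symm (I := 𝓡 6)).contMDiffAt ((chartAt E6 x₀).open_target.mem_nhds hy)

theorem contMDiffAt_chart {x₀ x : M} (hx : x ∈ (chartAt E6 x₀).source) :
    ContMDiffAt (𝓡 6) (𝓡 6) ∞ (chartAt E6 x₀) x :=
  (contMDiffOn_chart (I := 𝓡 6)).contMDiffAt ((chartAt E6 x₀).open_source.mem_nhds hx)

/-- The transition map between two preferred charts. -/
def chartTransition (x₀ x₁ : M) : E6 → E6 := chartAt E6 x₁ ∘ (chartAt E6 x₀).symm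

theorem contDiffAt_chartTransition {x₀ x₁ : M} {y : E6} (hy : y ∈ (chartAt E6 x₀).target)
    (hy' : (chartAt E6 x₀).symm y ∈ (chartAt E6 x₁).source) :
    ContDiffAt ℝ ∞ (chartTransition x₀ x₁) y :=
  contMDiffAt_iff_contDiffAt.1 ((contMDiffAt_chart hy').comp y (contMDiffAt_chart_symm hy))

theorem fderiv_chartTransition {x₀ x₁ : M} {y : E6} (hy : y ∈ (chartAt E6 x₀).target)
    (hy' : (chartAt E6 x₀).symm y ∈ (chartAt E6 x₁).source) :
    fderiv ℝ (chartTransition x₀ x₁) y =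
      chartDeriv x₁ ((chartAt E6 x₀).symm y) ∘L chartInvDeriv x₀ y := by
  rw [← mfderiv_eq_fderiv]
  exact mfderiv_comp y ((contMDiffAt_chart hy').mdifferentiableAt (by norm_num))
    ((contMDiffAt_chart_symm hy).mdifferentiableAt (by norm_num))

/-- The coordinate expressions of a form in two charts differ by the pullback by the transition
map. -/
theorem localRep_eq_pullback (η : Form M k) {x₀ x₁ : M} {y : E6}
    (hy : y ∈ (chartAt E6 x₀).target) (hy' : (chartAt E6 x₀).symm y ∈ (chartAt E6 x₁).source) :
    localRep η x₀ y = (localRep η x₁ (chartTransition x₀ x₁ y)).compContinuousLinearMap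
      (fderiv ℝ (chartTransition x₀ x₁) y) := by
  -- The inverse chart at `x₀` is the inverse chart at `x₁` after the transition map.
  have hinv : (chartAt E6 x₁).symm (chartTransition x₀ x₁ y) = (chartAt E6 x₀).symm y :=
    (chartAt E6 x₁).left_inv hy'
  have hmem : chartTransition x₀ x₁ y ∈ (chartAt E6 x₁).target := (chartAt E6 x₁).map_source hy'
  have hA := chartInvDeriv_comp_chartDeriv hmem
  rw [hinv] at hA
  have hD : chartInvDeriv x₁ (chartTransition x₀ x₁ y) ∘L fderiv ℝ (chartTransition x₀ x₁) y =
      chartInvDeriv x₀ y := by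
    rw [fderiv_chartTransition hy hy', ← ContinuousLinearMap.comp_assoc, hA,
      ContinuousLinearMap.id_comp]
  rw [localRep_eq, localRep_eq, hinv, ← hD]
  rfl

/-- The de Rham differential is computed by the exterior derivative in every preferred chart. -/
theorem localRep_deRham {η : Form M k} (hη : IsSmooth η) {x₀ : M} {y : E6}
    (hy : y ∈ (chartAt E6 x₀).target) :
    localRep (deRham η) x₀ y = extDeriv (localRep η x₀) y := by
  set x := (chartAt E6 x₀).symm y with hx
  have hxs : x ∈ (chartAt E6 x).source := mem_chart_source E6 x
  set f := chartTransition x₀ x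
  have hfy : f y = chartAt E6 x x := rfl
  have hnear : ∀ᶠ z in nhds y, localRep η x₀ z =
      (localRep η x (f z)).compContinuousLinearMap (fderiv ℝ f z) := by
    have h1 : ∀ᶠ z in nhds y, z ∈ (chartAt E6 x₀).target :=
      (chartAt E6 x₀).open_target.mem_nhds hy
    have h2 : ∀ᶠ z in nhds y, (chartAt E6 x₀).symm z ∈ (chartAt E6 x).source :=
      ((chartAt E6 x₀).continuousAt_symm hy).eventually_mem
        ((chartAt E6 x).open_source.mem_nhds hxs)
    filter_upwards [h1, h2] with z hz hz'
    exact localRep_eq_pullback η hz hz'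
  have hdiff : DifferentiableAt ℝ (localRep η x) (f y) :=
    differentiableAt_of_contDiffOn (hη x) (chartAt E6 x).open_target
      ((chartAt E6 x).map_source hxs)
  rw [Filter.EventuallyEq.extDeriv_eq hnear,
    extDeriv_pullback hdiff (contDiffAt_chartTransition hy hxs)
      (by rw [minSmoothness_of_isRCLikeNormedField]
          exact WithTop.coe_le_coe.2 (le_top (a := (2 : ℕ∞)))),
    fderiv_chartTransition hy hxs]
  rfl

end Charts

/-! ### Nearly Kähler structures on manifolds -/

section AlmostComplex

variable {M : Type*} [TopologicalSpace M] [ChartedSpace E6 M] {k : ℕ}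

/-- A field of endomorphisms of the tangent spaces, in the preferred chart at `x₀`. -/
def localEnd (J : ∀ x : M, TangentSpace (𝓡 6) x →L[ℝ] TangentSpace (𝓡 6) x) (x₀ : M) (y : E6) :
    E6 →L[ℝ] E6 :=
  chartDeriv x₀ ((chartAt E6 x₀).symm y) ∘L
    (J ((chartAt E6 x₀).symm y) : E6 →L[ℝ] E6) ∘L chartInvDeriv x₀ y

variable [IsManifold (𝓡 6) ∞ M]
  {J : ∀ x : M, TangentSpace (𝓡 6) x →L[ℝ] TangentSpace (𝓡 6) x}

theorem chartInvDeriv_localEnd {x₀ : M} {y : E6} (hy : y ∈ (chartAt E6 x₀).target) (v : E6) :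
    chartInvDeriv x₀ y (localEnd J x₀ y v) =
      J ((chartAt E6 x₀).symm y) (chartInvDeriv x₀ y v) :=
  chartInvDeriv_chartDeriv hy _

theorem localRep_hodgeProj (p q : ℤ) (η : Form M k) {x₀ : M} {y : E6}
    (hy : y ∈ (chartAt E6 x₀).target) :
    localRep (hodgeProj J p q η) x₀ y = typeProj (localEnd J x₀ y) p q (localRep η x₀ y) :=
  typeProj_compContinuousLinearMap (V := E6) (W := E6) (chartInvDeriv x₀ y)
    (J := J ((chartAt E6 x₀).symm y)) (chartInvDeriv_localEnd hy) p q
    (formAt η ((chartAt E6 x₀).symm y))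

/-- A smooth section of the bundle of endomorphisms is smooth in every preferred chart: the
trivialization of that bundle at `x₀` is conjugation by the derivative of the chart at `x₀`. -/
theorem contDiffOn_localEnd
    (hJ : ContMDiff (𝓡 6) ((𝓡 6).prod 𝓘(ℝ, E6 →L[ℝ] E6)) ∞
      (fun x => Bundle.TotalSpace.mk' (E6 →L[ℝ] E6)
        (E := fun x : M => TangentSpace (𝓡 6) x →L[ℝ] TangentSpace (𝓡 6) x) x (J x)))
    (x₀ : M) : ContDiffOn ℝ ∞ (localEnd J x₀) (chartAt E6 x₀).target := by
  intro y hy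
  refine ContDiffAt.contDiffWithinAt ?_
  set x := (chartAt E6 x₀).symm y with hx
  have hxs : x ∈ (chartAt E6 x₀).source := (chartAt E6 x₀).map_target hy
  have h1 := ((trivializationAt (E6 →L[ℝ] E6)
    (fun x : M => TangentSpace (𝓡 6) x →L[ℝ] TangentSpace (𝓡 6) x) x₀).contMDiffAt_iff
      (f := fun x => Bundle.TotalSpace.mk' (E6 →L[ℝ] E6)
        (E := fun x : M => TangentSpace (𝓡 6) x →L[ℝ] TangentSpace (𝓡 6) x) x (J x))
      (x₀ := x) (by simpa using hxs)).1 hJ.contMDiffAt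
  have h2 : ContMDiffAt (𝓡 6) 𝓘(ℝ, E6 →L[ℝ] E6) ∞
      (fun z : M => inTangentCoordinates (𝓡 6) (𝓡 6) id id J x₀ z) x := h1.2
  have h3 : ContMDiffAt (𝓡 6) 𝓘(ℝ, E6 →L[ℝ] E6) ∞
      (fun z : E6 => inTangentCoordinates (𝓡 6) (𝓡 6) id id J x₀ ((chartAt E6 x₀).symm z)) y :=
    h2.comp y (contMDiffAt_chart_symm hy)
  refine (contMDiffAt_iff_contDiffAt.1 h3).congr_of_eventuallyEq ?_
  filter_upwards [(chartAt E6 x₀).open_target.mem_nhds hy] with z hz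
  have hzs := (chartAt E6 x₀).map_target hz
  have : IsManifold (𝓡 6) 1 M := .of_le (n := ∞) (by norm_num)
  refine Eq.trans ?_ (inTangentCoordinates_eq_mfderiv_comp (I := 𝓡 6) (I' := 𝓡 6) (f := id)
    (g := id) (ϕ := J) (x₀ := x₀) hzs hzs).symm
  have e1 : extChartAt (𝓡 6) x₀ ((chartAt E6 x₀).symm z) = z := (chartAt E6 x₀).right_inv hz
  have e2 : (mfderivWithin (𝓡 6) (𝓡 6) (extChartAt (𝓡 6) x₀).symm (Set.range (𝓡 6))
      (extChartAt (𝓡 6) x₀ ((chartAt E6 x₀).symm z)) : E6 →L[ℝ] E6) = chartInvDeriv x₀ z := by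
    rw [e1, ModelWithCorners.range_eq_univ, mfderivWithin_univ]
    rfl
  exact congrArg (fun A : E6 →L[ℝ] E6 => chartDeriv x₀ ((chartAt E6 x₀).symm z) ∘L
    (J ((chartAt E6 x₀).symm z) : E6 →L[ℝ] E6) ∘L A) e2.symm

theorem isAlmostComplexOn_localEnd
    (hJ : ContMDiff (𝓡 6) ((𝓡 6).prod 𝓘(ℝ, E6 →L[ℝ] E6)) ∞
      (fun x => Bundle.TotalSpace.mk' (E6 →L[ℝ] E6)
        (E := fun x : M => TangentSpace (𝓡 6) x →L[ℝ] TangentSpace (𝓡 6) x) x (J x)))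
    (hsq : ∀ x v, J x (J x v) = -v) (x₀ : M) :
    IsAlmostComplexOn (localEnd J x₀) (chartAt E6 x₀).target where
  isOpen := (chartAt E6 x₀).open_target
  smooth := contDiffOn_localEnd hJ x₀
  sq y hy v := by
    change chartDeriv x₀ _ (J _ (chartInvDeriv x₀ y (localEnd J x₀ y v))) = -v
    rw [chartInvDeriv_localEnd hy]
    have h : J ((chartAt E6 x₀).symm y) (J ((chartAt E6 x₀).symm y) (chartInvDeriv x₀ y v)) =
      -(chartInvDeriv x₀ y v) := hsq _ _
    rw [h]
    exact (map_neg (chartDeriv x₀ ((chartAt E6 x₀).symm y)) _).trans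
      (congrArg Neg.neg (chartDeriv_chartInvDeriv hy v))

section Components

variable (h : ∀ x₀ : M, IsAlmostComplexOn (localEnd J x₀) (chartAt E6 x₀).target)

include h

theorem IsSmooth.hodgeProj {η : Form M k} (hη : IsSmooth η) (p q : ℤ) :
    IsSmooth (hodgeProj J p q η) := fun x₀ =>
  (contDiffOn_typeProj (h x₀).smooth (hη x₀) p q).congr fun _ hy => localRep_hodgeProj p q η hy

theorem localRep_dComp {η : Form M k} (hη : IsSmooth η) (i j : ℤ) {x₀ : M} {y : E6}
    (hy : y ∈ (chartAt E6 x₀).target) :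
    localRep (dComp J i j η) x₀ y = locComp (localEnd J x₀) i j (localRep η x₀) y := by
  rw [dComp, localRep_sum, locComp]
  refine Finset.sum_congr rfl fun pq _ => ?_
  have hev : localRep (NK.hodgeProj J pq.1 pq.2 η) x₀ =ᶠ[nhds y]
      fun z => typeProj (localEnd J x₀ z) pq.1 pq.2 (localRep η x₀ z) :=
    Filter.mem_of_superset ((chartAt E6 x₀).open_target.mem_nhds hy)
      fun z hz => localRep_hodgeProj _ _ η hz
  rw [localRep_hodgeProj _ _ _ hy, localRep_deRham (hη.hodgeProj h _ _) hy, hev.extDeriv_eq]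

theorem IsSmooth.dComp {η : Form M k} (hη : IsSmooth η) (i j : ℤ) :
    IsSmooth (dComp J i j η) := fun x₀ =>
  (contDiffOn_locComp (h x₀) (hη x₀) i j).congr fun _ hy => localRep_dComp h hη i j hy

/-- The coordinate expression of `d^{i,j} η` only depends on `η` on the chart domain. -/
theorem localRep_dComp_congr {η : Form M k} (hη : IsSmooth η) (i j : ℤ) {x₀ : M}
    {β : E6 → E6 [⋀^Fin k]→L[ℝ] ℂ} (hβ : ∀ z ∈ (chartAt E6 x₀).target, localRep η x₀ z = β z)
    {y : E6} (hy : y ∈ (chartAt E6 x₀).target) :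
    localRep (dComp J i j η) x₀ y = locComp (localEnd J x₀) i j β y := by
  rw [localRep_dComp h hη i j hy, locComp, locComp]
  refine Finset.sum_congr rfl fun pq _ => ?_
  have hev : (fun z => typeProj (localEnd J x₀ z) pq.1 pq.2 (localRep η x₀ z)) =ᶠ[nhds y]
      fun z => typeProj (localEnd J x₀ z) pq.1 pq.2 (β z) :=
    Filter.mem_of_superset ((chartAt E6 x₀).open_target.mem_nhds hy) fun z hz => by
      change typeProj _ _ _ _ = typeProj _ _ _ _
      rw [hβ z hz]
  rw [hev.extDeriv_eq]

end Components

end AlmostComplex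

section NearlyKahler

variable {M : Type*} [TopologicalSpace M] [ChartedSpace E6 M] [IsManifold (𝓡 6) ∞ M] {k : ℕ}

/-- The metric of an `SU(3)`-structure in the preferred chart at `x₀`. -/
def SU3Structure.localMetric (s : SU3Structure M) (x₀ : M) (y : E6) : E6 →L[ℝ] E6 →L[ℝ] ℝ :=
  ContinuousLinearMap.bilinearComp
    (s.g.inner ((chartAt E6 x₀).symm y) : E6 →L[ℝ] E6 →L[ℝ] ℝ)
    (chartInvDeriv x₀ y) (chartInvDeriv x₀ y)

theorem SU3Structure.localMetric_apply (s : SU3Structure M) (x₀ : M) (y u v : E6) :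
    s.localMetric x₀ y u v = s.g.inner ((chartAt E6 x₀).symm y) (chartInvDeriv x₀ y u)
      (chartInvDeriv x₀ y v) := rfl

variable {s : SU3Structure M} {lam : ℝ}

theorem SU3Structure.isAlmostComplexOn (s : SU3Structure M) (x₀ : M) :
    IsAlmostComplexOn (localEnd s.J x₀) (chartAt E6 x₀).target :=
  isAlmostComplexOn_localEnd s.J_smooth s.J_sq x₀

theorem SU3Structure.isHermitianStructure (s : SU3Structure M) {x₀ : M} {y : E6}
    (hy : y ∈ (chartAt E6 x₀).target) :
    IsHermitianStructure (localEnd s.J x₀ y) (s.localMetric x₀ y) where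
  sq := (s.isAlmostComplexOn x₀).sq y hy
  symm u v := s.g.symm _ _ _
  pos v hv := by
    have h1 : chartInvDeriv x₀ y v ≠ 0 := fun h0 =>
      hv (by rw [← chartDeriv_chartInvDeriv hy v, h0, map_zero])
    exact s.g.pos ((chartAt E6 x₀).symm y) (chartInvDeriv x₀ y v) h1
  orth u v := by
    rw [s.localMetric_apply, chartInvDeriv_localEnd hy, chartInvDeriv_localEnd hy]
    exact s.J_orthogonal _ _ _

/-- The coordinate expression of a nearly Kähler structure in a preferred chart. -/
theorem SU3Structure.IsNearlyKahler.isNearlyKahlerOn (hs : s.IsNearlyKahler lam) (x₀ : M) :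
    IsNearlyKahlerOn (localEnd s.J x₀) (s.localMetric x₀) (localRep s.omega x₀)
      (localRep s.Omega x₀) lam (chartAt E6 x₀).target where
  toIsAlmostComplexOn := s.isAlmostComplexOn x₀
  finrank := finrank_euclideanSpace_fin
  hermitian y hy := s.isHermitianStructure hy
  omega_smooth := s.omega_smooth x₀
  omega_apply y hy u v := by
    have h1 : (fun i => chartInvDeriv x₀ y (![u, v] i)) =
        ![chartInvDeriv x₀ y u, chartInvDeriv x₀ y v] := by
      funext i; fin_cases i <;> rfl
    rw [localRep_apply, h1]
    refine (s.omega_apply _ _ _).trans ?_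
    change _ = ((s.localMetric x₀ y (localEnd s.J x₀ y u) v : ℝ) : ℂ)
    rw [s.localMetric_apply, chartInvDeriv_localEnd hy]
  Omega_smooth := s.Omega_section.smooth x₀
  Omega_type y hy := by rw [← localRep_hodgeProj 3 0 s.Omega hy, s.Omega_section.type]
  Omega_unit y hy e he heJ := by
    rw [localRep_apply]
    refine s.Omega_unit _ _ he fun a b => ?_
    have := heJ a b
    rwa [s.localMetric_apply, chartInvDeriv_localEnd hy] at this
  ne_zero := hs.ne_zero
  d_omega y hy := by
    rw [← localRep_deRham s.omega_smooth hy, hs.d_omega, localRep_smul, localRep_rePart]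
  d_im y hy := by
    have h1 : IsSmooth s.Omega.imPart := fun x₀ => contDiffOn_imForm (s.Omega_section.smooth x₀)
    have h2 := localRep_deRham h1 hy
    rw [hs.d_im, localRep_smul, localRep_wedge] at h2
    exact h2.symm

theorem localRep_type {η : Form M k} {p q : ℤ} (hη : IsSection s.J p q η) {x₀ : M} {y : E6}
    (hy : y ∈ (chartAt E6 x₀).target) :
    typeProj (localEnd s.J x₀ y) p q (localRep η x₀ y) = localRep η x₀ y := by
  rw [← localRep_hodgeProj p q η hy, hη.type]

/-- `C² η = 2 √-1 λ² (p - q) η ∧ ω` on forms of type `(p,q)`. -/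
theorem SU3Structure.IsNearlyKahler.opC_opC (hs : s.IsNearlyKahler lam) {p q : ℤ} {η : Form M k}
    (hη : IsSection s.J p q η) : opC s.J (opC s.J η) =
      (2 * Complex.I * (lam : ℂ) ^ 2 * ((p : ℂ) - q)) • Form.wedge η s.omega := by
  have h := s.isAlmostComplexOn
  have hC : IsSmooth (opC s.J η) := (hη.smooth.dComp h 2 (-1)).add (hη.smooth.dComp h (-1) 2)
  refine form_ext fun x₀ y hy => ?_
  have hCl : ∀ z ∈ (chartAt E6 x₀).target, localRep (opC s.J η) x₀ z =
      locComp (localEnd s.J x₀) 2 (-1) (localRep η x₀) z +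
        locComp (localEnd s.J x₀) (-1) 2 (localRep η x₀) z := fun z hz => by
    rw [opC, localRep_add, nij, nijbar, localRep_dComp h hη.smooth _ _ hz,
      localRep_dComp h hη.smooth _ _ hz]
  rw [localRep_smul, localRep_wedge, ← (hs.isNearlyKahlerOn x₀).locC_locC hy (hη.smooth x₀)
    fun z hz => localRep_type hη hz, opC, localRep_add, nij, nijbar,
    localRep_dComp_congr h hC _ _ hCl hy, localRep_dComp_congr h hC _ _ hCl hy]

/-- `-(∂∂̄ + ∂̄∂) η = 2 √-1 λ² (p - q) η ∧ ω` on forms of type `(p,q)`. -/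
theorem SU3Structure.IsNearlyKahler.neg_anticommutator (hs : s.IsNearlyKahler lam) {p q : ℤ}
    (hpq : p + q = k) {η : Form M k} (hη : IsSection s.J p q η) :
    -(del s.J (delbar s.J η) + delbar s.J (del s.J η)) =
      (2 * Complex.I * (lam : ℂ) ^ 2 * ((p : ℂ) - q)) • Form.wedge η s.omega := by
  have h := s.isAlmostComplexOn
  refine form_ext fun x₀ y hy => ?_
  rw [localRep_smul, localRep_wedge, ← (hs.isNearlyKahlerOn x₀).locC_locC_eq hy hpq (hη.smooth x₀)
    fun z hz => localRep_type hη hz, localRep_neg, localRep_add, del, del, delbar, delbar,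
    localRep_dComp_congr h (hη.smooth.dComp h 0 1) _ _
      (fun z hz => localRep_dComp h hη.smooth _ _ hz) hy,
    localRep_dComp_congr h (hη.smooth.dComp h 1 0) _ _
      (fun z hz => localRep_dComp h hη.smooth _ _ hz) hy]

theorem SU3Structure.IsNearlyKahler.isSection_wedge (hs : s.IsNearlyKahler lam) {p q : ℤ}
    (hpq : p + q = k) {η : Form M k} (hη : IsSection s.J p q η) (c : ℂ) :
    IsSection s.J (p + 1) (q + 1) (c • Form.wedge η s.omega) where
  smooth := (hη.smooth.wedge s.omega_smooth).const_smul c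
  type := form_ext fun x₀ y hy => by
    rw [localRep_hodgeProj _ _ _ hy, localRep_smul, localRep_wedge, typeProj_smul,
      (hs.isNearlyKahlerOn x₀).typeProj_wedge hy hpq (localRep_type hη hy)]

theorem IsSection.add {η θ : Form M k} {p q : ℤ} (hη : IsSection s.J p q η)
    (hθ : IsSection s.J p q θ) : IsSection s.J p q (η + θ) where
  smooth := hη.smooth.add hθ.smooth
  type := form_ext fun x₀ y hy => by
    rw [localRep_hodgeProj _ _ _ hy, localRep_add, typeProj_add, localRep_type hη hy,
      localRep_type hθ hy]

theorem IsSection.funMul {η : Form M k} {p q : ℤ} (hη : IsSection s.J p q η) {f : M → ℂ}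
    (hf : ContMDiff (𝓡 6) 𝓘(ℝ, ℂ) ∞ f) : IsSection s.J p q (Form.funMul f η) where
  smooth x₀ := by
    have h1 : ContDiffOn ℝ ∞ (f ∘ (chartAt E6 x₀).symm) (chartAt E6 x₀).target :=
      contMDiffOn_iff_contDiffOn.1
        (hf.comp_contMDiffOn (contMDiffOn_chart_symm (I := 𝓡 6)))
    exact h1.smul (hη.smooth x₀)
  type := form_ext fun x₀ y hy => by
    rw [localRep_hodgeProj _ _ _ hy, localRep_funMul, typeProj_smul, localRep_type hη hy]

end NearlyKahler

end NK

end

theorem mainTheorem7 {M : Type*} [TopologicalSpace M] [T2Space M] [SecondCountableTopology M]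
    [ChartedSpace NK.E6 M] [IsManifold (𝓡 6) ∞ M]
    (s : NK.SU3Structure M) (lam : ℝ) (hs : s.IsNearlyKahler lam) (p q : ℕ) :
    -- the three operators map `Λ^{p,q}(M)` to `Λ^{p+1,q+1}(M)` and coincide there
    (∀ η : NK.Form M (p + q), NK.IsSection s.J p q η →
      NK.IsSection s.J (p + 1) (q + 1) (NK.opC s.J (NK.opC s.J η)) ∧
      NK.opC s.J (NK.opC s.J η) =
        -(NK.del s.J (NK.delbar s.J η) + NK.delbar s.J (NK.del s.J η)) ∧
      NK.opC s.J (NK.opC s.J η) =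
        (2 * Complex.I * (lam : ℂ) ^ 2 * ((p : ℂ) - (q : ℂ))) • NK.Form.wedge η s.omega) ∧
    -- and they are linear over smooth functions
    (∀ η θ : NK.Form M (p + q), NK.IsSection s.J p q η → NK.IsSection s.J p q θ →
      NK.opC s.J (NK.opC s.J (η + θ)) =
        NK.opC s.J (NK.opC s.J η) + NK.opC s.J (NK.opC s.J θ)) ∧
    (∀ (f : M → ℂ) (η : NK.Form M (p + q)), ContMDiff (𝓡 6) 𝓘(ℝ, ℂ) ∞ f →
      NK.IsSection s.J p q η →
      NK.opC s.J (NK.opC s.J (NK.Form.funMul f η)) =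
        NK.Form.funMul f (NK.opC s.J (NK.opC s.J η))) := by
  have hpq : (p : ℤ) + (q : ℤ) = ((p + q : ℕ) : ℤ) := by push_cast; rfl
  have hC : ∀ η : NK.Form M (p + q), NK.IsSection s.J p q η → NK.opC s.J (NK.opC s.J η) =
      (2 * Complex.I * (lam : ℂ) ^ 2 * ((p : ℂ) - (q : ℂ))) • NK.Form.wedge η s.omega := by
    intro η hη
    exact_mod_cast hs.opC_opC hη
  refine ⟨fun η hη => ⟨?_, ?_, hC η hη⟩, fun η θ hη hθ => ?_, fun f η hf hη => ?_⟩
  · rw [hC η hη]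
    exact hs.isSection_wedge hpq hη _
  · rw [hC η hη]
    exact_mod_cast (hs.neg_anticommutator hpq hη).symm
  · rw [hC η hη, hC θ hθ, hC _ (hη.add hθ), NK.Form.wedge_add_left, smul_add]
  · rw [hC η hη, hC _ (hη.funMul hf), NK.Form.wedge_funMul_left]
    exact NK.Form.smul_funMul _ f _
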